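/- **Setting.** Let $\mathcal D$ be the set of dyadic intervals $[k2^{-n},(k+1)2^{-n})$ of $\mathbb R$ ($n,k\in\mathbb Z$); for $I\in\mathcal D$ let $I^-$, $I^+$ be its left and right halves and $h_I=|I|^{-1/2}(\chi_{I^+}-\chi_{I^-})$. For a dyadic rectangle $R=I\times J$ put $h_R(s,t)=h_I(s)h_J(t)$ and, for a locally square integrable $f:\mathbb R^2\to\mathbb C$, $f_R=\int f\,h_R$. Let $$\|f\|_{\mathrm{BMO}^d(\mathbb R^2)}=\sup_{\Omega}\Big(\frac1{|\Omega|}\sum_{R\subseteq\Omega}|f_R|^2\Big)^{1/2},$$ the supremum being over all non-empty open $\Omega\subseteq\mathbb R^2$ of finite measure. $\mathrm{BMO}^d(\mathbb R^2)$ is the space of locally square integrable $f$ for which this is finite, and $\mathrm{BMO}^d([0,1]^2)$ consists of those $f\in\mathrm{BMO}^d(\mathbb R^2)$ that vanish almost everywhere outside $[0,1]^2$. For $f\in L^2(\mathbb R^2)$ and $\vec k=(k_1,k_2)\in\mathbb N_0^2$ let $Q_{\vec k}f=\sum_{|I|\le 2^{-k_1},\,|J|\le 2^{-k_2}}f_{I\times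 J}\,h_{I\times J}$. $\mathrm{LMO}^d([0,1]^2)$ is the space of $f\in\mathrm{BMO}^d([0,1]^2)$ for which there is $C<\infty$ with $$\|Q_{\vec k}f\|_{\mathrm{BMO}^d(\mathbb R^2)}\le\frac{C}{(k_1+1)(k_2+1)}\qquad(\vec k\in\mathbb N_0^2),$$ and $\|f\|_{\mathrm{LMO}^d}$ denotes the infimum of such $C$. Let $S$ be the dyadic shift, the bounded linear operator on $L^2(\mathbb R)$ with $Sh_I=h_{I^+}-h_{I^-}$ for all $I\in\mathcal D$, and let $S^{(1)}=S\otimes 1$, $S^{(2)}=1\otimes S$ on $L^2(\mathbb R^2)$. Write $\phi$ also for the operator of multiplication by $\phi$, so that $$[S^{(1)},[S^{(2)},\phi]]\,b=S^{(1)}S^{(2)}(\phi b)-S^{(1)}(\phi\, S^{(2)}b)-S^{(2)}(\phi\, S^{(1)}b)+\phi\, S^{(2)}S^{(1)}b .$$ **Theorem.** There is an absolute constant $C<\infty$ such that the following holds. Let $\phi\in\mathrm{LMO}^d([0,1]^2)$ belong to $L^2_0([0,1]^2)$, that is, $\int\phi(s,t)\,dt=0$ for almost every $s$ and $\int\phi(s,t)\,ds=0$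 for almost every $t$. Then for every $b\in\mathrm{BMO}^d([0,1]^2)$ the products $\phi b$, $\phi S^{(1)}b$, $\phi S^{(2)}b$, $\phi S^{(2)}S^{(1)}b$ belong to $L^2(\mathbb R^2)$, so that $[S^{(1)},[S^{(2)},\phi]]\,b$ is defined, and $[S^{(1)},[S^{(2)},\phi]]\,b\in\mathrm{BMO}^d(\mathbb R^2)$ with $$\big\|[S^{(1)},[S^{(2)},\phi]]\,b\big\|_{\mathrm{BMO}^d(\mathbb R^2)}\le C\,\|\phi\|_{\mathrm{LMO}^d}\,\|b\|_{\mathrm{BMO}^d(\mathbb R^2)} .$$ -/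

import Mathlib

open MeasureTheory Set
open scoped ENNReal

/-- A dyadic interval of `ℝ`, coded by its generation and its position:
it stands for `[pos * 2 ^ (-gen), (pos + 1) * 2 ^ (-gen))`. -/
structure DyadicInterval where
  gen : ℤ
  pos : ℤ

namespace DyadicInterval

/-- The length `|I| = 2 ^ (-gen)`. -/
noncomputable def length (I : DyadicInterval) : ℝ := (2 : ℝ) ^ (-I.gen)

/-- The interval as a set of reals. -/
def toSet (I : DyadicInterval) : Set ℝ :=
  Ico ((I.pos : ℝ) * I.length) (((I.pos : ℝ) + 1) * I.length)

/-- The left half `I⁻`. -/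
def left (I : DyadicInterval) : DyadicInterval := ⟨I.gen + 1, 2 * I.pos⟩

/-- The right half `I⁺`. -/
def right (I : DyadicInterval) : DyadicInterval := ⟨I.gen + 1, 2 * I.pos + 1⟩

/-- The Haar function `h_I = |I| ^ (-1/2) (χ_{I⁺} - χ_{I⁻})`. -/
noncomputable def haar (I : DyadicInterval) (x : ℝ) : ℝ :=
  I.length ^ (-(1 / 2) : ℝ) *
    (I.right.toSet.indicator (fun _ => (1 : ℝ)) x - I.left.toSet.indicator (fun _ => (1 : ℝ)) x)

theorem length_pos (I : DyadicInterval) : 0 < I.length := by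
  unfold length; positivity

theorem memLp_haar (I : DyadicInterval) : MemLp I.haar 2 := by
  have h (K : DyadicInterval) : MemLp (K.toSet.indicator (fun _ => (1 : ℝ))) 2 :=
    memLp_indicator_const 2 measurableSet_Ico 1 (Or.inr measure_Ico_lt_top.ne)
  exact ((h I.right).sub (h I.left)).const_mul _

end DyadicInterval

/-- A dyadic rectangle `R = I × J` of `ℝ²`. -/
abbrev DyadicRect := DyadicInterval × DyadicInterval

namespace DyadicRect

/-- The rectangle as a subset of the plane. -/
def toSet (R : DyadicRect) : Set (ℝ × ℝ) := R.1.toSet ×ˢ R.2.toSet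

/-- The product Haar function `h_R(s, t) = h_I(s) h_J(t)`. -/
noncomputable def haar (R : DyadicRect) (z : ℝ × ℝ) : ℂ :=
  ((R.1.haar z.1 * R.2.haar z.2 : ℝ) : ℂ)

theorem memLp_haar (R : DyadicRect) : MemLp R.haar 2 := by
  have h1 := R.1.memLp_haar
  have h2 := R.2.memLp_haar
  have hm : AEStronglyMeasurable (fun z : ℝ × ℝ => R.1.haar z.1 * R.2.haar z.2) volume :=
    h1.1.comp_fst.mul h2.1.comp_snd
  have hr : MemLp (fun z : ℝ × ℝ => R.1.haar z.1 * R.2.haar z.2) 2 := by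
    rw [memLp_two_iff_integrable_sq hm]
    simp only [mul_pow]
    exact h1.integrable_sq.mul_prod h2.integrable_sq
  exact hr.ofReal

end DyadicRect

/-- The Hilbert space `L²(ℝ²)` (complex valued functions, Lebesgue measure). -/
noncomputable abbrev L2Plane := Lp ℂ 2 (volume : Measure (ℝ × ℝ))

/-- The Haar function `h_R` as an element of `L²(ℝ²)`. -/
noncomputable def haarL2 (R : DyadicRect) : L2Plane := (DyadicRect.memLp_haar R).toLp R.haar

/-- The Haar coefficient `f_R = ⟨f, h_R⟩` of a locally square integrable function. -/
noncomputable def haarCoeff (f : ℝ × ℝ → ℂ) (R : DyadicRect) : ℂ := ∫ z, f z * R.haar z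

/-- The norm of the dyadic product space `BMO^d(ℝ²)`, with values in `[0, ∞]`: the supremum over
the non-empty open sets `Ω` of finite measure of `(|Ω|⁻¹ ∑_{R ⊆ Ω} |f_R|²) ^ (1/2)`. -/
noncomputable def bmoNorm (f : ℝ × ℝ → ℂ) : ℝ≥0∞ :=
  ⨆ (Ω : Set (ℝ × ℝ)) (_ : IsOpen Ω) (_ : Ω.Nonempty) (_ : volume Ω < ∞),
    ((∑' R : {R : DyadicRect // R.toSet ⊆ Ω}, ‖haarCoeff f R.1‖ₑ ^ 2) / volume Ω) ^ (1 / 2 : ℝ)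

/-- `f ∈ BMO^d(ℝ²)`. -/
def MemBMOd (f : ℝ × ℝ → ℂ) : Prop :=
  (∀ K : Set (ℝ × ℝ), IsCompact K → MemLp f 2 (volume.restrict K)) ∧ bmoNorm f < ∞

/-- The closed unit square `[0,1]²`. -/
def unitSquare : Set (ℝ × ℝ) := Icc (0 : ℝ) 1 ×ˢ Icc (0 : ℝ) 1

/-- `f ∈ BMO^d([0,1]²)`: `f ∈ BMO^d(ℝ²)` and `f` vanishes almost everywhere off `[0,1]²`. -/
def MemBMOdUnit (f : ℝ × ℝ → ℂ) : Prop :=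
  MemBMOd f ∧ ∀ᵐ z, z ∉ unitSquare → f z = 0

/-- For `f` supported in `[0,1]²` this says `f ∈ L²₀([0,1]²)`: the integral over each variable
vanishes for almost every value of the other one. -/
def MarginalsVanish (f : ℝ × ℝ → ℂ) : Prop :=
  (∀ᵐ s : ℝ, ∫ t : ℝ, f (s, t) = 0) ∧ (∀ᵐ t : ℝ, ∫ s : ℝ, f (s, t) = 0)

/-- The projection `Q_k f = ∑ ⟨f, h_{I × J}⟩ h_{I × J}`, over the dyadic rectangles with
`|I| ≤ 2 ^ (-k₁)` and `|J| ≤ 2 ^ (-k₂)`. The series converges in `L²(ℝ²)`, since the `h_R` are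
orthonormal. -/
noncomputable def projQ (k : ℕ × ℕ) (f : L2Plane) : L2Plane :=
  ∑' R : {R : DyadicRect // (k.1 : ℤ) ≤ R.1.gen ∧ (k.2 : ℤ) ≤ R.2.gen},
    haarCoeff f R.1 • haarL2 R.1

/-- The infimum of the constants `C` with `‖Q_k f‖_{BMO^d(ℝ²)} ≤ C / ((k₁ + 1) (k₂ + 1))` for all
`k ∈ ℕ₀ × ℕ₀` (it is `∞` if there is no finite such constant). -/
noncomputable def lmoNorm (f : L2Plane) : ℝ≥0∞ :=
  sInf {C : ℝ≥0∞ | ∀ k : ℕ × ℕ,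
    bmoNorm (projQ k f) ≤ C / (((k.1 : ℝ≥0∞) + 1) * ((k.2 : ℝ≥0∞) + 1))}

/-- `f ∈ LMO^d([0,1]²)`. -/
def MemLMOdUnit (f : L2Plane) : Prop := MemBMOdUnit f ∧ lmoNorm f < ∞

/-- The dyadic shift in the first variable, `S⁽¹⁾ = S ⊗ 1`, where `S h_I = h_{I⁺} - h_{I⁻}`.
The series converges in `L²(ℝ²)`: its terms are pairwise orthogonal, and the coefficients are
square summable. -/
noncomputable def shift₁ (f : L2Plane) : L2Plane :=
  ∑' R : DyadicRect, haarCoeff f R • (haarL2 (R.1.right, R.2) - haarL2 (R.1.left, R.2))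

/-- The dyadic shift in the second variable, `S⁽²⁾ = 1 ⊗ S`. -/
noncomputable def shift₂ (f : L2Plane) : L2Plane :=
  ∑' R : DyadicRect, haarCoeff f R • (haarL2 (R.1, R.2.right) - haarL2 (R.1, R.2.left))

/-- The pointwise product `φ f` lies in `L²(ℝ²)`, i.e. `f` is in the domain of the operator of
multiplication by `φ`. -/
def InMulDomain (φ f : L2Plane) : Prop := MemLp (fun z => φ z * f z) 2

open Classical in
/-- Multiplication by `φ` on `L²(ℝ²)`, with the value `0` off its domain. -/
noncomputable def mulL2 (φ f : L2Plane) : L2Plane :=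
  if h : InMulDomain φ f then MemLp.toLp (fun z => φ z * f z) h else 0

/-- The commutator `[A, B] = A B - B A`. -/
noncomputable def opCommutator (A B : L2Plane → L2Plane) (f : L2Plane) : L2Plane :=
  A (B f) - B (A f)

/-- The iterated commutator `[S⁽¹⁾, [S⁽²⁾, φ]]`. -/
noncomputable def shiftCommutator (φ : L2Plane) : L2Plane → L2Plane :=
  opCommutator shift₁ (opCommutator shift₂ (mulL2 φ))

/-- All products with `φ` that occur in `[S⁽¹⁾, [S⁽²⁾, φ]] b` are in `L²(ℝ²)`, so that this is
defined. -/
def InCommutatorDomain (φ b : L2Plane) : Prop :=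
  InMulDomain φ b ∧ InMulDomain φ (shift₁ b) ∧ InMulDomain φ (shift₂ b) ∧
    InMulDomain φ (shift₂ (shift₁ b))

/-! ### Dyadic intervals, products of Haar functions and the one-variable commutator kernel. -/

namespace DyadicInterval

/-! Expand `φ = ∑ φ_R h_R` and `b = ∑ b_N h_N`. The `Q`-th Haar coefficient of the commutator is
`∑_R φ_R ∑_N b_N k(R₁,N₁,Q₁) k(R₂,N₂,Q₂)`, where `k(K,I,Q) = ⟨[S,h_K] h_I, h_Q⟩`. If `K` is much
larger than `I`, then `h_K` is constant near `I` and commutes with `S`, so that paraproduct cancels.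
By `kernel_eq` five terms survive, each a factor in `(K,I)` times a factor in `(K,Q)`. The factor in
`(K,I)` is either local (`I` is `K` or its parent) or, up to passage to a parent, the mean of `h_I`
over `K`. A term of the second kind sums `b` over all ancestors of `K`; the logarithmic gain in LMO
pays for this sum.

The BMO bound is dualised: finite families of coefficients are tested against a finite sequence `g`,
and each of the 25 pairs of terms is bounded separately (`sq_sum_pair_le`). Zero marginals of `φ`
leave only rectangles inside the unit square. The coefficients of `b` at large intervals decay
geometrically, so these intervals are absorbed into `[0,2)`, and this is why ancestors are taken of
length at most two.

Local in both variables: Carleson embedding and the strong maximal function (`sq_sum_mul_avg_le`).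

Ancestors in both variables (`sum_mul_sq_ancSum₂_le`): Cauchy–Schwarz with weights `√(m+1)` in the
generation `m`, then a splitting into blocks in which `m+1` varies by a factor 4. LMO gains the
square of `(m+1)(n+1)`. One power is lost because the rectangles of generations at most `(m,n)` that
lie in `U ∩ R'` cover at most `|R'| (m+1)(n+1) u(R')`. The weight `u` is dominated by a logarithmic
maximal function of `U` whose integral is at most `4|U|` (`lintegral_logMax₂_le`); this estimate
does the work of a covering lemma. The other power makes the block sums geometric.

Mixed terms (`sq_sum_ancSum₁_le`): the H¹–BMO inequality `sum_mul_sq_le` in each block, a product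
bound for the square function, and the one-variable logarithmic maximal function.

The products lie in `L²` because all factors lie in `L⁴` of the unit square. This is a
John–Nirenberg inequality, obtained from a Hilbert-space valued fourth moment bound for Haar sums,
used once in each variable. -/

theorem eq_of_gen_pos {I J : DyadicInterval} (h1 : I.gen = J.gen) (h2 : I.pos = J.pos) : I = J := by
  cases I; cases J; simp_all

instance : Countable DyadicInterval :=
  Function.Injective.countable (f := fun I : DyadicInterval => (I.gen, I.pos))
    fun I J h => by
      simp only [Prod.mk.injEq] at h
      exact eq_of_gen_pos h.1 h.2

noncomputable instance : DecidableEq DyadicInterval := Classical.decEq _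

/-- The dyadic interval of generation `n` containing `x`. -/
noncomputable def cell (n : ℤ) (x : ℝ) : DyadicInterval := ⟨n, ⌊x * 2 ^ n⌋⟩

/-- The dyadic parent. -/
def parent (I : DyadicInterval) : DyadicInterval := ⟨I.gen - 1, I.pos / 2⟩

/-- The `n`-th dyadic ancestor. -/
def anc (n : ℕ) (I : DyadicInterval) : DyadicInterval := parent^[n] I

/-- `1` for right children, `-1` for left children. -/
noncomputable def sgn (I : DyadicInterval) : ℝ := if I.pos % 2 = 1 then 1 else -1

/-- The height `|I| ^ (-1/2)` of the Haar function. -/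
noncomputable def amp (I : DyadicInterval) : ℝ := I.length ^ (-(1 / 2) : ℝ)

@[simp] theorem cell_gen (n : ℤ) (x : ℝ) : (cell n x).gen = n := rfl

@[simp] theorem parent_gen (I : DyadicInterval) : I.parent.gen = I.gen - 1 := rfl

@[simp] theorem right_gen (I : DyadicInterval) : I.right.gen = I.gen + 1 := rfl

@[simp] theorem left_gen (I : DyadicInterval) : I.left.gen = I.gen + 1 := rfl

@[simp] theorem anc_zero (I : DyadicInterval) : anc 0 I = I := rfl

theorem anc_succ (n : ℕ) (I : DyadicInterval) : anc (n + 1) I = (anc n I).parent :=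
  Function.iterate_succ_apply' ..

theorem mem_toSet_iff {I : DyadicInterval} {x : ℝ} : x ∈ I.toSet ↔ cell I.gen x = I := by
  have h2 : (0 : ℝ) < 2 ^ I.gen := by positivity
  have hl : I.length = (2 ^ I.gen)⁻¹ := by rw [length, zpow_neg]
  have : cell I.gen x = I ↔ ⌊x * 2 ^ I.gen⌋ = I.pos :=
    ⟨fun h => congrArg pos h, fun h => eq_of_gen_pos rfl h⟩
  rw [this, Int.floor_eq_iff, toSet, mem_Ico, hl, ← div_eq_mul_inv, ← div_eq_mul_inv,
    div_le_iff₀ h2, lt_div_iff₀ h2]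

theorem mem_cell (n : ℤ) (x : ℝ) : x ∈ (cell n x).toSet := mem_toSet_iff.2 rfl

theorem parent_cell (n : ℤ) (x : ℝ) : (cell n x).parent = cell (n - 1) x := by
  refine eq_of_gen_pos rfl ?_
  change ⌊x * 2 ^ n⌋ / 2 = ⌊x * 2 ^ (n - 1)⌋
  have := Int.floor_div_natCast (x * 2 ^ n) 2
  push_cast at this
  rw [← this, zpow_sub_one₀ two_ne_zero, div_eq_mul_inv, mul_assoc]

theorem anc_cell (k : ℕ) (n : ℤ) (x : ℝ) : anc k (cell n x) = cell (n - k) x := by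
  induction k with
  | zero => simp
  | succ k ih => rw [anc_succ, ih, parent_cell]; push_cast; ring_nf

theorem mem_parent {I : DyadicInterval} {x : ℝ} (h : x ∈ I.toSet) : x ∈ I.parent.toSet := by
  rw [mem_toSet_iff] at *
  rw [parent_gen, ← parent_cell, h]

theorem mem_anc {I : DyadicInterval} {x : ℝ} (n : ℕ) (h : x ∈ I.toSet) : x ∈ (anc n I).toSet := by
  induction n with
  | zero => exact h
  | succ n ih => rw [anc_succ]; exact mem_parent ih

theorem eq_anc_of_mem {I J : DyadicInterval} {x : ℝ} (hI : x ∈ I.toSet) (hJ : x ∈ J.toSet)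
    (h : I.gen ≤ J.gen) : I = anc (J.gen - I.gen).toNat J := by
  rw [mem_toSet_iff] at hI hJ
  conv_rhs => rw [← hJ]
  rw [anc_cell]
  conv_lhs => rw [← hI]
  congr 1
  simp only [cell_gen]
  omega

theorem subset_anc (n : ℕ) (I : DyadicInterval) : I.toSet ⊆ (anc n I).toSet := fun _ h => mem_anc n h

theorem subset_parent (I : DyadicInterval) : I.toSet ⊆ I.parent.toSet := fun _ h => mem_parent h

theorem subset_of_mem {I J : DyadicInterval} {x : ℝ} (hI : x ∈ I.toSet) (hJ : x ∈ J.toSet)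
    (h : I.gen ≤ J.gen) : J.toSet ⊆ I.toSet := by
  rw [eq_anc_of_mem hI hJ h]; exact subset_anc _ _

theorem eq_of_mem {I J : DyadicInterval} {x : ℝ} (hI : x ∈ I.toSet) (hJ : x ∈ J.toSet)
    (h : I.gen = J.gen) : I = J := by
  rw [mem_toSet_iff] at *; rw [← hI, ← hJ, h]

/-- The left end point. -/
noncomputable def base (I : DyadicInterval) : ℝ := I.pos * I.length

theorem base_mem (I : DyadicInterval) : I.base ∈ I.toSet := by
  have := I.length_pos
  rw [toSet, mem_Ico, base]
  constructor <;> nlinarith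

theorem nonempty_toSet (I : DyadicInterval) : I.toSet.Nonempty := ⟨_, I.base_mem⟩

@[simp] theorem parent_right (I : DyadicInterval) : I.right.parent = I :=
  eq_of_gen_pos (by simp) (by simp only [parent, right]; omega)

@[simp] theorem parent_left (I : DyadicInterval) : I.left.parent = I :=
  eq_of_gen_pos (by simp) (by simp only [parent, left]; omega)

@[simp] theorem sgn_right (I : DyadicInterval) : I.right.sgn = 1 := by
  simp [sgn, right, Int.add_emod]

@[simp] theorem sgn_left (I : DyadicInterval) : I.left.sgn = -1 := by
  simp [sgn, left]

theorem sgn_mul_self (I : DyadicInterval) : I.sgn * I.sgn = 1 := by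
  unfold sgn; split_ifs <;> norm_num

theorem abs_sgn (I : DyadicInterval) : |I.sgn| = 1 := by
  unfold sgn; split_ifs <;> norm_num

theorem right_ne_left (I J : DyadicInterval) : I.right ≠ J.left := fun h => by
  have := congrArg sgn h
  norm_num at this

theorem right_injective : Function.Injective right := fun I J h => by
  rw [← parent_right I, h, parent_right]

theorem left_injective : Function.Injective left := fun I J h => by
  rw [← parent_left I, h, parent_left]

theorem eq_right_or_left (I : DyadicInterval) : I = I.parent.right ∨ I = I.parent.left := by
  rcases Int.emod_two_eq_zero_or_one I.pos with h | h
  · right; refine eq_of_gen_pos (by simp) ?_; simp only [parent, left]; omega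
  · left; refine eq_of_gen_pos (by simp) ?_; simp only [parent, right]; omega

theorem eq_right_iff {I J : DyadicInterval} : I = J.right ↔ I.parent = J ∧ I.sgn = 1 := by
  constructor
  · rintro rfl; simp
  · rintro ⟨rfl, h⟩
    rcases eq_right_or_left I with h' | h'
    · exact h'
    · rw [h'] at h; norm_num at h

theorem eq_left_iff {I J : DyadicInterval} : I = J.left ↔ I.parent = J ∧ I.sgn = -1 := by
  constructor
  · rintro rfl; simp
  · rintro ⟨rfl, h⟩
    rcases eq_right_or_left I with h' | h'
    · rw [h'] at h; norm_num at h
    · exact h'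

theorem amp_pos (I : DyadicInterval) : 0 < I.amp := Real.rpow_pos_of_pos I.length_pos _

theorem amp_sq (I : DyadicInterval) : I.amp ^ 2 = I.length⁻¹ := by
  rw [amp, ← Real.rpow_natCast, ← Real.rpow_mul I.length_pos.le]
  norm_num
  exact Real.rpow_neg_one _

theorem length_parent (I : DyadicInterval) : I.parent.length = 2 * I.length := by
  simp only [length, parent_gen]
  rw [show -(I.gen - 1) = -I.gen + 1 by ring, zpow_add_one₀ two_ne_zero, mul_comm]

theorem length_right (I : DyadicInterval) : I.right.length = I.length / 2 := by
  have := length_parent I.right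
  rw [parent_right] at this; linarith

theorem length_left (I : DyadicInterval) : I.left.length = I.length / 2 := by
  have := length_parent I.left
  rw [parent_left] at this; linarith

theorem haar_eq (I : DyadicInterval) (x : ℝ) :
    I.haar x = I.toSet.indicator (fun x => I.amp * (cell (I.gen + 1) x).sgn) x := by
  have hr : x ∈ I.right.toSet ↔ x ∈ I.toSet ∧ (cell (I.gen + 1) x).sgn = 1 := by
    rw [mem_toSet_iff, eq_right_iff, mem_toSet_iff, parent_cell]; simp
  have hl : x ∈ I.left.toSet ↔ x ∈ I.toSet ∧ (cell (I.gen + 1) x).sgn = -1 := by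
    rw [mem_toSet_iff, eq_left_iff, mem_toSet_iff, parent_cell]; simp
  have hs : (cell (I.gen + 1) x).sgn = 1 ∨ (cell (I.gen + 1) x).sgn = -1 := by
    unfold sgn; split_ifs <;> simp
  unfold haar
  by_cases hx : x ∈ I.toSet
  · rcases hs with hs | hs
    · rw [indicator_of_mem (hr.2 ⟨hx, hs⟩), indicator_of_notMem (by rw [hl, hs]; norm_num),
        indicator_of_mem hx, hs, amp]
      ring
    · rw [indicator_of_mem (hl.2 ⟨hx, hs⟩), indicator_of_notMem (by rw [hr, hs]; norm_num),
        indicator_of_mem hx, hs, amp]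
      ring
  · rw [indicator_of_notMem (fun h => hx (hr.1 h).1), indicator_of_notMem (fun h => hx (hl.1 h).1),
      indicator_of_notMem hx]
    ring

theorem haar_of_notMem {I : DyadicInterval} {x : ℝ} (h : x ∉ I.toSet) : I.haar x = 0 := by
  rw [haar_eq, indicator_of_notMem h]

theorem abs_haar (I : DyadicInterval) (x : ℝ) : |I.haar x| = I.toSet.indicator (fun _ => I.amp) x := by
  rw [haar_eq]
  by_cases h : x ∈ I.toSet
  · simp [h, abs_mul, abs_sgn, abs_of_pos I.amp_pos]
  · simp [h]

theorem haar_sq (I : DyadicInterval) (x : ℝ) :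
    I.haar x * I.haar x = I.toSet.indicator (fun _ => I.length⁻¹) x := by
  rw [← abs_mul_abs_self, abs_haar, ← amp_sq]
  by_cases h : x ∈ I.toSet <;> simp [h, sq]

theorem haar_const {I K : DyadicInterval} {x y : ℝ} (h : I.gen < K.gen) (hx : x ∈ K.toSet)
    (hy : y ∈ K.toSet) : I.haar x = I.haar y := by
  have key : ∀ m ≤ K.gen, cell m x = cell m y := fun m hm => by
    have hx := mem_toSet_iff.1 hx
    have hy := mem_toSet_iff.1 hy
    have := anc_cell (K.gen - m).toNat K.gen
    have e : K.gen - ((K.gen - m).toNat : ℤ) = m := by omega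
    rw [e] at this
    rw [← this, ← this, hx, hy]
  have e1 : x ∈ I.toSet ↔ y ∈ I.toSet := by rw [mem_toSet_iff, mem_toSet_iff, key _ h.le]
  rw [haar_eq, haar_eq]
  by_cases hy' : y ∈ I.toSet
  · rw [indicator_of_mem (e1.2 hy'), indicator_of_mem hy', key _ h]
  · rw [indicator_of_notMem (e1.not.2 hy'), indicator_of_notMem hy']

/-- The mean of `h_I` over `K`. -/
noncomputable def meanHaar (K I : DyadicInterval) : ℝ := if I.gen < K.gen then I.haar K.base else 0

theorem meanHaar_self (K : DyadicInterval) : meanHaar K K = 0 := by simp [meanHaar]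

theorem haar_mul_of_lt {K I : DyadicInterval} (h : I.gen < K.gen) (x : ℝ) :
    K.haar x * I.haar x = meanHaar K I * K.haar x := by
  by_cases hx : x ∈ K.toSet
  · rw [meanHaar, if_pos h, haar_const h hx K.base_mem, mul_comm]
  · rw [haar_of_notMem hx]; ring

/-- When one interval is strictly finer, the coarser Haar function is constant on it and pulls out
as `meanHaar`; at equal generations the intervals coincide or are disjoint. The summands are the
diagonal and the two paraproduct parts. -/
theorem haar_mul (K I : DyadicInterval) (x : ℝ) :
    K.haar x * I.haar x = (if K = I then K.toSet.indicator (fun _ => K.length⁻¹) x else 0) +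
      meanHaar K I * K.haar x + meanHaar I K * I.haar x := by
  rcases lt_trichotomy I.gen K.gen with h | h | h
  · rw [haar_mul_of_lt h, if_neg (by rintro rfl; exact h.ne rfl), meanHaar, meanHaar,
      if_neg (not_lt.2 h.le) ]
    ring
  · by_cases e : K = I
    · subst e; simp [meanHaar_self, haar_sq]
    · rw [if_neg e, meanHaar, meanHaar, if_neg (not_lt.2 h.ge), if_neg (not_lt.2 h.le)]
      have : x ∉ K.toSet ∨ x ∉ I.toSet := by
        by_contra! hc
        exact e (eq_of_mem hc.1 hc.2 h.symm)
      rcases this with hx | hx <;> simp [haar_of_notMem hx]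
  · rw [mul_comm, haar_mul_of_lt h, if_neg (by rintro rfl; exact h.ne rfl), meanHaar, meanHaar,
      if_neg (not_lt.2 h.le) ]
    ring

theorem measurableSet_toSet (I : DyadicInterval) : MeasurableSet I.toSet := measurableSet_Ico

theorem volume_toSet (I : DyadicInterval) : volume I.toSet = ENNReal.ofReal I.length := by
  rw [toSet, Real.volume_Ico]; ring_nf

theorem volume_ne_zero (I : DyadicInterval) : volume I.toSet ≠ 0 := by
  rw [volume_toSet]; simpa using I.length_pos

theorem volume_ne_top (I : DyadicInterval) : volume I.toSet ≠ ⊤ := by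
  rw [volume_toSet]; simp

theorem measurable_cell_comp {α : Type*} [MeasurableSpace α] (n : ℤ) (g : DyadicInterval → α) :
    Measurable fun x : ℝ => g (cell n x) := by
  have h1 : Measurable fun x : ℝ => ⌊x * 2 ^ n⌋ := (measurable_id.mul_const _).floor
  exact (measurable_from_top (f := fun k : ℤ => g ⟨n, k⟩)).comp h1

theorem measurable_haar (I : DyadicInterval) : Measurable I.haar := by
  have : I.haar = I.toSet.indicator fun x => I.amp * (cell (I.gen + 1) x).sgn := by
    ext x; rw [haar_eq]
  rw [this]
  exact ((measurable_cell_comp _ sgn).const_mul _).indicator I.measurableSet_toSet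

theorem integrable_indicator (K : DyadicInterval) (c : ℝ) :
    Integrable (K.toSet.indicator (fun _ => c)) :=
  (integrableOn_const K.volume_ne_top).integrable_indicator K.measurableSet_toSet

theorem integrable_haar (I : DyadicInterval) : Integrable I.haar := by
  have h (K : DyadicInterval) := integrable_indicator K 1
  exact ((h I.right).sub (h I.left)).const_mul _

theorem setIntegral_one (I : DyadicInterval) :
    ∫ x, I.toSet.indicator (fun _ => (1 : ℝ)) x = I.length := by
  rw [integral_indicator I.measurableSet_toSet, setIntegral_const, smul_eq_mul, mul_one,
    Measure.real, volume_toSet, ENNReal.toReal_ofReal I.length_pos.le]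

theorem integral_haar (I : DyadicInterval) : ∫ x, I.haar x = 0 := by
  have h (K : DyadicInterval) := integrable_indicator K 1
  unfold haar
  rw [integral_const_mul, integral_sub (h _) (h _), setIntegral_one, setIntegral_one,
    length_right, length_left]
  ring

/-- The normalised indicator `χ_K / |K|`. -/
noncomputable def nind (K : DyadicInterval) (x : ℝ) : ℝ := K.toSet.indicator (fun _ => K.length⁻¹) x

theorem integrable_nind (K : DyadicInterval) : Integrable K.nind := integrable_indicator K _

theorem integral_nind (K : DyadicInterval) : ∫ x, K.nind x = 1 := by
  have h1 : ∀ x, K.nind x = K.length⁻¹ * K.toSet.indicator (fun _ => (1 : ℝ)) x := fun x => by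
    by_cases hx : x ∈ K.toSet <;> simp [nind, hx]
  simp only [h1]
  rw [integral_const_mul, setIntegral_one, inv_mul_cancel₀ K.length_pos.ne']

theorem integrable_haar_mul (K I : DyadicInterval) : Integrable fun x => K.haar x * I.haar x := by
  refine I.integrable_haar.bdd_mul (c := K.amp) K.measurable_haar.aestronglyMeasurable ?_
  filter_upwards with x
  rw [Real.norm_eq_abs, abs_haar]
  exact indicator_le_self' (fun _ _ => K.amp_pos.le) x

theorem integral_nind_mul_haar (K I : DyadicInterval) :
    ∫ x, K.nind x * I.haar x = meanHaar K I := by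
  by_cases h : I.gen < K.gen
  · have : ∀ x, K.nind x * I.haar x = meanHaar K I * K.nind x := fun x => by
      by_cases hx : x ∈ K.toSet
      · rw [meanHaar, if_pos h, haar_const h hx K.base_mem, mul_comm]
      · rw [nind, indicator_of_notMem hx]; ring
    simp only [this]
    rw [integral_const_mul, integral_nind, mul_one]
  · rw [meanHaar, if_neg h]
    have : (∀ x, K.nind x * I.haar x = K.length⁻¹ * I.haar x) ∨ ∀ x, K.nind x * I.haar x = 0 := by
      by_cases hc : ∃ x, x ∈ K.toSet ∧ x ∈ I.toSet
      · left
        obtain ⟨y, hyK, hyI⟩ := hc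
        have hs := subset_of_mem hyK hyI (not_lt.1 h)
        intro x
        by_cases hx : x ∈ I.toSet
        · rw [nind, indicator_of_mem (hs hx)]
        · simp [haar_of_notMem hx]
      · right
        intro x
        by_cases hx : x ∈ I.toSet
        · rw [nind, indicator_of_notMem (fun hK => hc ⟨x, hK, hx⟩), zero_mul]
        · simp [haar_of_notMem hx]
    rcases this with h' | h' <;> simp only [h']
    · rw [integral_const_mul, integral_haar, mul_zero]
    · simp

theorem integral_haar_mul_haar (K I : DyadicInterval) :
    ∫ x, K.haar x * I.haar x = if K = I then 1 else 0 := by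
  simp only [haar_mul K I]
  rw [integral_add, integral_add, integral_const_mul, integral_const_mul, integral_haar,
    integral_haar]
  · split_ifs with h
    · rw [mul_zero, mul_zero, add_zero, add_zero]; exact K.integral_nind
    · simp
  · split_ifs with h
    · exact K.integrable_nind
    · simp
  · exact K.integrable_haar.const_mul _
  · refine Integrable.add ?_ (K.integrable_haar.const_mul _)
    split_ifs with h
    · exact K.integrable_nind
    · simp
  · exact I.integrable_haar.const_mul _

/-- `∫ h_K h_I h_Q`. -/
noncomputable def triple (K I Q : DyadicInterval) : ℝ := ∫ x, K.haar x * I.haar x * Q.haar x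

/-- Integrating `haar_mul` against `h_Q` leaves only triples in which two of the three intervals
coincide. -/
theorem triple_eq (K I Q : DyadicInterval) :
    triple K I Q = (if K = I then meanHaar K Q else 0) + (if K = Q then meanHaar K I else 0) +
      (if I = Q then meanHaar I K else 0) := by
  have hb : ∀ J : DyadicInterval, ∀ᵐ x, ‖Q.haar x‖ ≤ Q.amp := fun J => by
    filter_upwards with x
    rw [Real.norm_eq_abs, abs_haar]
    exact indicator_le_self' (fun _ _ => Q.amp_pos.le) x
  have hn : Integrable fun x => K.nind x * Q.haar x := by
    exact K.integrable_nind.mul_bdd (c := Q.amp) Q.measurable_haar.aestronglyMeasurable (hb K)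
  have hsplit : ∀ x, K.haar x * I.haar x * Q.haar x =
      (if K = I then K.nind x * Q.haar x else 0) + meanHaar K I * (K.haar x * Q.haar x) +
        meanHaar I K * (I.haar x * Q.haar x) := fun x => by
    rw [haar_mul K I, add_mul, add_mul, ite_mul, zero_mul, mul_assoc, mul_assoc, nind]
  have hn' : Integrable fun x => if K = I then K.nind x * Q.haar x else 0 := by
    split_ifs
    · exact hn
    · simp
  unfold triple
  simp only [hsplit]
  rw [integral_add (by exact hn'.add ((integrable_haar_mul K Q).const_mul _))
    ((integrable_haar_mul I Q).const_mul _), integral_add hn' ((integrable_haar_mul K Q).const_mul _),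
    integral_const_mul, integral_const_mul, integral_haar_mul_haar, integral_haar_mul_haar,
    mul_ite, mul_ite, mul_one, mul_one, mul_zero, mul_zero]
  congr 2
  split_ifs
  · exact integral_nind_mul_haar K Q
  · simp

/-- The mean of `h_K` changes between `Q.parent` and `Q` only at the single scale where `h_K` jumps.
This is the cancellation that the commutator exploits. -/
theorem meanHaar_parent_sub (Q K : DyadicInterval) :
    meanHaar Q.parent K - meanHaar Q K = if Q.parent = K then -(Q.sgn * K.amp) else 0 := by
  unfold meanHaar
  rcases lt_trichotomy K.gen Q.parent.gen with h | h | h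
  · have h' := h
    rw [parent_gen] at h'
    rw [if_pos h, if_pos (by omega), if_neg (by rintro rfl; exact h.ne rfl),
      haar_const h Q.parent.base_mem (mem_parent Q.base_mem), sub_self]
  · have h' := h
    rw [parent_gen] at h'
    rw [if_neg h.not_lt, if_pos (by omega), zero_sub, haar_eq]
    have hg : K.gen + 1 = Q.gen := by omega
    split_ifs with e
    · rw [indicator_of_mem (e ▸ mem_parent Q.base_mem), hg, mem_toSet_iff.1 Q.base_mem, mul_comm]
    · rw [indicator_of_notMem, neg_zero]
      exact fun hK => e (eq_of_mem (mem_parent Q.base_mem) hK h.symm)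
  · have h' := h
    rw [parent_gen] at h'
    rw [if_neg (by omega), if_neg (by omega), if_neg (by rintro rfl; exact h.ne rfl), sub_self]

theorem abs_meanHaar (K I : DyadicInterval) :
    |meanHaar K I| = if I.gen < K.gen then I.toSet.indicator (fun _ => I.amp) K.base else 0 := by
  unfold meanHaar
  split_ifs
  · rw [abs_haar]
  · simp

/-- The kernel of the commutator of the shift with multiplication by `h_K`. -/
noncomputable def kernel (K I Q : DyadicInterval) : ℝ :=
  Q.sgn * triple K I Q.parent - (triple K I.right Q - triple K I.left Q)

theorem sub_ite_children (K I : DyadicInterval) (c : ℝ) :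
    (if K = I.right then c else 0) - (if K = I.left then c else 0) =
      if I = K.parent then K.sgn * c else 0 := by
  by_cases h : I = K.parent
  · subst h
    rcases eq_right_or_left K with h' | h'
    · rw [if_pos h', if_neg (fun h2 => right_ne_left _ _ (h'.symm.trans h2)), if_pos rfl, h', sgn_right]
      ring
    · rw [if_pos h', if_neg (fun h2 => right_ne_left _ _ (h2.symm.trans h')), if_pos rfl, h', sgn_left]
      ring
  · rw [if_neg (fun h2 => h (eq_right_iff.1 h2).1.symm), if_neg (fun h2 => h (eq_left_iff.1 h2).1.symm),
      if_neg h, sub_zero]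

/-- Each triple product contributes three terms by `triple_eq`. Those in which `h_K` is averaged
over an interval tied to both `I` and `Q` cancel except at the jump scale. What remains factors into
a function of `(K, I)` times a function of `(K, Q)`, which is what allows separate treatment of `b`
and of the test sequence. -/
theorem kernel_eq (K I Q : DyadicInterval) :
    kernel K I Q =
      (if I = K then 1 else 0) * (Q.sgn * meanHaar K Q.parent) +
      (if I = K then 1 else 0) * (-(K.amp * if Q.parent = K then 1 else 0)) +
      meanHaar K I * (Q.sgn * if Q.parent = K then 1 else 0) +
      (meanHaar K I.left - meanHaar K I.right) * (if Q = K then 1 else 0) +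
      (if I = K.parent then 1 else 0) * (-(K.sgn * meanHaar K Q)) := by
  have h1 := sub_ite_children K I (meanHaar K Q)
  have h2 := sub_ite_children Q I (meanHaar Q K)
  -- The terms with `K` coarser than `I`: the means over `Q.parent` and over `Q` appear with
  -- opposite signs, and only `K = I = Q.parent` survives.
  have h3 : Q.sgn * (if I = Q.parent then meanHaar I K else 0) -
      (if I = Q.parent then Q.sgn * meanHaar Q K else 0) =
      (if I = K then 1 else 0) * (-(K.amp * if Q.parent = K then 1 else 0)) := by
    by_cases h : I = Q.parent
    · have s := Q.sgn_mul_self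
      rw [if_pos h, if_pos h, ← mul_sub, h, meanHaar_parent_sub]
      split_ifs
      · linear_combination (-K.amp) * s
      · ring
    · rw [if_neg h, if_neg h]
      by_cases h' : I = K
      · rw [if_neg (fun h2 : Q.parent = K => h (h'.trans h2.symm))]; ring
      · rw [if_neg h']; ring
  have h4 : (if I.right = Q then meanHaar I.right K else 0) =
      if Q = I.right then meanHaar Q K else 0 := by
    by_cases h : Q = I.right
    · rw [if_pos h, if_pos h.symm, h]
    · rw [if_neg h, if_neg (Ne.symm h)]
  have h5 : (if I.left = Q then meanHaar I.left K else 0) =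
      if Q = I.left then meanHaar Q K else 0 := by
    by_cases h : Q = I.left
    · rw [if_pos h, if_pos h.symm, h]
    · rw [if_neg h, if_neg (Ne.symm h)]
  unfold kernel
  rw [triple_eq, triple_eq, triple_eq, ← h3, h4, h5]
  simp only [eq_comm (a := K) (b := I), eq_comm (a := K) (b := Q), eq_comm (a := K) (b := Q.parent),
    ite_mul, mul_ite, one_mul, zero_mul, mul_one, mul_zero]
  have e : (if I = K.parent then -(K.sgn * meanHaar K Q) else 0) =
      -(if I = K.parent then K.sgn * meanHaar K Q else 0) := by split_ifs <;> simp
  rw [e, ← h1, ← h2]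
  split_ifs <;> ring

end DyadicInterval

/-! ### Layer-cake formulas and the dyadic maximal function on the line. -/

theorem ENNReal.lintegral_one_lt (y : ℝ≥0∞) :
    ∫⁻ t in Ioi (0 : ℝ), {t | ENNReal.ofReal t < y}.indicator 1 t = y := by
  have hm : MeasurableSet {t : ℝ | ENNReal.ofReal t < y} :=
    measurableSet_lt ENNReal.measurable_ofReal measurable_const
  rw [lintegral_indicator_one hm, Measure.restrict_apply hm]
  induction y with
  | top => simp
  | coe a =>
    have : {t : ℝ | ENNReal.ofReal t < a} ∩ Ioi 0 = Ioo 0 (a : ℝ) := by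
      ext t
      simp only [mem_inter_iff, mem_ofPred_eq, mem_Ioi, mem_Ioo]
      constructor
      · rintro ⟨h1, h2⟩
        rw [← ENNReal.ofReal_coe_nnreal] at h1
        exact ⟨h2, (ENNReal.ofReal_lt_ofReal_iff_of_nonneg h2.le).1 h1⟩
      · rintro ⟨h1, h2⟩
        rw [← ENNReal.ofReal_coe_nnreal]
        exact ⟨(ENNReal.ofReal_lt_ofReal_iff_of_nonneg h1.le).2 h2, h1⟩
    rw [this, Real.volume_Ioo, sub_zero, ENNReal.ofReal_coe_nnreal]

/-- The identity `y² = 8 ∫₀^{y/2} t dt`. The level `2t` fits the truncation at height `t` in the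
maximal theorem. -/
theorem ENNReal.sq_le_lintegral (y : ℝ≥0∞) :
    y ^ 2 ≤ 8 * ∫⁻ t in Ioi (0 : ℝ), {t | ENNReal.ofReal (2 * t) < y}.indicator ENNReal.ofReal t := by
  have hm (y : ℝ≥0∞) : MeasurableSet {t : ℝ | ENNReal.ofReal (2 * t) < y} :=
    measurableSet_lt (ENNReal.measurable_ofReal.comp (measurable_const_mul 2)) measurable_const
  have key (a : NNReal) : (a : ℝ≥0∞) ^ 2 ≤
      8 * ∫⁻ t in Ioi (0 : ℝ), {t | ENNReal.ofReal (2 * t) < a}.indicator ENNReal.ofReal t := by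
    rw [lintegral_indicator (hm _), Measure.restrict_restrict (hm _)]
    have : {t : ℝ | ENNReal.ofReal (2 * t) < a} ∩ Ioi 0 = Ioo 0 (a / 2 : ℝ) := by
      ext t
      simp only [mem_inter_iff, mem_ofPred_eq, mem_Ioi, mem_Ioo]
      rw [← ENNReal.ofReal_coe_nnreal]
      constructor
      · rintro ⟨h1, h2⟩
        have := (ENNReal.ofReal_lt_ofReal_iff_of_nonneg (by positivity)).1 h1
        exact ⟨h2, by linarith⟩
      · rintro ⟨h1, h2⟩
        exact ⟨(ENNReal.ofReal_lt_ofReal_iff_of_nonneg (by positivity)).2 (by linarith), h1⟩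
    rw [this, ← ofReal_integral_eq_lintegral_ofReal, ← integral_Ioc_eq_integral_Ioo,
      ← intervalIntegral.integral_of_le (by positivity), integral_id]
    · rw [← ENNReal.ofReal_coe_nnreal, ← ENNReal.ofReal_pow (NNReal.coe_nonneg a),
        show (8 : ℝ≥0∞) = ENNReal.ofReal 8 by simp, ← ENNReal.ofReal_mul (by norm_num)]
      apply ENNReal.ofReal_le_ofReal
      apply le_of_eq
      ring
    · exact (continuous_id.integrableOn_Icc).mono_set Ioo_subset_Icc_self
    · exact (ae_restrict_mem measurableSet_Ioo).mono fun t ht => ht.1.le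
  induction y with
  | coe a => exact key a
  | top =>
    have : (8 * ∫⁻ t in Ioi (0 : ℝ), {t | ENNReal.ofReal (2 * t) < ⊤}.indicator ENNReal.ofReal t) = ⊤ := by
      refine ENNReal.eq_top_of_forall_nnreal_le fun r => ?_
      calc (r : ℝ≥0∞) ≤ ((r + 1 : NNReal) : ℝ≥0∞) ^ 2 := by
            norm_cast
            nlinarith [r.2, sq_nonneg r]
        _ ≤ _ := key _
        _ ≤ _ := by
            refine mul_le_mul_right (lintegral_mono fun t => ?_) _
            by_cases h : t ∈ {t : ℝ | ENNReal.ofReal (2 * t) < (r + 1 : NNReal)}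
            · rw [indicator_of_mem h, indicator_of_mem (by exact ENNReal.ofReal_lt_top)]
            · rw [indicator_of_notMem h]; exact zero_le
    rw [this]
    exact le_top

namespace DyadicInterval

/-- The mean of `f` over `I`. -/
noncomputable def avg (I : DyadicInterval) (f : ℝ → ℝ≥0∞) : ℝ≥0∞ :=
  (volume I.toSet)⁻¹ * ∫⁻ x in I.toSet, f x

theorem volume_mul_avg (I : DyadicInterval) (f : ℝ → ℝ≥0∞) :
    volume I.toSet * I.avg f = ∫⁻ x in I.toSet, f x := by
  rw [avg, ← mul_assoc, ENNReal.mul_inv_cancel I.volume_ne_zero I.volume_ne_top, one_mul]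

theorem avg_mono {I : DyadicInterval} {f g : ℝ → ℝ≥0∞} (h : ∀ x ∈ I.toSet, f x ≤ g x) :
    I.avg f ≤ I.avg g := by
  unfold avg
  gcongr 1
  exact setLIntegral_mono' I.measurableSet_toSet h

theorem avg_const (I : DyadicInterval) (c : ℝ≥0∞) : I.avg (fun _ => c) = c := by
  rw [avg, setLIntegral_const, mul_comm c, ← mul_assoc,
    ENNReal.inv_mul_cancel I.volume_ne_zero I.volume_ne_top, one_mul]

theorem avg_add {I : DyadicInterval} {f : ℝ → ℝ≥0∞} (hf : Measurable f) (g : ℝ → ℝ≥0∞) :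
    I.avg (fun x => f x + g x) = I.avg f + I.avg g := by
  unfold avg
  rw [lintegral_add_left hf, mul_add]

theorem measurableSet_cell_prop (n : ℤ) (P : DyadicInterval → Prop) :
    MeasurableSet {x : ℝ | P (cell n x)} :=
  measurableSet_setOfPred.2 (measurable_cell_comp n P)

theorem lintegral_eq_tsum (n : ℤ) (f : ℝ → ℝ≥0∞) :
    ∫⁻ x, f x = ∑' k : ℤ, ∫⁻ x in (⟨n, k⟩ : DyadicInterval).toSet, f x := by
  rw [← lintegral_iUnion (fun k => measurableSet_toSet _)]
  · have : ⋃ k : ℤ, (⟨n, k⟩ : DyadicInterval).toSet = univ :=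
      eq_univ_of_forall fun x => mem_iUnion.2 ⟨_, mem_cell n x⟩
    rw [this, Measure.restrict_univ]
  · intro i j hij
    refine disjoint_left.2 fun x hx hy => hij ?_
    have := eq_of_mem hx hy rfl
    simpa using this

theorem lintegral_avg_cell (n : ℤ) (f : ℝ → ℝ≥0∞) : ∫⁻ x, (cell n x).avg f = ∫⁻ x, f x := by
  rw [lintegral_eq_tsum n, lintegral_eq_tsum n f]
  congr 1; ext k
  rw [setLIntegral_congr_fun (g := fun _ => (⟨n, k⟩ : DyadicInterval).avg f) (measurableSet_toSet _)
    (fun x hx => by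
      have := mem_toSet_iff.1 hx
      simp only at this
      simp only [this]),
    setLIntegral_const, mul_comm, volume_mul_avg]

theorem mul_volume_cell_le (n : ℤ) (P : DyadicInterval → Prop) (c : ℝ≥0∞) (f : ℝ → ℝ≥0∞)
    (h : ∀ I, P I → c ≤ I.avg f) :
    c * volume {x | P (cell n x)} ≤ ∫⁻ x in {x | P (cell n x)}, f x := by
  have hm := measurableSet_cell_prop n P
  rw [← setLIntegral_const, ← lintegral_indicator hm, ← lintegral_indicator hm, lintegral_eq_tsum n,
    lintegral_eq_tsum n (indicator _ _)]
  refine ENNReal.tsum_le_tsum fun k => ?_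
  by_cases hP : P ⟨n, k⟩
  · have hk : ∀ x ∈ (⟨n, k⟩ : DyadicInterval).toSet, x ∈ {x | P (cell n x)} := fun x hx => by
      have := mem_toSet_iff.1 hx
      simp only at this
      simpa [this] using hP
    rw [setLIntegral_congr_fun (g := fun _ => c) (measurableSet_toSet _)
      (fun x hx => indicator_of_mem (hk x hx) _),
      setLIntegral_congr_fun (g := f) (measurableSet_toSet _)
      (fun x hx => indicator_of_mem (hk x hx) _), setLIntegral_const, ← volume_mul_avg, mul_comm]
    gcongr
    exact h _ hP
  · have hk : ∀ x ∈ (⟨n, k⟩ : DyadicInterval).toSet, x ∉ {x | P (cell n x)} := fun x hx => by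
      have := mem_toSet_iff.1 hx
      simp only at this
      simpa [this] using hP
    rw [setLIntegral_congr_fun (g := fun _ => 0) (measurableSet_toSet _)
      (fun x hx => indicator_of_notMem (hk x hx) _)]
    simp

/-- The dyadic maximal function. -/
noncomputable def maxFun (f : ℝ → ℝ≥0∞) (x : ℝ) : ℝ≥0∞ := ⨆ n : ℤ, (cell n x).avg f

theorem measurable_maxFun (f : ℝ → ℝ≥0∞) : Measurable (maxFun f) :=
  Measurable.iSup fun n => measurable_cell_comp n fun I => I.avg f

theorem avg_le_maxFun {I : DyadicInterval} {x : ℝ} (hx : x ∈ I.toSet) (f : ℝ → ℝ≥0∞) :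
    I.avg f ≤ maxFun f x := by
  rw [← mem_toSet_iff.1 hx]
  exact le_iSup (fun n : ℤ => (cell n x).avg f) _

/-- Weak type (1,1) with constant 1: the level set is a disjoint union of the maximal dyadic
intervals on which the mean exceeds `c`. -/
theorem mul_volume_maxFun_le (c : ℝ≥0∞) (f : ℝ → ℝ≥0∞) :
    c * volume {x | c < maxFun f x} ≤ ∫⁻ x, f x := by
  -- Restricting to generations at least `-N` guarantees that a first generation with large mean
  -- exists; afterwards `N` tends to infinity.
  let A : ℕ → ℕ → Set ℝ := fun N k => {x | c < (cell (k - N) x).avg f}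
  have hA : ∀ N k, MeasurableSet (A N k) := fun N k => measurableSet_cell_prop _ fun I => c < I.avg f
  have hU : {x | c < maxFun f x} = ⋃ N, ⋃ k, A N k := by
    ext x
    simp only [mem_ofPred_eq, maxFun, lt_iSup_iff, mem_iUnion, A]
    constructor
    · rintro ⟨n, hn⟩
      refine ⟨n.natAbs, (n + n.natAbs).toNat, ?_⟩
      convert hn using 3
      omega
    · rintro ⟨N, k, h⟩
      exact ⟨_, h⟩
  have hmono : Monotone fun N => ⋃ k, A N k := by
    refine monotone_nat_of_le_succ fun N => iUnion_subset fun k x hx => mem_iUnion.2 ⟨k + 1, ?_⟩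
    simp only [A, mem_ofPred_eq] at hx ⊢
    convert hx using 3
    push_cast; ring
  rw [hU, hmono.measure_iUnion, ENNReal.mul_iSup]
  refine iSup_le fun N => ?_
  rw [← iUnion_disjointed, measure_iUnion (disjoint_disjointed _)
    (fun k => MeasurableSet.disjointed (hA N) k), ← ENNReal.tsum_mul_left]
  calc ∑' k, c * volume (disjointed (A N) k)
      ≤ ∑' k, ∫⁻ x in disjointed (A N) k, f x := by
        refine ENNReal.tsum_le_tsum fun k => ?_
        -- The piece stopped at step `k` is a union of cells of generation `k - N`, since the
        -- conditions at earlier steps concern only ancestors of the cell.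
        have : disjointed (A N) k = {x | (fun I : DyadicInterval => c < I.avg f ∧
            ∀ j < k, ¬ c < (anc (k - j) I).avg f) (cell (k - N) x)} := by
          ext x
          rw [disjointed_eq_inter_compl]
          simp only [A, mem_inter_iff, mem_ofPred_eq, mem_iInter, mem_compl_iff]
          refine and_congr_right fun _ => forall₂_congr fun j hj => ?_
          rw [anc_cell, show ((k : ℤ) - N - ((k - j : ℕ) : ℤ)) = j - N by omega]
        rw [this]
        exact mul_volume_cell_le (k - N) (fun I : DyadicInterval => c < I.avg f ∧
            ∀ j < k, ¬ c < (anc (k - j) I).avg f) c f fun I h => h.1.le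
    _ = ∫⁻ x in ⋃ k, disjointed (A N) k, f x :=
        (lintegral_iUnion (fun k => MeasurableSet.disjointed (hA N) k) (disjoint_disjointed _) _).symm
    _ ≤ ∫⁻ x, f x := setLIntegral_le_lintegral _ _

/-- If `g = f · 1_{f > t}`, then `f ≤ t + g`, hence `{Mf > 2t} ⊆ {Mg > t}`. The weak type bound for
`g`, integrated against `t dt` and followed by Tonelli, gives the strong bound. -/
theorem lintegral_maxFun_sq_le {f : ℝ → ℝ≥0∞} (hf : Measurable f) :
    ∫⁻ x, maxFun f x ^ 2 ≤ 8 * ∫⁻ x, f x ^ 2 := by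
  have hM := measurable_maxFun f
  calc ∫⁻ x, maxFun f x ^ 2
      ≤ ∫⁻ x, 8 * ∫⁻ t in Ioi (0 : ℝ),
          {t | ENNReal.ofReal (2 * t) < maxFun f x}.indicator ENNReal.ofReal t :=
        lintegral_mono fun x => ENNReal.sq_le_lintegral _
    _ = 8 * ∫⁻ t in Ioi (0 : ℝ), ∫⁻ x,
          {t | ENNReal.ofReal (2 * t) < maxFun f x}.indicator ENNReal.ofReal t := by
        rw [lintegral_const_mul', lintegral_lintegral_swap]
        · refine Measurable.aemeasurable ?_
          have : MeasurableSet {p : ℝ × ℝ | ENNReal.ofReal (2 * p.2) < maxFun f p.1} :=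
            measurableSet_lt (by fun_prop) (by fun_prop)
          exact (ENNReal.measurable_ofReal.comp measurable_snd).indicator this
        · norm_num
    _ ≤ 8 * ∫⁻ t in Ioi (0 : ℝ), ∫⁻ x, f x * {t | ENNReal.ofReal t < f x}.indicator 1 t := by
        gcongr 1
        refine setLIntegral_mono' measurableSet_Ioi fun t ht => ?_
        set g : ℝ → ℝ≥0∞ := fun x => f x * {t | ENNReal.ofReal t < f x}.indicator 1 t with hg
        have hfg : ∀ x, f x ≤ ENNReal.ofReal t + g x := fun x => by
          by_cases h : ENNReal.ofReal t < f x
          · simp [hg, h]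
          · exact (not_lt.1 h).trans le_self_add
        have hsub : {x | ENNReal.ofReal (2 * t) < maxFun f x} ⊆ {x | ENNReal.ofReal t < maxFun g x} := by
          intro x hx
          simp only [mem_ofPred_eq, maxFun, lt_iSup_iff] at hx ⊢
          obtain ⟨n, hn⟩ := hx
          refine ⟨n, ?_⟩
          have h1 : (cell n x).avg f ≤ ENNReal.ofReal t + (cell n x).avg g := by
            rw [← avg_const (cell n x) (ENNReal.ofReal t), ← avg_add measurable_const]
            exact avg_mono fun y _ => by simpa [avg_const] using hfg y
          rw [two_mul, ENNReal.ofReal_add (le_of_lt ht) (le_of_lt ht)] at hn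
          exact lt_of_add_lt_add_left (hn.trans_le h1)
        calc ∫⁻ x, {t | ENNReal.ofReal (2 * t) < maxFun f x}.indicator ENNReal.ofReal t
            = ∫⁻ x, {x | ENNReal.ofReal (2 * t) < maxFun f x}.indicator
                (fun _ => ENNReal.ofReal t) x := by rfl
          _ = ENNReal.ofReal t * volume {x | ENNReal.ofReal (2 * t) < maxFun f x} := by
              rw [lintegral_indicator_const (measurableSet_lt measurable_const hM)]
          _ ≤ ENNReal.ofReal t * volume {x | ENNReal.ofReal t < maxFun g x} := by gcongr
          _ ≤ _ := mul_volume_maxFun_le _ _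
    _ = 8 * ∫⁻ x, f x ^ 2 := by
        rw [lintegral_lintegral_swap]
        · congr 2; ext x
          rw [lintegral_const_mul, ENNReal.lintegral_one_lt, sq]
          exact measurable_const.indicator (measurableSet_lt (by fun_prop) (by fun_prop))
        · refine Measurable.aemeasurable ?_
          have : MeasurableSet {p : ℝ × ℝ | ENNReal.ofReal p.1 < f p.2} :=
            measurableSet_lt (by fun_prop) (by fun_prop)
          exact (hf.comp measurable_snd).mul (measurable_one.indicator this)

attribute [irreducible] maxFun

end DyadicInterval

/-! ### Dyadic rectangles and the strong maximal function. -/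

namespace DyadicRect

open DyadicInterval

/-- The dyadic rectangle of generation `n` containing `z`. -/
noncomputable def cell (n : ℤ × ℤ) (z : ℝ × ℝ) : DyadicRect :=
  (DyadicInterval.cell n.1 z.1, DyadicInterval.cell n.2 z.2)

theorem eq_cell {R : DyadicRect} {z : ℝ × ℝ} (h : z ∈ R.toSet) : cell (R.1.gen, R.2.gen) z = R :=
  Prod.ext (DyadicInterval.mem_toSet_iff.1 h.1) (DyadicInterval.mem_toSet_iff.1 h.2)

theorem measurableSet_toSet (R : DyadicRect) : MeasurableSet R.toSet :=
  R.1.measurableSet_toSet.prod R.2.measurableSet_toSet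

theorem volume_toSet (R : DyadicRect) :
    volume R.toSet = volume R.1.toSet * volume R.2.toSet := by
  rw [toSet, Measure.volume_eq_prod, Measure.prod_prod]

theorem volume_ne_zero (R : DyadicRect) : volume R.toSet ≠ 0 := by
  rw [volume_toSet]; exact mul_ne_zero R.1.volume_ne_zero R.2.volume_ne_zero

theorem volume_ne_top (R : DyadicRect) : volume R.toSet ≠ ⊤ := by
  rw [volume_toSet]; exact ENNReal.mul_ne_top R.1.volume_ne_top R.2.volume_ne_top

theorem measurable_cell_comp {α : Type*} [MeasurableSpace α] (n : ℤ × ℤ) (g : DyadicRect → α) :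
    Measurable fun z : ℝ × ℝ => g (cell n z) := by
  have h1 : Measurable fun z : ℝ × ℝ => (⌊z.1 * 2 ^ n.1⌋, ⌊z.2 * 2 ^ n.2⌋) :=
    (measurable_fst.mul_const _).floor.prodMk (measurable_snd.mul_const _).floor
  exact (measurable_of_countable (f := fun k : ℤ × ℤ => g (⟨n.1, k.1⟩, ⟨n.2, k.2⟩))).comp h1

/-- The mean of `F` over `R`. -/
noncomputable def avg (R : DyadicRect) (F : ℝ × ℝ → ℝ≥0∞) : ℝ≥0∞ :=
  (volume R.toSet)⁻¹ * ∫⁻ z in R.toSet, F z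

theorem volume_mul_avg (R : DyadicRect) (F : ℝ × ℝ → ℝ≥0∞) :
    volume R.toSet * R.avg F = ∫⁻ z in R.toSet, F z := by
  rw [avg, ← mul_assoc, ENNReal.mul_inv_cancel R.volume_ne_zero R.volume_ne_top, one_mul]

theorem avg_eq (R : DyadicRect) {F : ℝ × ℝ → ℝ≥0∞} (hF : Measurable F) :
    R.avg F = R.1.avg fun s => R.2.avg fun t => F (s, t) := by
  unfold avg DyadicInterval.avg
  rw [volume_toSet, toSet, Measure.volume_eq_prod, ← Measure.prod_restrict,
    lintegral_prod _ hF.aemeasurable, lintegral_const_mul', ← mul_assoc,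
    ENNReal.mul_inv (Or.inl R.1.volume_ne_zero) (Or.inl R.1.volume_ne_top)]
  exact ENNReal.inv_ne_top.2 R.2.volume_ne_zero

/-- The dyadic strong maximal function. -/
noncomputable def maxFun (F : ℝ × ℝ → ℝ≥0∞) (z : ℝ × ℝ) : ℝ≥0∞ := ⨆ n : ℤ × ℤ, (cell n z).avg F

theorem measurable_maxFun (F : ℝ × ℝ → ℝ≥0∞) : Measurable (maxFun F) :=
  Measurable.iSup fun n => measurable_cell_comp n fun R => R.avg F

theorem avg_le_maxFun {R : DyadicRect} {z : ℝ × ℝ} (hz : z ∈ R.toSet) (F : ℝ × ℝ → ℝ≥0∞) :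
    R.avg F ≤ maxFun F z := by
  rw [← eq_cell hz]
  exact le_iSup (fun n : ℤ × ℤ => (cell n z).avg F) _

theorem measurable_avg_cell_snd {F : ℝ × ℝ → ℝ≥0∞} (hF : Measurable F) (n : ℤ) :
    Measurable fun z : ℝ × ℝ => (DyadicInterval.cell n z.2).avg fun t => F (z.1, t) := by
  unfold DyadicInterval.avg
  refine Measurable.mul ?_ ?_
  · exact (DyadicInterval.measurable_cell_comp n fun I => (volume I.toSet)⁻¹).comp measurable_snd
  -- The cell moves with `z.2`, so the integral over it is written as a parameter integral of the
  -- indicator of a measurable relation.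
  · have hS : MeasurableSet {p : (ℝ × ℝ) × ℝ | ⌊p.2 * 2 ^ n⌋ = ⌊p.1.2 * 2 ^ n⌋} :=
      measurableSet_eq_fun (by fun_prop) (by fun_prop)
    have h1 : Measurable fun p : (ℝ × ℝ) × ℝ =>
        {p : (ℝ × ℝ) × ℝ | ⌊p.2 * 2 ^ n⌋ = ⌊p.1.2 * 2 ^ n⌋}.indicator (fun p => F (p.1.1, p.2)) p :=
      Measurable.indicator (by fun_prop) hS
    convert h1.lintegral_prod_right' (ν := volume) using 2 with z
    rw [← lintegral_indicator (DyadicInterval.measurableSet_toSet _)]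
    refine lintegral_congr fun t => ?_
    have : t ∈ (DyadicInterval.cell n z.2).toSet ↔ ⌊t * 2 ^ n⌋ = ⌊z.2 * 2 ^ n⌋ := by
      rw [DyadicInterval.mem_toSet_iff]
      simp [DyadicInterval.cell]
    by_cases h : t ∈ (DyadicInterval.cell n z.2).toSet
    · rw [indicator_of_mem h, indicator_of_mem (by exact this.1 h)]
    · rw [indicator_of_notMem h, indicator_of_notMem (by exact fun h' => h (this.2 h'))]

theorem measurable_maxFun_snd {F : ℝ × ℝ → ℝ≥0∞} (hF : Measurable F) :
    Measurable fun z : ℝ × ℝ => DyadicInterval.maxFun (fun t => F (z.1, t)) z.2 := by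
  unfold DyadicInterval.maxFun
  exact Measurable.iSup fun n => measurable_avg_cell_snd hF n

theorem measurable_of_swap_sections {M : (ℝ → ℝ≥0∞) → ℝ → ℝ≥0∞} {F : ℝ × ℝ → ℝ≥0∞}
    (h : Measurable fun z : ℝ × ℝ => M (fun t => F (t, z.1)) z.2) :
    Measurable fun z : ℝ × ℝ => M (fun s => F (s, z.2)) z.1 :=
  h.comp (measurable_snd.prodMk measurable_fst)

theorem measurable_maxFun_fst {F : ℝ × ℝ → ℝ≥0∞} (hF : Measurable F) :
    Measurable fun z : ℝ × ℝ => DyadicInterval.maxFun (fun s => F (s, z.2)) z.1 :=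
  have h1 : Measurable fun z : ℝ × ℝ => F (z.2, z.1) := hF.comp measurable_swap
  measurable_of_swap_sections (M := DyadicInterval.maxFun) (measurable_maxFun_snd h1)

/-- The strong maximal function is at most the composition of the two one-variable maximal
functions, so the constant is `8 * 8`. -/
theorem lintegral_maxFun_sq_le {F : ℝ × ℝ → ℝ≥0∞} (hF : Measurable F) :
    ∫⁻ z, maxFun F z ^ 2 ≤ 64 * ∫⁻ z, F z ^ 2 := by
  obtain ⟨N, hN⟩ : ∃ N : ℝ × ℝ → ℝ≥0∞, N = fun z => DyadicInterval.maxFun (fun t => F (z.1, t)) z.2 :=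
    ⟨_, rfl⟩
  have hNm : Measurable N := by rw [hN]; exact measurable_maxFun_snd hF
  have h1 : ∀ z, maxFun F z ≤ DyadicInterval.maxFun (fun s => N (s, z.2)) z.1 := fun z => by
    refine iSup_le fun n => ?_
    rw [avg_eq _ hF]
    refine le_trans (DyadicInterval.avg_mono fun s _ => ?_)
      (DyadicInterval.avg_le_maxFun (DyadicInterval.mem_cell _ _) _)
    rw [hN]
    exact DyadicInterval.avg_le_maxFun (DyadicInterval.mem_cell _ _) _
  have hNs : Measurable fun z : ℝ × ℝ => N (z.2, z.1) := hNm.comp measurable_swap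
  have hNm' := measurable_maxFun_fst hNm
  have h2 : ∫⁻ z : ℝ × ℝ, DyadicInterval.maxFun (fun s => N (s, z.2)) z.1 ^ 2 =
      ∫⁻ t, ∫⁻ s, DyadicInterval.maxFun (fun s => N (s, t)) s ^ 2 :=
    lintegral_prod_symm' _ (hNm'.pow_const 2)
  have h3 : ∫⁻ t, ∫⁻ s, N (s, t) ^ 2 = ∫⁻ s, ∫⁻ t, N (s, t) ^ 2 :=
    lintegral_lintegral_swap (f := fun t s => N (s, t) ^ 2) (hNs.pow_const 2).aemeasurable
  have h4 : ∫⁻ z : ℝ × ℝ, F z ^ 2 = ∫⁻ s, ∫⁻ t, F (s, t) ^ 2 :=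
    lintegral_prod _ (hF.pow_const 2).aemeasurable
  have h5 : ∫⁻ t, ∫⁻ s, DyadicInterval.maxFun (fun s => N (s, t)) s ^ 2 ≤
      ∫⁻ t, 8 * ∫⁻ s, N (s, t) ^ 2 :=
    lintegral_mono fun t => DyadicInterval.lintegral_maxFun_sq_le (hNm.comp measurable_prodMk_right)
  have h6 : ∫⁻ s, ∫⁻ t, N (s, t) ^ 2 ≤ ∫⁻ s, 8 * ∫⁻ t, F (s, t) ^ 2 :=
    lintegral_mono fun s => by
      simp only [hN]
      exact DyadicInterval.lintegral_maxFun_sq_le (hF.comp measurable_prodMk_left)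
  have h8 : (8 : ℝ≥0∞) ≠ ⊤ := by norm_num
  rw [lintegral_const_mul' _ _ h8] at h5 h6
  calc ∫⁻ z, maxFun F z ^ 2 ≤ ∫⁻ z, DyadicInterval.maxFun (fun s => N (s, z.2)) z.1 ^ 2 :=
        lintegral_mono fun z => pow_le_pow_left' (h1 z) 2
    _ ≤ 8 * ∫⁻ s, ∫⁻ t, N (s, t) ^ 2 := by rw [h2, ← h3]; exact h5
    _ ≤ 8 * (8 * ∫⁻ z, F z ^ 2) := by rw [h4]; gcongr
    _ = 64 * ∫⁻ z, F z ^ 2 := by rw [← mul_assoc]; norm_num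

end DyadicRect

/-! ### Cauchy–Schwarz inequalities, Carleson embedding and the H¹–BMO inequality. -/

namespace ENNReal

theorem rpow_half_mul_rpow_half_sq (a b : ℝ≥0∞) :
    (a ^ (1 / (2 : ℝ)) * b ^ (1 / (2 : ℝ))) ^ 2 = a * b := by
  rw [← ENNReal.mul_rpow_of_nonneg _ _ (by norm_num), ← ENNReal.rpow_natCast, ← ENNReal.rpow_mul]
  norm_num

theorem sq_sum_mul_le {ι : Type*} (s : Finset ι) (f g : ι → ℝ≥0∞) :
    (∑ i ∈ s, f i * g i) ^ 2 ≤ (∑ i ∈ s, f i ^ 2) * ∑ i ∈ s, g i ^ 2 := by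
  have h := ENNReal.inner_le_Lp_mul_Lq s f g (p := 2) (q := 2) Real.HolderConjugate.two_two
  refine (pow_le_pow_left' h 2).trans_eq ?_
  rw [rpow_half_mul_rpow_half_sq]
  simp

theorem sq_lintegral_mul_le {α : Type*} [MeasurableSpace α] {μ : Measure α} {f g : α → ℝ≥0∞}
    (hf : AEMeasurable f μ) (hg : AEMeasurable g μ) :
    (∫⁻ x, f x * g x ∂μ) ^ 2 ≤ (∫⁻ x, f x ^ 2 ∂μ) * ∫⁻ x, g x ^ 2 ∂μ := by
  have h := ENNReal.lintegral_mul_le_Lp_mul_Lq μ (p := 2) (q := 2) Real.HolderConjugate.two_two hf hg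
  refine (pow_le_pow_left' h 2).trans_eq ?_
  rw [rpow_half_mul_rpow_half_sq]
  simp

theorem le_of_sq_le_sq {a b : ℝ≥0∞} (h : a ^ 2 ≤ b ^ 2) : a ≤ b :=
  (ENNReal.pow_right_strictMono two_ne_zero).le_iff_le.1 h

theorem lintegral_volume_lt {α : Type*} [MeasurableSpace α] (μ : Measure α) [SFinite μ]
    {f : α → ℝ≥0∞} (hf : Measurable f) :
    ∫⁻ t in Ioi (0 : ℝ), μ {x | ENNReal.ofReal t < f x} = ∫⁻ x, f x ∂μ := by
  have hS : MeasurableSet {p : ℝ × α | ENNReal.ofReal p.1 < f p.2} :=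
    measurableSet_lt (by fun_prop) (by fun_prop)
  calc ∫⁻ t in Ioi (0 : ℝ), μ {x | ENNReal.ofReal t < f x}
      = ∫⁻ t in Ioi (0 : ℝ), ∫⁻ x, {t | ENNReal.ofReal t < f x}.indicator 1 t ∂μ := by
        refine lintegral_congr fun t => ?_
        rw [← lintegral_indicator_one (measurableSet_lt measurable_const hf)]
        rfl
    _ = ∫⁻ x, f x ∂μ := by
        rw [lintegral_lintegral_swap]
        · exact lintegral_congr fun x => ENNReal.lintegral_one_lt _
        · exact (measurable_one.indicator hS).aemeasurable

end ENNReal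

namespace DyadicRect

noncomputable instance : DecidableEq DyadicRect := Classical.decEq _

/-- The Carleson condition with constant `A` over finite families of rectangles. -/
def IsCarleson (c : DyadicRect → ℝ≥0∞) (A : ℝ≥0∞) : Prop :=
  ∀ T : Finset DyadicRect, ∑ R ∈ T, c R ≤ A * volume (⋃ R ∈ T, R.toSet)

theorem measurable_indicator (R : DyadicRect) (c : ℝ≥0∞) :
    Measurable (R.toSet.indicator fun _ => c) :=
  measurable_const.indicator R.measurableSet_toSet

/-- Layer cake in `u`: the rectangles with `u R > t` form a subfamily whose union lies in `{g > t}`,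
and the Carleson condition applies to that subfamily. -/
theorem IsCarleson.embedding {c : DyadicRect → ℝ≥0∞} {A : ℝ≥0∞} {T : Finset DyadicRect}
    (hc : ∀ T' ⊆ T, ∑ R ∈ T', c R ≤ A * volume (⋃ R ∈ T', R.toSet)) (u : DyadicRect → ℝ≥0∞)
    (g : ℝ × ℝ → ℝ≥0∞) (hg : ∀ R ∈ T, ∀ z ∈ R.toSet, u R ≤ g z) :
    ∑ R ∈ T, c R * u R ≤ A * ∫⁻ z, g z := by
  -- The smallest admissible majorant. It is measurable, whereas nothing of the kind is assumed of
  -- `g`.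
  set f : ℝ × ℝ → ℝ≥0∞ := fun z => ⨆ R ∈ T, R.toSet.indicator (fun _ => u R) z with hf
  have hfm : Measurable f :=
    by
      exact Measurable.iSup fun R => Measurable.iSup fun _ => measurable_indicator R _
  have hm : ∀ y : ℝ≥0∞, MeasurableSet {t : ℝ | ENNReal.ofReal t < y} := fun y =>
    measurableSet_lt ENNReal.measurable_ofReal measurable_const
  calc ∑ R ∈ T, c R * u R
      = ∑ R ∈ T, ∫⁻ t in Ioi (0 : ℝ), c R * {t | ENNReal.ofReal t < u R}.indicator 1 t := by
        refine Finset.sum_congr rfl fun R _ => ?_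
        rw [lintegral_const_mul _ (measurable_one.indicator (hm _)), ENNReal.lintegral_one_lt]
    _ = ∫⁻ t in Ioi (0 : ℝ), ∑ R ∈ T, c R * {t | ENNReal.ofReal t < u R}.indicator 1 t := by
        rw [lintegral_finsetSum]
        exact fun R _ => (measurable_one.indicator (hm _)).const_mul _
    _ ≤ ∫⁻ t in Ioi (0 : ℝ), A * volume {z | ENNReal.ofReal t < f z} := by
        refine lintegral_mono fun t => ?_
        classical
        calc ∑ R ∈ T, c R * {t | ENNReal.ofReal t < u R}.indicator 1 t
            = ∑ R ∈ T with ENNReal.ofReal t < u R, c R := by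
              rw [Finset.sum_filter]
              refine Finset.sum_congr rfl fun R _ => ?_
              by_cases h : ENNReal.ofReal t < u R <;> simp [h]
          _ ≤ A * volume (⋃ R ∈ T.filter fun R => ENNReal.ofReal t < u R, R.toSet) :=
              hc _ (Finset.filter_subset _ _)
          _ ≤ _ := by
              gcongr
              refine iUnion₂_subset fun R hR z hz => ?_
              rw [Finset.mem_filter] at hR
              refine lt_of_lt_of_le hR.2 ?_
              refine le_iSup₂_of_le R hR.1 ?_
              rw [indicator_of_mem hz]
    _ = A * ∫⁻ z, f z := by
        rw [lintegral_const_mul, ENNReal.lintegral_volume_lt _ hfm]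
        refine Antitone.measurable fun s t hst => ?_
        exact measure_mono fun z hz => (ENNReal.ofReal_le_ofReal hst).trans_lt hz
    _ ≤ A * ∫⁻ z, g z := by
        gcongr with z
        refine iSup₂_le fun R hR => ?_
        by_cases h : z ∈ R.toSet
        · rw [indicator_of_mem h]; exact hg R hR z h
        · rw [indicator_of_notMem h]; exact zero_le

/-- The square of the dyadic square function of a finite family of coefficients. -/
noncomputable def sqFun (T : Finset DyadicRect) (x : DyadicRect → ℝ≥0∞) (z : ℝ × ℝ) : ℝ≥0∞ :=
  ∑ R ∈ T, R.toSet.indicator (fun _ => x R ^ 2 / volume R.toSet) z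

theorem measurable_sqFun (T : Finset DyadicRect) (x : DyadicRect → ℝ≥0∞) : Measurable (sqFun T x) :=
  Finset.measurable_fun_sum _ fun R _ => measurable_indicator R _

theorem le_sqFun {T : Finset DyadicRect} (x : DyadicRect → ℝ≥0∞) {R : DyadicRect} (hR : R ∈ T)
    {z : ℝ × ℝ} (hz : z ∈ R.toSet) : x R ^ 2 / volume R.toSet ≤ sqFun T x z := by
  refine le_trans (le_of_eq ?_)
    (Finset.single_le_sum (f := fun R => R.toSet.indicator (fun _ => x R ^ 2 / volume R.toSet) z)
      (fun _ _ => bot_le) hR)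
  simp [hz]

theorem sqFun_le {T : Finset DyadicRect} (x : DyadicRect → ℝ≥0∞) (z : ℝ × ℝ) :
    sqFun T x z ≤ ∑ R ∈ T, x R ^ 2 / volume R.toSet :=
  Finset.sum_le_sum fun _ _ => indicator_le_self _ _ z

theorem sum_sq_mul_avg (T : Finset DyadicRect) (x : DyadicRect → ℝ≥0∞) {g : ℝ × ℝ → ℝ≥0∞}
    (hg : Measurable g) :
    ∑ R ∈ T, x R ^ 2 * R.avg g = ∫⁻ z, sqFun T x z * g z := by
  simp only [sqFun, Finset.sum_mul]
  rw [lintegral_finsetSum (f := fun (R : DyadicRect) z =>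
    R.toSet.indicator (fun _ => x R ^ 2 / volume R.toSet) z * g z) _
    fun R _ => (measurable_indicator R _).mul hg]
  refine Finset.sum_congr rfl fun R _ => ?_
  simp only [← indicator_mul_left]
  rw [lintegral_indicator R.measurableSet_toSet, lintegral_const_mul _ hg, avg, div_eq_mul_inv,
    mul_assoc]

/-- Hölder with exponents `3/2` and `3` applied to `1 = q^(1/6) q^(-1/6)`, then cubed. -/
theorem one_le_sq_avg_mul_avg (R : DyadicRect) {q : ℝ × ℝ → ℝ≥0∞} (hq : Measurable q)
    (h0 : ∀ z ∈ R.toSet, q z ≠ 0) (ht : ∀ z, q z ≠ ⊤) :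
    1 ≤ R.avg (fun z => q z ^ (1 / 4 : ℝ)) ^ 2 * R.avg (fun z => q z ^ (-(1 / 2) : ℝ)) := by
  have hpq : (3 / 2 : ℝ).HolderConjugate 3 := by
    rw [Real.holderConjugate_iff]; norm_num
  have h := ENNReal.lintegral_mul_le_Lp_mul_Lq (volume.restrict R.toSet) hpq
    (f := fun z => q z ^ (1 / 6 : ℝ)) (g := fun z => q z ^ (-(1 / 6) : ℝ))
    (hq.pow_const _).aemeasurable (hq.pow_const _).aemeasurable
  have h1 : ∫⁻ z in R.toSet, ((fun z => q z ^ (1 / 6 : ℝ)) * fun z => q z ^ (-(1 / 6) : ℝ)) z =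
      volume R.toSet := by
    rw [setLIntegral_congr_fun (g := fun _ => 1) R.measurableSet_toSet]
    · simp
    · intro z hz
      simp only [Pi.mul_apply]
      rw [← ENNReal.rpow_add _ _ (h0 z hz) (ht z)]
      norm_num
  rw [h1] at h
  simp only [← ENNReal.rpow_mul] at h
  norm_num at h
  have h3 := ENNReal.rpow_le_rpow h (z := 3) (by norm_num)
  rw [ENNReal.mul_rpow_of_nonneg _ _ (by norm_num), ← ENNReal.rpow_mul, ← ENNReal.rpow_mul] at h3
  norm_num at h3
  have hv0 := R.volume_ne_zero
  have hvt := R.volume_ne_top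
  unfold avg
  calc (1 : ℝ≥0∞) = (volume R.toSet)⁻¹ ^ 3 * volume R.toSet ^ 3 := by
        rw [← mul_pow, ENNReal.inv_mul_cancel hv0 hvt, one_pow]
    _ ≤ (volume R.toSet)⁻¹ ^ 3 * ((∫⁻ z in R.toSet, q z ^ (1 / 4 : ℝ)) ^ 2 *
          ∫⁻ z in R.toSet, q z ^ (-(1 / 2) : ℝ)) := by
        gcongr
    _ = _ := by ring

/-- The H¹–BMO inequality. With `q` the squared square function of `x` and `a R` the mean of
`q^(1/4)`, write `φ x = (φ a)(x / a)` and apply Cauchy–Schwarz. Carleson embedding and the maximal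
theorem bound the first sum by `64 A ∫ q^(1/2)`. For the second, `a⁻²` is at most the mean of
`q^(-1/2)`, and `∫ q · q^(-1/2) = ∫ q^(1/2)`. -/
theorem sum_mul_sq_le {φ : DyadicRect → ℝ≥0∞} {A : ℝ≥0∞} {T : Finset DyadicRect}
    (hφ : ∀ T' ⊆ T, ∑ R ∈ T', φ R ^ 2 ≤ A * volume (⋃ R ∈ T', R.toSet)) {x : DyadicRect → ℝ≥0∞}
    (hx : ∀ R ∈ T, x R ≠ ⊤) :
    (∑ R ∈ T, φ R * x R) ^ 2 ≤ 64 * A * (∫⁻ z, sqFun T x z ^ (1 / 2 : ℝ)) ^ 2 := by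
  set q := sqFun T x
  have hq : Measurable q := measurable_sqFun T x
  have hqt : ∀ z, q z ≠ ⊤ := fun z => ne_top_of_le_ne_top
    (ENNReal.sum_ne_top.2 fun R hR => ENNReal.div_ne_top (ENNReal.pow_ne_top (hx R hR)) R.volume_ne_zero)
    (sqFun_le x z)
  set a : DyadicRect → ℝ≥0∞ := fun R => R.avg fun z => q z ^ (1 / 4 : ℝ)
  have key : ∀ R ∈ T, x R ≠ 0 → a R ≠ 0 ∧ a R ≠ ⊤ ∧ (a R)⁻¹ ^ 2 ≤ R.avg fun z => q z ^ (-(1 / 2) : ℝ) := by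
    intro R hR hxR
    have hpos : x R ^ 2 / volume R.toSet ≠ 0 := ENNReal.div_ne_zero.2 ⟨pow_ne_zero 2 hxR, R.volume_ne_top⟩
    have h0 : ∀ z ∈ R.toSet, q z ≠ 0 := fun z hz h =>
      hpos (le_antisymm ((le_sqFun x hR hz).trans_eq h) bot_le)
    have h1 := one_le_sq_avg_mul_avg R hq h0 hqt
    have hat : a R ≠ ⊤ := by
      refine ENNReal.mul_ne_top (ENNReal.inv_ne_top.2 R.volume_ne_zero) ?_
      refine ne_top_of_le_ne_top (b := (∑ R ∈ T, x R ^ 2 / volume R.toSet) ^ (1 / 4 : ℝ) *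
        volume R.toSet) (ENNReal.mul_ne_top (ENNReal.rpow_ne_top_of_nonneg (by norm_num)
          (ENNReal.sum_ne_top.2 fun R hR => ENNReal.div_ne_top (ENNReal.pow_ne_top (hx R hR))
            R.volume_ne_zero)) R.volume_ne_top) ?_
      rw [← setLIntegral_const]
      exact lintegral_mono fun z => ENNReal.rpow_le_rpow (sqFun_le x z) (by norm_num)
    have ha0 : a R ≠ 0 := fun h => by
      change 1 ≤ a R ^ 2 * _ at h1
      rw [h] at h1
      norm_num at h1
    refine ⟨ha0, hat, ?_⟩
    calc (a R)⁻¹ ^ 2 ≤ (a R)⁻¹ ^ 2 * (a R ^ 2 * R.avg fun z => q z ^ (-(1 / 2) : ℝ)) :=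
          le_mul_of_one_le_right' h1
      _ = _ := by
          rw [← mul_assoc, ← mul_pow, ENNReal.inv_mul_cancel ha0 hat, one_pow, one_mul]
  have e1 : ∑ R ∈ T, φ R * x R ≤ ∑ R ∈ T, (φ R * a R) * (x R * (a R)⁻¹) := by
    refine Finset.sum_le_sum fun R hR => ?_
    by_cases h : x R = 0
    · simp [h]
    · obtain ⟨h1, h2, -⟩ := key R hR h
      rw [mul_mul_mul_comm, ENNReal.mul_inv_cancel h1 h2, mul_one]
  have e2 : ∑ R ∈ T, (φ R * a R) ^ 2 ≤ 64 * A * ∫⁻ z, q z ^ (1 / 2 : ℝ) := by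
    have := IsCarleson.embedding hφ (fun R => a R ^ 2) (fun z => maxFun (fun z => q z ^ (1 / 4 : ℝ)) z ^ 2)
      fun R _ z hz => pow_le_pow_left' (avg_le_maxFun hz _) 2
    simp only [mul_pow]
    refine this.trans ?_
    have h2 := lintegral_maxFun_sq_le (hq.pow_const (1 / 4 : ℝ))
    have h3 : ∀ z, (q z ^ (1 / 4 : ℝ)) ^ 2 = q z ^ (1 / 2 : ℝ) := fun z => by
      rw [← ENNReal.rpow_natCast, ← ENNReal.rpow_mul]; norm_num
    simp only [h3] at h2
    calc _ ≤ A * (64 * ∫⁻ z, q z ^ (1 / 2 : ℝ)) := by gcongr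
      _ = _ := by ring
  have e3 : ∑ R ∈ T, (x R * (a R)⁻¹) ^ 2 ≤ ∫⁻ z, q z ^ (1 / 2 : ℝ) := by
    calc ∑ R ∈ T, (x R * (a R)⁻¹) ^ 2 ≤ ∑ R ∈ T, x R ^ 2 * R.avg fun z => q z ^ (-(1 / 2) : ℝ) := by
          refine Finset.sum_le_sum fun R hR => ?_
          by_cases h : x R = 0
          · simp [h]
          · rw [mul_pow]
            gcongr
            exact (key R hR h).2.2
      _ = ∫⁻ z, q z * q z ^ (-(1 / 2) : ℝ) := sum_sq_mul_avg T x (hq.pow_const _)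
      _ ≤ ∫⁻ z, q z ^ (1 / 2 : ℝ) := by
          refine lintegral_mono fun z => ?_
          by_cases h : q z = 0
          · simp [h]
          · nth_rewrite 1 [← ENNReal.rpow_one (q z)]
            rw [← ENNReal.rpow_add _ _ h (hqt z)]
            norm_num
  calc (∑ R ∈ T, φ R * x R) ^ 2 ≤ (∑ R ∈ T, (φ R * a R) * (x R * (a R)⁻¹)) ^ 2 := by gcongr
    _ ≤ _ := ENNReal.sq_sum_mul_le _ _ _
    _ ≤ _ := mul_le_mul' e2 e3
    _ = _ := by ring

end DyadicRect

/-! ### Logarithmic maximal functions. -/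

namespace DyadicInterval

/-- The supremum over the dyadic `I ∋ x` with `|I| ≤ 2` and over `n` of the means over `I` of
`γ n (cell n ·) / (n + 1)`. -/
noncomputable def logMax (γ : ℕ → DyadicInterval → ℝ≥0∞) (x : ℝ) : ℝ≥0∞ :=
  ⨆ l : ℕ, ⨆ n : ℕ, (cell (l - 1) x).avg (fun y => γ n (cell n y)) / (n + 1)

theorem avg_le_logMax (γ : ℕ → DyadicInterval → ℝ≥0∞) {I : DyadicInterval} (hI : -1 ≤ I.gen) {x : ℝ}
    (hx : x ∈ I.toSet) (n : ℕ) :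
    I.avg (fun y => γ n (cell n y)) ≤ (n + 1) * logMax γ x := by
  have h : I.avg (fun y => γ n (cell n y)) / (n + 1) ≤ logMax γ x := by
    refine le_iSup_of_le (I.gen + 1).toNat (le_iSup_of_le n ?_)
    rw [show (((I.gen + 1).toNat : ℕ) : ℤ) - 1 = I.gen by omega, mem_toSet_iff.1 hx]
  rw [ENNReal.div_le_iff (by simp) (by finiteness), mul_comm] at h
  exact h

theorem measurable_cell_nat (n : ℕ) (γ : DyadicInterval → ℝ≥0∞) :
    Measurable fun x : ℝ => γ (cell n x) := measurable_cell_comp n γ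

/-- The increments `δ k` are constant on cells of generation `k`, so among generations `-1, 0, 1, …`
each has at most `k + 2` different means at a point. Replacing the supremum of these means by their
sum costs `k + 2`, the division by `n + 1 ≥ k + 1` compensates for it, and the increments add up to
the supremum of `γ`. -/
theorem lintegral_logMax_le (γ : ℕ → DyadicInterval → ℝ≥0∞)
    (hγ : ∀ n x, γ n (cell n x) ≤ γ (n + 1) (cell (n + 1 : ℕ) x)) :
    ∫⁻ x, logMax γ x ≤ 2 * ∫⁻ x, ⨆ n, γ n (cell n x) := by
  let δ : ℕ → ℝ → ℝ≥0∞ := fun k x =>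
    γ k (cell k x) - (if k = 0 then 0 else γ (k - 1) (cell (k - 1 : ℕ) x))
  have hδm : ∀ k, Measurable (δ k) := fun k => by
    refine (measurable_cell_nat k _).sub ?_
    split_ifs
    · exact measurable_const
    · exact measurable_cell_nat _ _
  have hsum : ∀ n x, γ n (cell n x) = ∑ k ∈ Finset.range (n + 1), δ k x := fun n x => by
    induction n with
    | zero => simp [δ]
    | succ n ih =>
      rw [Finset.sum_range_succ, ← ih]
      simp only [δ, Nat.succ_ne_zero, if_false, Nat.add_sub_cancel]
      exact (add_tsub_cancel_of_le (hγ n x)).symm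
  have hconst : ∀ k : ℕ, ∀ I : DyadicInterval, (k : ℤ) ≤ I.gen → ∀ x ∈ I.toSet, ∀ y ∈ I.toSet,
      δ k x = δ k y := by
    intro k I hI x hx y hy
    have h1 : ∀ j : ℕ, j ≤ k → cell j x = cell j y := fun j hj => by
      have hx' := anc_cell (I.gen - j).toNat I.gen x
      have hy' := anc_cell (I.gen - j).toNat I.gen y
      have e : I.gen - ((I.gen - j).toNat : ℤ) = j := by omega
      rw [e] at hx' hy'
      rw [← hx', ← hy', mem_toSet_iff.1 hx, mem_toSet_iff.1 hy]
    simp only [δ, h1 k le_rfl, h1 (k - 1) (Nat.sub_le _ _)]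
  -- Index `l` stands for generation `l - 1`. From generation `k` on, the mean of `δ k` is its value
  -- at `x`, which is already the term with index `k + 1`.
  have havg : ∀ (k l : ℕ) (x : ℝ), (cell (l - 1) x).avg (δ k) ≤
      ∑ l' ∈ Finset.range (k + 2), (cell (l' - 1) x).avg (δ k) := by
    intro k l x
    by_cases hl : l < k + 2
    · exact Finset.single_le_sum (f := fun l' : ℕ => (cell (l' - 1) x).avg (δ k))
        (fun _ _ => bot_le) (Finset.mem_range.2 hl)
    · have e1 : (cell (l - 1) x).avg (δ k) = (cell ((k + 1 : ℕ) - 1) x).avg (δ k) := by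
        have h1 : ∀ I : DyadicInterval, (k : ℤ) ≤ I.gen → x ∈ I.toSet → I.avg (δ k) = δ k x := by
          intro I hI hx
          rw [← avg_const I (δ k x)]
          exact le_antisymm (avg_mono fun y hy => (hconst k I hI y hy x hx).le)
            (avg_mono fun y hy => (hconst k I hI y hy x hx).ge)
        rw [h1 _ (by simp only [cell_gen]; omega) (mem_cell _ _),
          h1 _ (by simp only [cell_gen]; omega) (mem_cell _ _)]
      rw [e1]
      exact Finset.single_le_sum (f := fun l' : ℕ => (cell (l' - 1) x).avg (δ k))
        (fun _ _ => bot_le) (Finset.mem_range.2 (by omega))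
  have hpt : ∀ x, logMax γ x ≤ ∑' k : ℕ, ((k : ℝ≥0∞) + 1)⁻¹ *
      ∑ l' ∈ Finset.range (k + 2), (cell (l' - 1) x).avg (δ k) := by
    intro x
    refine iSup_le fun l => iSup_le fun n => ?_
    have e : (cell (l - 1) x).avg (fun y => γ n (cell n y)) =
        ∑ k ∈ Finset.range (n + 1), (cell (l - 1) x).avg (δ k) := by
      simp only [hsum, avg]
      rw [lintegral_finsetSum _ fun k _ => hδm k, Finset.mul_sum]
    rw [e, div_eq_mul_inv, Finset.sum_mul]
    refine le_trans (Finset.sum_le_sum fun k hk => ?_) (ENNReal.sum_le_tsum (Finset.range (n + 1)))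
    rw [mul_comm]
    have hk' : (k : ℝ≥0∞) + 1 ≤ n + 1 := by
      gcongr
      exact Nat.lt_succ_iff.1 (Finset.mem_range.1 hk)
    exact mul_le_mul' (ENNReal.inv_le_inv.2 hk') (havg k l x)
  have hIm : ∀ k l', Measurable fun x => (cell ((l' : ℕ) - 1) x).avg (δ k) := fun k l' =>
    measurable_cell_comp _ fun I => I.avg (δ k)
  calc ∫⁻ x, logMax γ x ≤ ∫⁻ x, ∑' k : ℕ, ((k : ℝ≥0∞) + 1)⁻¹ *
          ∑ l' ∈ Finset.range (k + 2), (cell (l' - 1) x).avg (δ k) := lintegral_mono hpt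
    _ = ∑' k : ℕ, ((k : ℝ≥0∞) + 1)⁻¹ * ((k + 2) * ∫⁻ x, δ k x) := by
        rw [lintegral_tsum fun k => ((Finset.measurable_fun_sum _ fun l' _ => hIm k l').const_mul _).aemeasurable]
        congr 1; ext k
        rw [lintegral_const_mul _ (Finset.measurable_fun_sum _ fun l' _ => hIm k l'),
          lintegral_finsetSum _ fun l' _ => hIm k l']
        simp [lintegral_avg_cell]
    _ ≤ ∑' k : ℕ, 2 * ∫⁻ x, δ k x := by
        refine ENNReal.tsum_le_tsum fun k => ?_
        rw [← mul_assoc]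
        gcongr
        rw [mul_comm, ← div_eq_mul_inv, ENNReal.div_le_iff (by simp) (by finiteness)]
        norm_cast
        omega
    _ = 2 * ∫⁻ x, ∑' k, δ k x := by
        rw [ENNReal.tsum_mul_left, lintegral_tsum fun k => (hδm k).aemeasurable]
    _ ≤ 2 * ∫⁻ x, ⨆ n, γ n (cell n x) := by
        gcongr with x
        rw [ENNReal.tsum_eq_iSup_nat]
        refine iSup_le fun n => ?_
        cases n with
        | zero => simp
        | succ n => rw [← hsum]; exact le_iSup (fun n : ℕ => γ n (cell n x)) n

end DyadicInterval

namespace DyadicRect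

open DyadicInterval (logMax)

open Classical in
/-- `1` if `I × J ⊆ U`, else `0`. -/
noncomputable def contained (U : Set (ℝ × ℝ)) (R : DyadicRect) : ℝ≥0∞ :=
  if R.toSet ⊆ U then 1 else 0

theorem contained_mono {U : Set (ℝ × ℝ)} {R R' : DyadicRect} (h : R'.toSet ⊆ R.toSet) :
    contained U R ≤ contained U R' := by
  unfold contained
  split_ifs with h1 h2
  · exact le_rfl
  · exact absurd (h.trans h1) h2
  · exact bot_le
  · exact le_rfl

theorem contained_le {U : Set (ℝ × ℝ)} {R : DyadicRect} {z : ℝ × ℝ} (hz : z ∈ R.toSet) :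
    contained U R ≤ U.indicator 1 z := by
  unfold contained
  split_ifs with h
  · simp [h hz]
  · exact bot_le

theorem cell_succ_subset (n : ℕ) (x : ℝ) :
    (DyadicInterval.cell (n + 1 : ℕ) x).toSet ⊆ (DyadicInterval.cell n x).toSet :=
  DyadicInterval.subset_of_mem (DyadicInterval.mem_cell _ _) (DyadicInterval.mem_cell _ _)
    (by simp)

/-- The one variable logarithmic maximal function of the containment indicator. -/
noncomputable def logMax₁ (U : Set (ℝ × ℝ)) (J : DyadicInterval) (s : ℝ) : ℝ≥0∞ :=
  logMax (fun _ I => contained U (I, J)) s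

/-- The two variable logarithmic maximal function of the containment indicator. -/
noncomputable def logMax₂ (U : Set (ℝ × ℝ)) (z : ℝ × ℝ) : ℝ≥0∞ :=
  logMax (fun _ J => logMax₁ U J z.1) z.2

theorem logMax₁_mono (U : Set (ℝ × ℝ)) {J J' : DyadicInterval} (h : J'.toSet ⊆ J.toSet) (s : ℝ) :
    logMax₁ U J s ≤ logMax₁ U J' s := by
  unfold logMax₁ logMax
  gcongr
  refine DyadicInterval.avg_mono fun y _ => contained_mono (prod_mono_right h)

theorem measurable_logMax₁ (U : Set (ℝ × ℝ)) (n : ℤ) :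
    Measurable fun z : ℝ × ℝ => logMax₁ U (DyadicInterval.cell n z.2) z.1 := by
  unfold logMax₁ logMax
  refine Measurable.iSup fun l => Measurable.iSup fun k => ?_
  exact measurable_cell_comp (l - 1, n) fun R =>
    R.1.avg (fun y => contained U (DyadicInterval.cell k y, R.2)) / (k + 1)

/-- The functions increase with `n`, so monotone convergence takes the supremum outside the
integral. For fixed `n` the one-variable bound is applied on each horizontal line. -/
theorem lintegral_iSup_logMax₁_le {U : Set (ℝ × ℝ)} (hU : MeasurableSet U) :
    ∫⁻ z : ℝ × ℝ, ⨆ n : ℕ, logMax₁ U (DyadicInterval.cell n z.2) z.1 ≤ 2 * volume U := by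
  rw [lintegral_iSup fun n => measurable_logMax₁ U n]
  · refine iSup_le fun n => ?_
    have h1 : ∀ t, ∫⁻ s, logMax₁ U (DyadicInterval.cell n t) s ≤ 2 * ∫⁻ s, U.indicator 1 (s, t) := by
      intro t
      have hmono : ∀ (k : ℕ) (x : ℝ),
          contained U (DyadicInterval.cell k x, DyadicInterval.cell n t) ≤
            contained U (DyadicInterval.cell (k + 1 : ℕ) x, DyadicInterval.cell n t) := fun k x =>
        contained_mono (R := (DyadicInterval.cell k x, DyadicInterval.cell n t))
          (R' := (DyadicInterval.cell (k + 1 : ℕ) x, DyadicInterval.cell n t))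
          (prod_mono_left (cell_succ_subset k x))
      refine (DyadicInterval.lintegral_logMax_le
        (fun _ I => contained U (I, DyadicInterval.cell n t)) hmono).trans ?_
      gcongr with s
      exact iSup_le fun k => contained_le ⟨DyadicInterval.mem_cell _ _, DyadicInterval.mem_cell _ _⟩
    have hm : Measurable (U.indicator (1 : ℝ × ℝ → ℝ≥0∞)) := measurable_one.indicator hU
    calc ∫⁻ z : ℝ × ℝ, logMax₁ U (DyadicInterval.cell n z.2) z.1
        = ∫⁻ t, ∫⁻ s, logMax₁ U (DyadicInterval.cell n t) s :=
          lintegral_prod_symm' _ (measurable_logMax₁ U n)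
      _ ≤ ∫⁻ t, 2 * ∫⁻ s, U.indicator 1 (s, t) := lintegral_mono h1
      _ = 2 * volume U := by
          rw [lintegral_const_mul' _ _ (by norm_num), ← lintegral_indicator_one hU]
          congr 1
          exact (lintegral_prod_symm' _ hm).symm
  · exact monotone_nat_of_le_succ fun n z => logMax₁_mono U (cell_succ_subset n z.2) z.1

/-- The one-variable bound in the second variable, with `logMax₁` as the increasing family, followed
by `lintegral_iSup_logMax₁_le` in the first; each costs a factor 2. -/
theorem lintegral_logMax₂_le {U : Set (ℝ × ℝ)} (hU : MeasurableSet U) :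
    ∫⁻ z, logMax₂ U z ≤ 4 * volume U := by
  calc ∫⁻ z, logMax₂ U z ≤ ∫⁻ s, ∫⁻ t, logMax₂ U (s, t) := lintegral_prod_le _
    _ ≤ ∫⁻ s, 2 * ∫⁻ t, ⨆ n : ℕ, logMax₁ U (DyadicInterval.cell n t) s := by
        refine lintegral_mono fun s => ?_
        exact DyadicInterval.lintegral_logMax_le (fun _ J => logMax₁ U J s)
          fun n x => logMax₁_mono U (cell_succ_subset n x) s
    _ = 2 * ∫⁻ z : ℝ × ℝ, ⨆ n : ℕ, logMax₁ U (DyadicInterval.cell n z.2) z.1 := by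
        rw [lintegral_const_mul' _ _ (by norm_num)]
        congr 1
        exact (lintegral_prod (μ := volume) (ν := volume) (fun z : ℝ × ℝ => ⨆ n : ℕ, logMax₁ U (DyadicInterval.cell n z.2) z.1) (Measurable.iSup fun n : ℕ => measurable_logMax₁ U n).aemeasurable).symm
    _ ≤ 2 * (2 * volume U) := mul_le_mul_right (lintegral_iSup_logMax₁_le hU) 2
    _ = 4 * volume U := by rw [← mul_assoc]; norm_num

theorem setLIntegral_contained_le₁ (U : Set (ℝ × ℝ)) {I J : DyadicInterval} (hI : -1 ≤ I.gen)
    {s : ℝ} (hs : s ∈ I.toSet) (n : ℕ) :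
    ∫⁻ y in I.toSet, contained U (DyadicInterval.cell n y, J) ≤
      volume I.toSet * ((n + 1) * logMax₁ U J s) := by
  rw [← DyadicInterval.volume_mul_avg]
  gcongr
  exact DyadicInterval.avg_le_logMax (fun _ I => contained U (I, J)) hI hs n

theorem setLIntegral_contained_le₂ (U : Set (ℝ × ℝ)) {R : DyadicRect} (h1 : -1 ≤ R.1.gen)
    (h2 : -1 ≤ R.2.gen) {z : ℝ × ℝ} (hz : z ∈ R.toSet) (m n : ℕ) :
    ∫⁻ y in R.toSet, contained U (cell (m, n) y) ≤
      volume R.toSet * ((m + 1) * (n + 1) * logMax₂ U z) := by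
  have hm : Measurable fun y : ℝ × ℝ => contained U (cell (m, n) y) := measurable_cell_comp _ _
  calc ∫⁻ y in R.toSet, contained U (cell (m, n) y)
      = ∫⁻ t in R.2.toSet, ∫⁻ s in R.1.toSet,
          contained U (DyadicInterval.cell m s, DyadicInterval.cell n t) := by
        rw [toSet, Measure.volume_eq_prod, ← Measure.prod_restrict]
        exact lintegral_prod_symm' _ hm
    _ ≤ ∫⁻ t in R.2.toSet, volume R.1.toSet * ((m + 1) * logMax₁ U (DyadicInterval.cell n t) z.1) :=
        lintegral_mono fun t => setLIntegral_contained_le₁ U h1 hz.1 m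
    _ = volume R.1.toSet * ((m + 1) * ∫⁻ t in R.2.toSet, logMax₁ U (DyadicInterval.cell n t) z.1) := by
        rw [lintegral_const_mul' _ _ R.1.volume_ne_top, lintegral_const_mul' _ _ (by finiteness)]
    _ ≤ volume R.1.toSet * ((m + 1) * (volume R.2.toSet * ((n + 1) * logMax₂ U z))) := by
        gcongr
        rw [← DyadicInterval.volume_mul_avg]
        gcongr
        exact DyadicInterval.avg_le_logMax (fun _ J => logMax₁ U J z.1) h2 hz.2 n
    _ = _ := by rw [volume_toSet]; ring

end DyadicRect

/-! ### Weights, blocks of generations and sums over ancestors in both variables. -/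

/-- The weight `√(n + 1)`. -/
noncomputable def sqrtWt (n : ℕ) : ℝ≥0∞ := ENNReal.ofReal √(n + 1)

namespace sqrtWt

theorem ne_zero (n : ℕ) : sqrtWt n ≠ 0 := by
  unfold sqrtWt
  simp only [ne_eq, ENNReal.ofReal_eq_zero, not_le]
  positivity

theorem ne_top (n : ℕ) : sqrtWt n ≠ ⊤ := ENNReal.ofReal_ne_top

theorem sq (n : ℕ) : sqrtWt n ^ 2 = n + 1 := by
  rw [sqrtWt, ← ENNReal.ofReal_pow (Real.sqrt_nonneg _), Real.sq_sqrt (by positivity),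
    ENNReal.ofReal_add (by positivity) zero_le_one]
  simp

theorem le_mul {a m k : ℕ} (h : m + 1 ≤ k ^ 2 * (a + 1)) : sqrtWt m ≤ k * sqrtWt a := by
  apply ENNReal.le_of_sq_le_sq
  rw [mul_pow, sq, sq]
  exact_mod_cast h

theorem sum_inv_le (m : ℕ) : ∑ a ∈ Finset.range (m + 1), (sqrtWt a)⁻¹ ≤ 2 * sqrtWt m := by
  have key : ∀ m : ℕ, ∑ a ∈ Finset.range m, (√((a : ℝ) + 1))⁻¹ ≤ 2 * √(m : ℝ) := by
    intro m
    induction m with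
    | zero => simp
    | succ m ih =>
      rw [Finset.sum_range_succ]
      push_cast
      have h1 : 0 < √((m : ℝ) + 1) := by positivity
      have h2 := Real.sq_sqrt (show (0 : ℝ) ≤ (m : ℝ) + 1 by positivity)
      have h3 := Real.sq_sqrt (show (0 : ℝ) ≤ (m : ℝ) by positivity)
      have h4 := Real.sqrt_nonneg (m : ℝ)
      -- Telescoping: `1/√(m+1) ≤ 2(√(m+1) - √m)`.
      have : (√((m : ℝ) + 1))⁻¹ ≤ 2 * √((m : ℝ) + 1) - 2 * √(m : ℝ) := by
        rw [inv_le_iff_one_le_mul₀ h1]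
        nlinarith [sq_nonneg (√((m : ℝ) + 1) - √(m : ℝ))]
      linarith
  have h1 : ∀ a ∈ Finset.range (m + 1), (sqrtWt a)⁻¹ = ENNReal.ofReal (√((a : ℝ) + 1))⁻¹ :=
    fun a _ => (ENNReal.ofReal_inv_of_pos (by positivity)).symm
  rw [Finset.sum_congr rfl h1, ← ENNReal.ofReal_sum_of_nonneg fun _ _ => by positivity, sqrtWt,
    show (2 : ℝ≥0∞) = ENNReal.ofReal 2 by simp, ← ENNReal.ofReal_mul zero_le_two]
  refine ENNReal.ofReal_le_ofReal ((key (m + 1)).trans_eq ?_)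
  push_cast
  rfl

end sqrtWt

/-- The index `j` of the block `4 ^ j (a + 1) ≤ m + 1 < 4 ^ (j + 1) (a + 1)`. -/
def logBlock (a m : ℕ) : ℕ := Nat.log 4 ((m + 1) / (a + 1))

theorem logBlock_le {a m : ℕ} (h : a ≤ m) : 4 ^ logBlock a m * (a + 1) ≤ m + 1 := by
  rw [← Nat.le_div_iff_mul_le (Nat.succ_pos a)]
  exact Nat.pow_log_le_self 4 (Nat.div_pos (by omega) (by omega)).ne'

theorem lt_logBlock (a m : ℕ) : m + 1 < 4 ^ (logBlock a m + 1) * (a + 1) := by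
  rw [← Nat.div_lt_iff_lt_mul (Nat.succ_pos a)]
  exact Nat.lt_pow_succ_log_self (by norm_num) _

theorem sqrtWt_le_logBlock (a m : ℕ) : sqrtWt m ≤ 2 * 2 ^ logBlock a m * sqrtWt a := by
  have := sqrtWt.le_mul (a := a) (m := m) (k := 2 ^ (logBlock a m + 1))
    ((lt_logBlock a m).le.trans_eq (by rw [← pow_mul, mul_comm _ 2, pow_mul]; norm_num))
  refine this.trans_eq ?_
  push_cast
  ring

namespace DyadicInterval

/-- The dyadic intervals of length at most two that strictly contain `K`. -/
noncomputable def ancs (K : DyadicInterval) : Finset DyadicInterval :=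
  (Finset.range (K.gen + 1).toNat).image fun a : ℕ => cell (a - 1) K.base

theorem mem_ancs {I K : DyadicInterval} :
    I ∈ ancs K ↔ -1 ≤ I.gen ∧ I.gen < K.gen ∧ K.toSet ⊆ I.toSet := by
  simp only [ancs, Finset.mem_image, Finset.mem_range]
  constructor
  · rintro ⟨a, ha, rfl⟩
    simp only [cell_gen]
    refine ⟨by omega, by omega, subset_of_mem (mem_cell _ _) K.base_mem ?_⟩
    simp only [cell_gen]; omega
  · rintro ⟨h1, h2, h3⟩
    refine ⟨(I.gen + 1).toNat, by omega, ?_⟩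
    rw [show (((I.gen + 1).toNat : ℕ) : ℤ) - 1 = I.gen by omega]
    exact mem_toSet_iff.1 (h3 K.base_mem)

theorem sum_ancs (K : DyadicInterval) (f : DyadicInterval → ℝ≥0∞) :
    ∑ I ∈ ancs K, f I = ∑ a ∈ Finset.range (K.gen + 1).toNat, f (cell (a - 1) K.base) := by
  rw [ancs, Finset.sum_image]
  intro a _ b _ h
  have := congrArg gen h
  simp only [cell_gen] at this
  omega

/-- Cauchy–Schwarz with weight `√(a+1)`, where `a = I.gen + 1`. The reciprocal weights sum to at
most `2√(K.gen + 1)`, a square root of the number of generations instead of the full power. -/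
theorem sq_sum_ancs_le (K : DyadicInterval) (y : DyadicInterval → ℝ≥0∞) :
    (∑ I ∈ ancs K, y I) ^ 2 ≤
      2 * sqrtWt K.gen.toNat * ∑ I ∈ ancs K, sqrtWt (I.gen + 1).toNat * y I ^ 2 := by
  by_cases hK : 0 ≤ K.gen
  swap
  · have : ancs K = ∅ := by
      rw [ancs, show (K.gen + 1).toNat = 0 by omega]; simp
    simp [this]
  let w : DyadicInterval → ℝ≥0∞ := fun I => sqrtWt (I.gen + 1).toNat ^ (1 / 2 : ℝ)
  have hw : ∀ I, w I ^ 2 = sqrtWt (I.gen + 1).toNat := fun I => by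
    rw [← ENNReal.rpow_natCast, ← ENNReal.rpow_mul]; norm_num
  have hw0 : ∀ I, w I ≠ 0 := fun I h => sqrtWt.ne_zero (I.gen + 1).toNat (by rw [← hw, h]; norm_num)
  have hwt : ∀ I, w I ≠ ⊤ := fun I h => sqrtWt.ne_top (I.gen + 1).toNat (by rw [← hw, h]; norm_num)
  have h1 : ∑ I ∈ ancs K, y I = ∑ I ∈ ancs K, (w I)⁻¹ * (w I * y I) :=
    Finset.sum_congr rfl fun I _ => by
      rw [← mul_assoc, ENNReal.inv_mul_cancel (hw0 I) (hwt I), one_mul]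
  rw [h1]
  refine (ENNReal.sq_sum_mul_le _ _ _).trans ?_
  simp only [mul_pow, hw]
  refine mul_le_mul_left ?_ _
  simp only [← ENNReal.inv_pow, hw]
  rw [sum_ancs]
  simp only [cell_gen]
  rw [show (K.gen + 1).toNat = K.gen.toNat + 1 by omega]
  refine le_trans (le_of_eq ?_) (sqrtWt.sum_inv_le K.gen.toNat)
  exact Finset.sum_congr rfl fun a _ => by rw [show ((a : ℤ) - 1 + 1).toNat = a by omega]

end DyadicInterval

namespace DyadicRect

open DyadicInterval (ancs)

/-- The logarithmic Carleson condition, with constant `A`. -/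
def IsLogCarleson (c : DyadicRect → ℝ≥0∞) (A : ℝ≥0∞) : Prop :=
  ∀ (k l : ℕ) (T : Finset DyadicRect), (∀ R ∈ T, (k : ℤ) ≤ R.1.gen ∧ (l : ℤ) ≤ R.2.gen) →
    (((k : ℝ≥0∞) + 1) * (l + 1)) ^ 2 * ∑ R ∈ T, c R ≤ A * volume (⋃ R ∈ T, R.toSet)

theorem measurableSet_biUnion (T : Finset DyadicRect) : MeasurableSet (⋃ R ∈ T, R.toSet) :=
  Finset.measurableSet_biUnion _ fun R _ => R.measurableSet_toSet

/-- The weight `u R` is the least number with the first property. It is a constant attached to `R`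
that is at most `logMax₂ U` everywhere on `R`, so Carleson embedding gives the second property. -/
theorem exists_weight₂ {U : Set (ℝ × ℝ)} (hU : MeasurableSet U) : ∃ u : DyadicRect → ℝ≥0∞,
    (∀ R : DyadicRect, ∀ m n : ℕ, ∫⁻ z in R.toSet, contained U (cell (m, n) z) ≤
      volume R.toSet * ((m + 1) * (n + 1) * u R)) ∧
    ∀ (c : DyadicRect → ℝ≥0∞) (B : ℝ≥0∞) (T : Finset DyadicRect), IsCarleson c B →
      (∀ R ∈ T, -1 ≤ R.1.gen ∧ -1 ≤ R.2.gen) → ∑ R ∈ T, c R * u R ≤ B * (4 * volume U) := by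
  let X : DyadicRect → ℕ → ℕ → ℝ≥0∞ := fun R m n =>
    (volume R.toSet * ((m + 1) * (n + 1)))
  have hX0 : ∀ R m n, X R m n ≠ 0 := fun R m n =>
    mul_ne_zero R.volume_ne_zero (mul_ne_zero (by simp) (by simp))
  have hXt : ∀ R m n, X R m n ≠ ⊤ := fun R m n =>
    ENNReal.mul_ne_top R.volume_ne_top (by finiteness)
  refine ⟨fun R => ⨆ m : ℕ, ⨆ n : ℕ, (∫⁻ z in R.toSet, contained U (cell (m, n) z)) / X R m n,
    fun R m n => ?_, fun c B T hc hT => ?_⟩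
  · rw [← mul_assoc, ← ENNReal.div_le_iff' (hX0 R m n) (hXt R m n)]
    exact le_iSup_of_le m (le_iSup_of_le n le_rfl)
  · refine (IsCarleson.embedding (fun T' _ => hc T') _ (logMax₂ U) ?_).trans
      (mul_le_mul_right (lintegral_logMax₂_le hU) B)
    intro R hR z hz
    refine iSup_le fun m => iSup_le fun n => ?_
    rw [ENNReal.div_le_iff' (hX0 R m n) (hXt R m n)]
    refine (setLIntegral_contained_le₂ U (hT R hR).1 (hT R hR).2 hz m n).trans_eq ?_
    rw [← mul_assoc]

/-- The analogue of `exists_weight₂` with averaging in the first variable only. The majorant takes a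
supremum over cells of generation `n : ℕ` in the second variable, hence the condition `0 ≤ R.2.gen`.
-/
theorem exists_weight₁ {U : Set (ℝ × ℝ)} (hU : MeasurableSet U) : ∃ u : DyadicRect → ℝ≥0∞,
    (∀ R : DyadicRect, ∀ n : ℕ,
      ∫⁻ s in R.1.toSet, contained U (DyadicInterval.cell n s, R.2) ≤
        volume R.1.toSet * ((n + 1) * u R)) ∧
    ∀ (c : DyadicRect → ℝ≥0∞) (B : ℝ≥0∞) (T : Finset DyadicRect), IsCarleson c B →
      (∀ R ∈ T, -1 ≤ R.1.gen ∧ 0 ≤ R.2.gen) → ∑ R ∈ T, c R * u R ≤ B * (2 * volume U) := by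
  let X : DyadicRect → ℕ → ℝ≥0∞ := fun R n => (volume R.1.toSet * (n + 1))
  have hX0 : ∀ R n, X R n ≠ 0 := fun R n => mul_ne_zero R.1.volume_ne_zero (by simp)
  have hXt : ∀ R n, X R n ≠ ⊤ := fun R n => ENNReal.mul_ne_top R.1.volume_ne_top (by finiteness)
  refine ⟨fun R => ⨆ n : ℕ, (∫⁻ s in R.1.toSet, contained U (DyadicInterval.cell n s, R.2)) / X R n,
    fun R n => ?_, fun c B T hc hT => ?_⟩
  · rw [← mul_assoc, ← ENNReal.div_le_iff' (hX0 R n) (hXt R n)]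
    exact le_iSup_of_le n le_rfl
  · refine (IsCarleson.embedding (fun T' _ => hc T') _
      (fun z => ⨆ n : ℕ, logMax₁ U (DyadicInterval.cell n z.2) z.1) ?_).trans
      (mul_le_mul_right (lintegral_iSup_logMax₁_le hU) B)
    intro R hR z hz
    refine iSup_le fun n => ?_
    rw [ENNReal.div_le_iff' (hX0 R n) (hXt R n)]
    refine (setLIntegral_contained_le₁ U (hT R hR).1 hz.1 n).trans ?_
    rw [← mul_assoc]
    refine mul_le_mul_right (le_iSup_of_le R.2.gen.toNat (le_of_eq ?_)) _
    rw [show ((R.2.gen.toNat : ℕ) : ℤ) = R.2.gen by have := (hT R hR).2; omega,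
      DyadicInterval.mem_toSet_iff.1 hz.2]

/-- If `z` lies in a rectangle of the family, its cell of generation `(m, n)` is contained in that
rectangle and hence in `U`. -/
theorem volume_block_le {U : Set (ℝ × ℝ)} {R' : DyadicRect} {T : Finset DyadicRect} {m n : ℕ}
    (hT : ∀ R ∈ T, R.toSet ⊆ U ∧ R.toSet ⊆ R'.toSet ∧ R.1.gen ≤ m ∧ R.2.gen ≤ n) :
    volume (⋃ R ∈ T, R.toSet) ≤ ∫⁻ z in R'.toSet, contained U (cell (m, n) z) := by
  rw [← lintegral_indicator_one (measurableSet_biUnion T), ← lintegral_indicator R'.measurableSet_toSet]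
  refine lintegral_mono fun z => ?_
  by_cases h : z ∈ ⋃ R ∈ T, R.toSet
  · rw [indicator_of_mem h]
    simp only [mem_iUnion, exists_prop] at h
    obtain ⟨R, hR, hz⟩ := h
    obtain ⟨h1, h2, h3, h4⟩ := hT R hR
    rw [indicator_of_mem (h2 hz), contained, if_pos]
    · rfl
    · refine subset_trans (prod_mono ?_ ?_) h1
      · exact DyadicInterval.subset_of_mem hz.1 (DyadicInterval.mem_cell _ _) h3
      · exact DyadicInterval.subset_of_mem hz.2 (DyadicInterval.mem_cell _ _) h4
  · rw [indicator_of_notMem h]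
    exact bot_le

end DyadicRect

theorem ENNReal.tsum_inv_two_pow : ∑' n : ℕ, (2⁻¹ : ℝ≥0∞) ^ n = 2 := by
  rw [ENNReal.tsum_geometric, ENNReal.one_sub_inv_two, inv_inv]

/-- The factor 4 is the square of the geometric series `∑ 2⁻ⁱ = 2`. -/
theorem ENNReal.sum_le_of_blocks {ι : Type*} (S : Finset ι) (b : ι → ℕ × ℕ) (F : ι → ℝ≥0∞)
    (D : ℝ≥0∞)
    (h : ∀ p, ∑ R ∈ S with b R = p, F R ≤ 2⁻¹ ^ p.1 * 2⁻¹ ^ p.2 * D) :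
    ∑ R ∈ S, F R ≤ 4 * D := by
  classical
  rw [← Finset.sum_fiberwise_of_maps_to (fun R hR => Finset.mem_image_of_mem b hR)]
  calc _ ≤ ∑ p ∈ S.image b, 2⁻¹ ^ p.1 * 2⁻¹ ^ p.2 * D := Finset.sum_le_sum fun p _ => h p
    _ ≤ ∑' p : ℕ × ℕ, 2⁻¹ ^ p.1 * 2⁻¹ ^ p.2 * D := ENNReal.sum_le_tsum _
    _ = 4 * D := by
      rw [ENNReal.tsum_prod (f := fun i j : ℕ => (2⁻¹ : ℝ≥0∞) ^ i * 2⁻¹ ^ j * D)]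
      simp only [ENNReal.tsum_mul_right, ENNReal.tsum_mul_left, ENNReal.tsum_inv_two_pow]
      norm_num

namespace DyadicRect

open DyadicInterval (ancs)

/-- The product weight `√((m + 1) (n + 1))` of a rectangle of generations `m`, `n`. -/
noncomputable def genWt (R : DyadicRect) : ℝ≥0∞ := sqrtWt R.1.gen.toNat * sqrtWt R.2.gen.toNat

/-- With `P = 4^i (a+1)` and `Q = 4^j (b+1)`, the block `(i, j)` has generations with `m + 1` in
`[P, 4P)` and `n + 1` in `[Q, 4Q)`. The logarithmic Carleson condition gains `(PQ)⁻²`, the area of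
the union costs `16 PQ`, and the weights are at most `4 · 2⁻ⁱ 2⁻ʲ PQ`. The block contributes `64 ·
2⁻ⁱ 2⁻ʲ`, and the double series adds a factor 4. -/
theorem sum_logBlock_le {c : DyadicRect → ℝ≥0∞} {A : ℝ≥0∞} (hc : IsLogCarleson c A)
    {U : Set (ℝ × ℝ)} {R' : DyadicRect} {u : ℝ≥0∞} (hu : ∀ m n : ℕ,
      ∫⁻ z in R'.toSet, contained U (cell (m, n) z) ≤ volume R'.toSet * ((m + 1) * (n + 1) * u))
    {a b : ℕ} (ha : R'.1.gen = a - 1) (hb : R'.2.gen = b - 1) {S : Finset DyadicRect}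
    (hS : ∀ R ∈ S, R.toSet ⊆ U ∧ R.toSet ⊆ R'.toSet ∧ R'.1.gen < R.1.gen ∧ R'.2.gen < R.2.gen) :
    sqrtWt a * sqrtWt b * ∑ R ∈ S, c R * genWt R ≤ 256 * (A * volume R'.toSet * u) := by
  rw [Finset.mul_sum]
  refine (ENNReal.sum_le_of_blocks S
    (fun R => (logBlock a R.1.gen.toNat, logBlock b R.2.gen.toNat)) _
    (64 * (A * volume R'.toSet * u)) ?_).trans_eq (by ring)
  rintro ⟨i, j⟩
  set S' := S.filter fun R : DyadicRect =>
    (logBlock a R.1.gen.toNat, logBlock b R.2.gen.toNat) = (i, j) with hS'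
  have hmem : ∀ R ∈ S', R.toSet ⊆ U ∧ R.toSet ⊆ R'.toSet ∧ (a : ℤ) ≤ R.1.gen ∧ (b : ℤ) ≤ R.2.gen ∧
      logBlock a R.1.gen.toNat = i ∧ logBlock b R.2.gen.toNat = j := by
    intro R hR
    obtain ⟨h1, h2⟩ := Finset.mem_filter.1 hR
    obtain ⟨h3, h4, h5, h6⟩ := hS R h1
    rw [Prod.mk.injEq] at h2
    exact ⟨h3, h4, by omega, by omega, h2.1, h2.2⟩
  set P : ℕ := 4 ^ i * (a + 1) with hP
  set Q : ℕ := 4 ^ j * (b + 1) with hQ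
  have hP0 : 0 < P := by positivity
  have hQ0 : 0 < Q := by positivity
  have h1 : ((P : ℝ≥0∞) * Q) ^ 2 * ∑ R ∈ S', c R ≤
      A * (volume R'.toSet * ((4 * P) * (4 * Q) * u)) := by
    -- The condition is stated with `k + 1` and `l + 1`, so `k = P - 1` and `l = Q - 1` produce
    -- exactly `P` and `Q`.
    have h2 := hc (P - 1) (Q - 1) S' fun R hR => by
      obtain ⟨-, -, h1, h2, h3, h4⟩ := hmem R hR
      have h5 := logBlock_le (a := a) (m := R.1.gen.toNat) (by omega)
      have h6 := logBlock_le (a := b) (m := R.2.gen.toNat) (by omega)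
      rw [h3] at h5
      rw [h4] at h6
      omega
    have e : ∀ n : ℕ, 0 < n → ((n - 1 : ℕ) : ℝ≥0∞) + 1 = n := fun n hn => by
      exact_mod_cast congrArg (Nat.cast (R := ℝ≥0∞)) (Nat.sub_add_cancel hn)
    rw [e P hP0, e Q hQ0] at h2
    refine h2.trans (mul_le_mul_right ?_ A)
    refine (volume_block_le (U := U) (m := 4 * P - 1) (n := 4 * Q - 1) fun R hR => ?_).trans
      ((hu (4 * P - 1) (4 * Q - 1)).trans_eq ?_)
    · obtain ⟨h0, h0', h1, h2, h3, h4⟩ := hmem R hR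
      have h5 := lt_logBlock a R.1.gen.toNat
      have h6 := lt_logBlock b R.2.gen.toNat
      rw [h3, pow_succ] at h5
      rw [h4, pow_succ] at h6
      refine ⟨h0, h0', ?_, ?_⟩
      · have : R.1.gen.toNat + 1 < 4 * P := by rw [hP]; linarith
        omega
      · have : R.2.gen.toNat + 1 < 4 * Q := by rw [hQ]; linarith
        omega
    · rw [e _ (by omega), e _ (by omega)]
      push_cast
      rfl
  have hPQ0 : (P : ℝ≥0∞) * Q ≠ 0 := by
    exact_mod_cast (Nat.mul_pos hP0 hQ0).ne'
  have hPQt : (P : ℝ≥0∞) * Q ≠ ⊤ := by finiteness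
  have h2 : (P : ℝ≥0∞) * Q * ∑ R ∈ S', c R ≤ 16 * (A * volume R'.toSet * u) := by
    rw [← ENNReal.mul_le_mul_iff_right hPQ0 hPQt]
    calc (P : ℝ≥0∞) * Q * (P * Q * ∑ R ∈ S', c R) = (P * Q) ^ 2 * ∑ R ∈ S', c R := by ring
      _ ≤ _ := h1
      _ = _ := by ring
  have h3 : ∀ R ∈ S', sqrtWt a * sqrtWt b * (c R * genWt R) ≤
      4 * (2⁻¹ ^ i * 2⁻¹ ^ j) * ((P : ℝ≥0∞) * Q * c R) := by
    intro R hR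
    obtain ⟨h0, h0', h1, h2, h3, h4⟩ := hmem R hR
    have h5 := sqrtWt_le_logBlock a R.1.gen.toNat
    have h6 := sqrtWt_le_logBlock b R.2.gen.toNat
    rw [h3] at h5
    rw [h4] at h6
    have h7 : ∀ i : ℕ, (2⁻¹ : ℝ≥0∞) ^ i * 4 ^ i = 2 ^ i := fun i => by
      rw [← mul_pow, show (4 : ℝ≥0∞) = 2 * 2 by norm_num, ← mul_assoc,
        ENNReal.inv_mul_cancel two_ne_zero ENNReal.ofNat_ne_top, one_mul]
    calc sqrtWt a * sqrtWt b * (c R * genWt R)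
        ≤ sqrtWt a * sqrtWt b * (c R * ((2 * 2 ^ i * sqrtWt a) * (2 * 2 ^ j * sqrtWt b))) := by
          unfold genWt
          gcongr
      _ = 4 * (2 ^ i * 2 ^ j) * (sqrtWt a ^ 2 * sqrtWt b ^ 2 * c R) := by ring
      _ = _ := by
          rw [sqrtWt.sq, sqrtWt.sq, ← h7 i, ← h7 j, hP, hQ]
          push_cast
          ring
  calc _ ≤ ∑ R ∈ S', 4 * (2⁻¹ ^ i * 2⁻¹ ^ j) * ((P : ℝ≥0∞) * Q * c R) := Finset.sum_le_sum h3
    _ = 4 * (2⁻¹ ^ i * 2⁻¹ ^ j) * ((P : ℝ≥0∞) * Q * ∑ R ∈ S', c R) := by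
        rw [← Finset.mul_sum, ← Finset.mul_sum]
    _ ≤ 4 * (2⁻¹ ^ i * 2⁻¹ ^ j) * (16 * (A * volume R'.toSet * u)) := by gcongr
    _ = _ := by ring

/-- The sum over the pairs of strict ancestors of length at most two. -/
noncomputable def ancSum₂ (y : DyadicRect → ℝ≥0∞) (R : DyadicRect) : ℝ≥0∞ :=
  ∑ I ∈ ancs R.1, ∑ J ∈ ancs R.2, y (I, J)

/-- The weight `√((m + 2) (n + 2))` of a rectangle of generations `m, n ≥ -1`. -/
noncomputable def ancWt (R : DyadicRect) : ℝ≥0∞ :=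
  sqrtWt (R.1.gen + 1).toNat * sqrtWt (R.2.gen + 1).toNat

theorem sq_ancSum₂_le (y : DyadicRect → ℝ≥0∞) (R : DyadicRect) :
    ancSum₂ y R ^ 2 ≤ 4 * genWt R * ∑ R' ∈ ancs R.1 ×ˢ ancs R.2, ancWt R' * y R' ^ 2 := by
  rw [Finset.sum_product]
  calc ancSum₂ y R ^ 2 ≤ 2 * sqrtWt R.1.gen.toNat * ∑ I ∈ ancs R.1,
        sqrtWt (I.gen + 1).toNat * (∑ J ∈ ancs R.2, y (I, J)) ^ 2 :=
      DyadicInterval.sq_sum_ancs_le _ _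
    _ ≤ 2 * sqrtWt R.1.gen.toNat * ∑ I ∈ ancs R.1, sqrtWt (I.gen + 1).toNat *
        (2 * sqrtWt R.2.gen.toNat * ∑ J ∈ ancs R.2, sqrtWt (J.gen + 1).toNat * y (I, J) ^ 2) := by
      gcongr
      exact DyadicInterval.sq_sum_ancs_le _ _
    _ = _ := by
      simp only [ancWt, genWt, Finset.mul_sum]
      refine Finset.sum_congr rfl fun I _ => Finset.sum_congr rfl fun J _ => ?_
      ring

/-- After the weighted Cauchy–Schwarz inequality the order of summation is reversed. For each
ancestor `R'` the descendants in `U` are summed by `sum_logBlock_le`, and the resulting sum of `y²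
|R'| u(R')` is a Carleson embedding against the logarithmic maximal function of `U`. The constant is
`4 · 256 · 4`. -/
theorem sum_mul_sq_ancSum₂_le {c : DyadicRect → ℝ≥0∞} {A B : ℝ≥0∞} (hc : IsLogCarleson c A)
    {y : DyadicRect → ℝ≥0∞} (hy : IsCarleson (fun R => y R ^ 2 * volume R.toSet) B)
    (T : Finset DyadicRect) :
    ∑ R ∈ T, c R * ancSum₂ y R ^ 2 ≤ 4096 * A * B * volume (⋃ R ∈ T, R.toSet) := by
  set U := ⋃ R ∈ T, R.toSet with hU
  obtain ⟨u, hu1, hu2⟩ := exists_weight₂ (measurableSet_biUnion T)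
  rw [← hU] at hu1 hu2
  set Ts : Finset DyadicRect := T.biUnion fun R => ancs R.1 ×ˢ ancs R.2 with hTs
  have hTs1 : ∀ R' ∈ Ts, -1 ≤ R'.1.gen ∧ -1 ≤ R'.2.gen := by
    intro R' h
    obtain ⟨R, -, h⟩ := Finset.mem_biUnion.1 h
    obtain ⟨h1, h2⟩ := Finset.mem_product.1 h
    exact ⟨(DyadicInterval.mem_ancs.1 h1).1, (DyadicInterval.mem_ancs.1 h2).1⟩
  calc ∑ R ∈ T, c R * ancSum₂ y R ^ 2
      ≤ ∑ R ∈ T, c R * (4 * genWt R * ∑ R' ∈ ancs R.1 ×ˢ ancs R.2, ancWt R' * y R' ^ 2) := by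
        gcongr; exact sq_ancSum₂_le _ _
    _ = ∑ R ∈ T, ∑ R' ∈ ancs R.1 ×ˢ ancs R.2, 4 * y R' ^ 2 * (ancWt R' * (c R * genWt R)) := by
        simp only [Finset.mul_sum]
        refine Finset.sum_congr rfl fun R _ => Finset.sum_congr rfl fun R' _ => ?_
        ring
    _ = ∑ R' ∈ Ts, ∑ R ∈ T with R' ∈ ancs R.1 ×ˢ ancs R.2,
          4 * y R' ^ 2 * (ancWt R' * (c R * genWt R)) := by
        refine Finset.sum_comm' fun R R' => ?_
        simp only [hTs, Finset.mem_biUnion, Finset.mem_filter]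
        constructor
        · rintro ⟨h1, h2⟩; exact ⟨⟨h1, h2⟩, R, h1, h2⟩
        · rintro ⟨h1, -⟩; exact h1
    _ ≤ ∑ R' ∈ Ts, 4 * y R' ^ 2 * (256 * (A * volume R'.toSet * u R')) := by
        refine Finset.sum_le_sum fun R' hR' => ?_
        rw [← Finset.mul_sum, ← Finset.mul_sum]
        refine mul_le_mul_right ?_ _
        obtain ⟨h1, h2⟩ := hTs1 R' hR'
        refine sum_logBlock_le hc (hu1 R') (a := (R'.1.gen + 1).toNat) (b := (R'.2.gen + 1).toNat)
          (by omega) (by omega) fun R hR => ?_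
        obtain ⟨hR1, hR2⟩ := Finset.mem_filter.1 hR
        obtain ⟨h3, h4⟩ := Finset.mem_product.1 hR2
        obtain ⟨-, h5, h6⟩ := DyadicInterval.mem_ancs.1 h3
        obtain ⟨-, h7, h8⟩ := DyadicInterval.mem_ancs.1 h4
        exact ⟨subset_biUnion_of_mem (u := fun R : DyadicRect => R.toSet) hR1, prod_mono h6 h8, h5, h7⟩
    _ = 1024 * A * ∑ R' ∈ Ts, y R' ^ 2 * volume R'.toSet * u R' := by
        rw [Finset.mul_sum]
        exact Finset.sum_congr rfl fun R' _ => by ring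
    _ ≤ 1024 * A * (B * (4 * volume U)) := by
        gcongr
        exact hu2 _ B Ts hy hTs1
    _ = _ := by ring

end DyadicRect

/-! ### Averages without ancestors, and sums over ancestors in one variable. -/

namespace ENNReal

theorem sq_sum_le_of_sq_le {ι : Type*} (s : Finset ι) {D a b : ι → ℝ≥0∞}
    (h : ∀ i ∈ s, D i ^ 2 ≤ a i * b i) : (∑ i ∈ s, D i) ^ 2 ≤ (∑ i ∈ s, a i) * ∑ i ∈ s, b i := by
  have h1 : ∀ i ∈ s, D i ≤ a i ^ (1 / (2 : ℝ)) * b i ^ (1 / (2 : ℝ)) := fun i hi =>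
    le_of_sq_le_sq ((h i hi).trans_eq (rpow_half_mul_rpow_half_sq _ _).symm)
  refine (pow_le_pow_left' (Finset.sum_le_sum h1) 2).trans ((sq_sum_mul_le _ _ _).trans_eq ?_)
  simp only [← ENNReal.rpow_natCast, ← ENNReal.rpow_mul]
  norm_num

theorem sum_inv_two_pow_le (J : Finset ℕ) (j₀ : ℕ) :
    ∑ j ∈ J with j₀ ≤ j, (2⁻¹ : ℝ≥0∞) ^ j ≤ 2 * 2⁻¹ ^ j₀ := by
  have h1 : ∀ j ∈ J.filter (j₀ ≤ ·), (2⁻¹ : ℝ≥0∞) ^ j = 2⁻¹ ^ (j - j₀) * 2⁻¹ ^ j₀ := fun j hj => by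
    rw [← pow_add, Nat.sub_add_cancel (Finset.mem_filter.1 hj).2]
  rw [Finset.sum_congr rfl h1, ← Finset.sum_mul]
  refine mul_le_mul_left ?_ _
  rw [← Finset.sum_image (f := fun n => (2⁻¹ : ℝ≥0∞) ^ n) (g := fun j => j - j₀)]
  · exact (ENNReal.sum_le_tsum _).trans_eq ENNReal.tsum_inv_two_pow
  · intro a ha b hb h
    have h2 := (Finset.mem_filter.1 ha).2
    have h3 := (Finset.mem_filter.1 hb).2
    simp only at h
    omega

end ENNReal

namespace DyadicRect

open DyadicInterval (ancs)

theorem IsLogCarleson.isCarleson {c : DyadicRect → ℝ≥0∞} {A : ℝ≥0∞} (hc : IsLogCarleson c A)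
    {T : Finset DyadicRect} (hT : ∀ R ∈ T, 0 ≤ R.1.gen ∧ 0 ≤ R.2.gen) :
    ∑ R ∈ T, c R ≤ A * volume (⋃ R ∈ T, R.toSet) := by
  simpa using hc 0 0 T (by simpa using hT)

/-- Cauchy–Schwarz decouples `φ` from `f`; the means of `G` are then absorbed by Carleson embedding
for `f` and the strong maximal theorem. No logarithmic gain is needed. -/
theorem sq_sum_mul_avg_le {φ f : DyadicRect → ℝ≥0∞} {A B : ℝ≥0∞}
    (hφ : IsLogCarleson (fun R => φ R ^ 2) A) (hf : IsCarleson (fun R => f R ^ 2) B)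
    {T : Finset DyadicRect} (hT : ∀ R ∈ T, 0 ≤ R.1.gen ∧ 0 ≤ R.2.gen) {G : ℝ × ℝ → ℝ≥0∞}
    (hG : Measurable G) :
    (∑ R ∈ T, φ R * (f R * R.avg G)) ^ 2 ≤
      64 * A * B * volume (⋃ R ∈ T, R.toSet) * ∫⁻ z, G z ^ 2 := by
  refine (ENNReal.sq_sum_mul_le _ _ _).trans ?_
  have h1 : ∑ R ∈ T, (f R * R.avg G) ^ 2 ≤ B * (64 * ∫⁻ z, G z ^ 2) := by
    simp only [mul_pow]
    refine (IsCarleson.embedding (fun T' _ => hf T') (fun R => R.avg G ^ 2)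
      (fun z => maxFun G z ^ 2) fun R _ z hz => pow_le_pow_left' (avg_le_maxFun hz _) 2).trans ?_
    exact mul_le_mul_right (lintegral_maxFun_sq_le hG) B
  exact (mul_le_mul' (hφ.isCarleson hT) h1).trans_eq (by ring)

/-- The sum over the strict ancestors of length at most two in the first variable. -/
noncomputable def ancSum₁ (y : DyadicRect → ℝ≥0∞) (R : DyadicRect) : ℝ≥0∞ :=
  ∑ I ∈ ancs R.1, y (I, R.2)

/-- The rectangles obtained from `T` by passing to strict ancestors in the first variable. -/
noncomputable def ancs₁ (T : Finset DyadicRect) : Finset DyadicRect :=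
  T.biUnion fun R => ancs R.1 ×ˢ {R.2}

theorem mem_ancs₁ {T : Finset DyadicRect} {R' : DyadicRect} :
    R' ∈ ancs₁ T ↔ ∃ R ∈ T, R'.1 ∈ ancs R.1 ∧ R'.2 = R.2 := by
  simp only [ancs₁, Finset.mem_biUnion, Finset.mem_product, Finset.mem_singleton]

/-- The majorant of the partial sums in the second variable of the square function of the
ancestor sums. -/
noncomputable def ancMajorant (U : Set (ℝ × ℝ)) (y : DyadicRect → ℝ≥0∞) (S : Finset DyadicRect)
    (n : ℕ) (z : ℝ × ℝ) : ℝ≥0∞ :=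
  ∑ R ∈ S, R.toSet.indicator (fun z => sqrtWt (R.1.gen + 1).toNat * (y R ^ 2 / volume R.2.toSet) *
    contained U (DyadicInterval.cell n z.1, R.2)) z

theorem measurable_ancMajorant (U : Set (ℝ × ℝ)) (y : DyadicRect → ℝ≥0∞) (S : Finset DyadicRect)
    (n : ℕ) : Measurable (ancMajorant U y S n) := by
  refine Finset.measurable_fun_sum _ fun R _ => Measurable.indicator ?_ R.measurableSet_toSet
  refine Measurable.const_mul ?_ _
  exact (DyadicInterval.measurable_cell_comp n fun I => contained U (I, R.2)).comp measurable_fst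

theorem lintegral_ancMajorant_le {U : Set (ℝ × ℝ)} {u : DyadicRect → ℝ≥0∞}
    (hu : ∀ R : DyadicRect, ∀ n : ℕ, ∫⁻ s in R.1.toSet, contained U (DyadicInterval.cell n s, R.2) ≤
        volume R.1.toSet * ((n + 1) * u R)) (y : DyadicRect → ℝ≥0∞) (S : Finset DyadicRect) (n : ℕ) :
    ∫⁻ z, ancMajorant U y S n z ≤
      (n + 1) * ∑ R ∈ S, sqrtWt (R.1.gen + 1).toNat * (y R ^ 2 * volume R.1.toSet * u R) := by
  have hm : ∀ R : DyadicRect, Measurable fun z : ℝ × ℝ =>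
      sqrtWt (R.1.gen + 1).toNat * (y R ^ 2 / volume R.2.toSet) *
        contained U (DyadicInterval.cell n z.1, R.2) := fun R =>
    ((DyadicInterval.measurable_cell_comp n fun I => contained U (I, R.2)).comp
      measurable_fst).const_mul _
  have hm' : ∀ R : DyadicRect, Measurable fun s : ℝ => contained U (DyadicInterval.cell n s, R.2) :=
    fun R => DyadicInterval.measurable_cell_comp n fun I => contained U (I, R.2)
  unfold ancMajorant
  rw [lintegral_finsetSum _ fun R _ => (hm R).indicator R.measurableSet_toSet, Finset.mul_sum]
  refine Finset.sum_le_sum fun R _ => ?_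
  rw [lintegral_indicator R.measurableSet_toSet, toSet, Measure.volume_eq_prod,
    ← Measure.prod_restrict, lintegral_prod _ (hm R).aemeasurable]
  simp only [lintegral_const, Measure.restrict_apply_univ]
  rw [lintegral_mul_const _ ((hm' R).const_mul _), lintegral_const_mul _ (hm' R)]
  calc _ = sqrtWt (R.1.gen + 1).toNat * y R ^ 2 * (volume R.2.toSet / volume R.2.toSet) *
        ∫⁻ s in R.1.toSet, contained U (DyadicInterval.cell n s, R.2) := by
        simp only [div_eq_mul_inv]; ring
    _ = sqrtWt (R.1.gen + 1).toNat * y R ^ 2 *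
        ∫⁻ s in R.1.toSet, contained U (DyadicInterval.cell n s, R.2) := by
        rw [ENNReal.div_self R.2.volume_ne_zero R.2.volume_ne_top, mul_one]
    _ ≤ sqrtWt (R.1.gen + 1).toNat * y R ^ 2 * (volume R.1.toSet * ((n + 1) * u R)) := by
        gcongr; exact hu R n
    _ = _ := by ring

/-- The containment factor comes for free: for `z` in `R ⊆ U` with `R.1.gen ≤ n`, the cell of
generation `n` around `z.1`, times `R.2`, lies in `R`. For fixed first side `K` the rectangles
differ in the second side, so the pairs `(I, R.2)` are all different and no ancestor is counted
twice. -/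
theorem sum_sq_ancSum₁_le {U : Set (ℝ × ℝ)} (y : DyadicRect → ℝ≥0∞) {T : Finset DyadicRect}
    {n : ℕ} (hT : ∀ R ∈ T, R.toSet ⊆ U ∧ R.1.gen ≤ n) (K : DyadicInterval) (z : ℝ × ℝ) :
    ∑ R ∈ T with R.1 = K, R.toSet.indicator (fun _ => ancSum₁ y R ^ 2 / volume R.2.toSet) z ≤
      2 * sqrtWt K.gen.toNat * ancMajorant U y (ancs₁ T) n z := by
  set F : DyadicRect → ℝ≥0∞ := fun R => R.toSet.indicator (fun z =>
    sqrtWt (R.1.gen + 1).toNat * (y R ^ 2 / volume R.2.toSet) *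
      contained U (DyadicInterval.cell n z.1, R.2)) z with hF
  have h1 : ∀ R ∈ T.filter (fun R => R.1 = K),
      R.toSet.indicator (fun _ => ancSum₁ y R ^ 2 / volume R.2.toSet) z ≤
        2 * sqrtWt K.gen.toNat * ∑ I ∈ ancs K, F (I, R.2) := by
    intro R hR'
    obtain ⟨hR, rfl⟩ := Finset.mem_filter.1 hR'
    by_cases hz : z ∈ R.toSet
    swap
    · rw [indicator_of_notMem hz]; exact bot_le
    rw [indicator_of_mem hz, div_eq_mul_inv]
    refine (mul_le_mul_left (DyadicInterval.sq_sum_ancs_le _ _) _).trans ?_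
    rw [mul_assoc, Finset.sum_mul]
    refine mul_le_mul_right (Finset.sum_le_sum fun I hI => ?_) _
    obtain ⟨-, -, hI⟩ := DyadicInterval.mem_ancs.1 hI
    have hz' : z ∈ (toSet (I, R.2)) := ⟨hI hz.1, hz.2⟩
    rw [hF]
    simp only
    rw [indicator_of_mem hz', contained, if_pos, div_eq_mul_inv, mul_one, mul_assoc]
    exact subset_trans (prod_mono (DyadicInterval.subset_of_mem hz.1 (DyadicInterval.mem_cell _ _)
      (hT R hR).2) subset_rfl) (hT R hR).1
  refine (Finset.sum_le_sum h1).trans ?_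
  rw [← Finset.mul_sum]
  refine mul_le_mul_right ?_ _
  rw [(Finset.sum_product' (T.filter fun R => R.1 = K) (ancs K) (fun R I => F (I, R.2))).symm,
    ← Finset.sum_image (f := F) (g := fun p : DyadicRect × DyadicInterval => (p.2, p.1.2))]
  · refine Finset.sum_le_sum_of_subset fun R' hR' => ?_
    obtain ⟨⟨R, I⟩, h, rfl⟩ := Finset.mem_image.1 hR'
    obtain ⟨h2, h3⟩ := Finset.mem_product.1 h
    obtain ⟨h4, rfl⟩ := Finset.mem_filter.1 h2
    exact mem_ancs₁.2 ⟨R, h4, h3, rfl⟩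
  · rintro ⟨R, I⟩ h ⟨R', I'⟩ h' e
    have h2 := (Finset.mem_filter.1 (Finset.mem_product.1 h).1).2
    have h3 := (Finset.mem_filter.1 (Finset.mem_product.1 h').1).2
    simp only [Prod.mk.injEq] at e h2 h3 ⊢
    exact ⟨Prod.ext (h2.trans h3.symm) e.2, e.1⟩

/-- In the block with `4^j ≤ R.1.gen + 1 < 4^(j+1)` the Carleson constant of `φ` improves to `A /
16^j`. The H¹–BMO inequality is applied there, with the square function split into a product. The
factor `2^j` from the weights and the factor `4^j` from the area bound combine with `16^(-j)` to
`2^(-j)`. -/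
theorem sq_sum_block_le {φ : DyadicRect → ℝ≥0∞} {A : ℝ≥0∞}
    (hφ : IsLogCarleson (fun R => φ R ^ 2) A) {y : DyadicRect → ℝ≥0∞} (hy : ∀ R, y R ≠ ⊤)
    {U : Set (ℝ × ℝ)} {u : DyadicRect → ℝ≥0∞}
    (hu : ∀ R : DyadicRect, ∀ n : ℕ, ∫⁻ s in R.1.toSet, contained U (DyadicInterval.cell n s, R.2) ≤
        volume R.1.toSet * ((n + 1) * u R))
    {j : ℕ} {T : Finset DyadicRect}
    (hT : ∀ R ∈ T, R.toSet ⊆ U ∧ 0 ≤ R.1.gen ∧ 0 ≤ R.2.gen ∧ logBlock 0 R.1.gen.toNat = j)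
    {G : DyadicInterval → ℝ → ℝ≥0∞} (hG : ∀ K, Measurable (G K))
    (hGt : ∀ K L : DyadicInterval, L.avg (G K) ≠ ⊤) :
    (∑ R ∈ T, φ R * (ancSum₁ y R * R.2.avg (G R.1))) ^ 2 ≤
      8192 * A * (∑ K ∈ T.image Prod.fst, ∫⁻ t, G K t ^ 2) *
        ∑ R' ∈ ancs₁ T, 2⁻¹ ^ j * (sqrtWt (R'.1.gen + 1).toNat *
          (y R' ^ 2 * volume R'.1.toSet * u R')) := by
  set x : DyadicRect → ℝ≥0∞ := fun R => ancSum₁ y R * R.2.avg (G R.1) with hx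
  have h4 : ((4 : ℝ≥0∞) ^ j) ^ 2 ≠ 0 := by positivity
  have h4t : ((4 : ℝ≥0∞) ^ j) ^ 2 ≠ ⊤ := by finiteness
  have hgen : ∀ R ∈ T, 4 ^ j ≤ R.1.gen.toNat + 1 ∧ R.1.gen ≤ (4 ^ (j + 1) - 1 : ℕ) ∧
      sqrtWt R.1.gen.toNat ≤ 2 * 2 ^ j := by
    intro R hR
    obtain ⟨-, h0, -, h⟩ := hT R hR
    have h5 := logBlock_le (a := 0) (m := R.1.gen.toNat) (by omega)
    have h6 := lt_logBlock 0 R.1.gen.toNat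
    have h7 := sqrtWt_le_logBlock 0 R.1.gen.toNat
    rw [h] at h5 h6 h7
    refine ⟨by omega, by omega, h7.trans_eq ?_⟩
    simp [sqrtWt]
  have hφ' : ∀ T' ⊆ T, ∑ R ∈ T', φ R ^ 2 ≤ A / (4 ^ j) ^ 2 * volume (⋃ R ∈ T', R.toSet) := by
    intro T' hT'
    have h := hφ (4 ^ j - 1) 0 T' fun R hR => by
      have h1 := (hgen R (hT' hR)).1
      have h2 := hT R (hT' hR)
      refine ⟨?_, by simpa using h2.2.2.1⟩
      have := h2.2.1
      omega
    have e : ((4 ^ j - 1 : ℕ) : ℝ≥0∞) + 1 = 4 ^ j := by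
      have : (4 ^ j - 1) + 1 = 4 ^ j := Nat.sub_add_cancel (Nat.one_le_pow _ _ (by norm_num))
      exact_mod_cast congrArg (Nat.cast (R := ℝ≥0∞)) this
    rw [e] at h
    simp only [Nat.cast_zero, zero_add, mul_one] at h
    rw [← ENNReal.mul_le_mul_iff_right h4 h4t]
    refine h.trans_eq ?_
    rw [← mul_assoc, ENNReal.mul_div_cancel h4 h4t]
  have hxt : ∀ R ∈ T, x R ≠ ⊤ := fun R _ =>
    ENNReal.mul_ne_top (ENNReal.sum_ne_top.2 fun I _ => hy _) (hGt _ _)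
  have key := sum_mul_sq_le hφ' hxt
  -- `Γ` carries the test functions and `V` the ancestor sums. Pointwise `sqFun T x ≤ Γ V`, so
  -- Cauchy–Schwarz bounds the integral of the square root.
  set Γ : ℝ × ℝ → ℝ≥0∞ := fun z => ∑ K ∈ T.image Prod.fst,
    K.toSet.indicator (fun _ => (volume K.toSet)⁻¹) z.1 * DyadicInterval.maxFun (G K) z.2 ^ 2 with hΓ
  set N : ℕ := 4 ^ (j + 1) - 1
  set V : ℝ × ℝ → ℝ≥0∞ := fun z => 4 * 2 ^ j * ancMajorant U y (ancs₁ T) N z with hV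
  have hm1 : ∀ K : DyadicInterval, Measurable (K.toSet.indicator fun _ : ℝ => (volume K.toSet)⁻¹) :=
    fun K => measurable_const.indicator K.measurableSet_toSet
  have hm2 : ∀ K, Measurable fun t => DyadicInterval.maxFun (G K) t ^ 2 := fun K =>
    (DyadicInterval.measurable_maxFun _).pow_const 2
  have hΓm : Measurable Γ := Finset.measurable_fun_sum _ fun K _ =>
    ((hm1 K).comp measurable_fst).mul ((hm2 K).comp measurable_snd)
  have hVm : Measurable V := (measurable_ancMajorant _ _ _ _).const_mul _
  have hΓi : ∫⁻ z, Γ z ≤ 8 * ∑ K ∈ T.image Prod.fst, ∫⁻ t, G K t ^ 2 := by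
    have hm3 : ∀ K, Measurable fun z : ℝ × ℝ =>
        K.toSet.indicator (fun _ => (volume K.toSet)⁻¹) z.1 * DyadicInterval.maxFun (G K) z.2 ^ 2 :=
      fun K => ((hm1 K).comp measurable_fst).mul ((hm2 K).comp measurable_snd)
    rw [hΓ, lintegral_finsetSum _ fun K _ => hm3 K, Finset.mul_sum]
    refine Finset.sum_le_sum fun K _ => ?_
    rw [Measure.volume_eq_prod, lintegral_prod_mul (hm1 K).aemeasurable (hm2 K).aemeasurable,
      lintegral_indicator K.measurableSet_toSet, setLIntegral_const,
      ENNReal.inv_mul_cancel K.volume_ne_zero K.volume_ne_top, one_mul]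
    exact DyadicInterval.lintegral_maxFun_sq_le (hG K)
  have hVi : ∫⁻ z, V z ≤ 4 * 2 ^ j * (4 ^ (j + 1) *
      ∑ R ∈ ancs₁ T, sqrtWt (R.1.gen + 1).toNat * (y R ^ 2 * volume R.1.toSet * u R)) := by
    rw [hV, lintegral_const_mul _ (measurable_ancMajorant _ _ _ _)]
    refine mul_le_mul_right ((lintegral_ancMajorant_le hu y _ N).trans_eq ?_) _
    congr 1
    have : (4 ^ (j + 1) - 1) + 1 = 4 ^ (j + 1) := Nat.sub_add_cancel (Nat.one_le_pow _ _ (by norm_num))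
    exact_mod_cast congrArg (Nat.cast (R := ℝ≥0∞)) this
  have hpt : ∀ z, sqFun T x z ≤ Γ z * V z := by
    intro z
    rw [sqFun, ← Finset.sum_fiberwise_of_maps_to (t := T.image Prod.fst) (g := Prod.fst)
      (fun R hR => Finset.mem_image_of_mem _ hR), hΓ, Finset.sum_mul]
    refine Finset.sum_le_sum fun K hK => ?_
    have h1 : ∀ R ∈ T.filter (fun R => R.1 = K),
        R.toSet.indicator (fun _ => x R ^ 2 / volume R.toSet) z ≤
          (K.toSet.indicator (fun _ => (volume K.toSet)⁻¹) z.1 * DyadicInterval.maxFun (G K) z.2 ^ 2) *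
          R.toSet.indicator (fun _ => ancSum₁ y R ^ 2 / volume R.2.toSet) z := by
      intro R hR'
      obtain ⟨hR, rfl⟩ := Finset.mem_filter.1 hR'
      by_cases hz : z ∈ R.toSet
      swap
      · rw [indicator_of_notMem hz]; exact bot_le
      rw [indicator_of_mem hz, indicator_of_mem hz, indicator_of_mem hz.1, hx, volume_toSet]
      simp only [div_eq_mul_inv]
      rw [ENNReal.mul_inv (Or.inl R.1.volume_ne_zero) (Or.inl R.1.volume_ne_top), mul_pow]
      calc _ = (volume R.1.toSet)⁻¹ * R.2.avg (G R.1) ^ 2 *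
            (ancSum₁ y R ^ 2 * (volume R.2.toSet)⁻¹) := by ring
        _ ≤ _ := by
          gcongr
          exact DyadicInterval.avg_le_maxFun hz.2 _
    refine (Finset.sum_le_sum h1).trans ?_
    rw [← Finset.mul_sum]
    refine mul_le_mul_right ((sum_sq_ancSum₁_le y (U := U) (n := N) (fun R hR =>
      ⟨(hT R hR).1, (hgen R hR).2.1⟩) K z).trans ?_) _
    obtain ⟨R, hR, rfl⟩ := Finset.mem_image.1 hK
    refine mul_le_mul_left ?_ _
    refine (mul_le_mul_right (hgen R hR).2.2 2).trans_eq (by ring)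
  have hS : (∫⁻ z, sqFun T x z ^ (1 / 2 : ℝ)) ^ 2 ≤ (∫⁻ z, Γ z) * ∫⁻ z, V z := by
    have h1 : ∀ z, sqFun T x z ^ (1 / 2 : ℝ) ≤ Γ z ^ (1 / 2 : ℝ) * V z ^ (1 / 2 : ℝ) := fun z => by
      rw [← ENNReal.mul_rpow_of_nonneg _ _ (by norm_num)]
      exact ENNReal.rpow_le_rpow (hpt z) (by norm_num)
    refine (pow_le_pow_left' (lintegral_mono h1) 2).trans ((ENNReal.sq_lintegral_mul_le
      (hΓm.pow_const _).aemeasurable (hVm.pow_const _).aemeasurable).trans_eq ?_)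
    simp only [← ENNReal.rpow_natCast, ← ENNReal.rpow_mul]
    norm_num
  have e8 : ((4 : ℝ≥0∞) ^ j) ^ 2 * 2⁻¹ ^ j = 2 ^ j * 4 ^ j := by
    rw [← pow_mul, mul_comm j 2, pow_mul, ← mul_pow, ← mul_pow]
    congr 1
    rw [show (4 : ℝ≥0∞) ^ 2 = 2 * 4 * 2 by norm_num, mul_assoc,
      ENNReal.mul_inv_cancel two_ne_zero ENNReal.ofNat_ne_top, mul_one]
  calc _ ≤ 64 * (A / (4 ^ j) ^ 2) * ((∫⁻ z, Γ z) * ∫⁻ z, V z) :=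
        key.trans (mul_le_mul_right hS _)
    _ ≤ 64 * (A / (4 ^ j) ^ 2) * ((8 * ∑ K ∈ T.image Prod.fst, ∫⁻ t, G K t ^ 2) *
        (4 * 2 ^ j * (4 ^ (j + 1) *
      ∑ R ∈ ancs₁ T, sqrtWt (R.1.gen + 1).toNat * (y R ^ 2 * volume R.1.toSet * u R)))) := by
        gcongr
    _ = 8192 * (A / (4 ^ j) ^ 2) * (∑ K ∈ T.image Prod.fst, ∫⁻ t, G K t ^ 2) * ((2 ^ j * 4 ^ j) *
      ∑ R ∈ ancs₁ T, sqrtWt (R.1.gen + 1).toNat * (y R ^ 2 * volume R.1.toSet * u R)) := by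
        rw [pow_succ]; ring
    _ = 8192 * (A / (4 ^ j) ^ 2 * (4 ^ j) ^ 2) * (∑ K ∈ T.image Prod.fst, ∫⁻ t, G K t ^ 2) *
      (2⁻¹ ^ j *
      ∑ R ∈ ancs₁ T, sqrtWt (R.1.gen + 1).toNat * (y R ^ 2 * volume R.1.toSet * u R)) := by
        rw [← e8]; ring
    _ = _ := by rw [ENNReal.div_mul_cancel h4 h4t, ← Finset.mul_sum]

/-- The blocks of `sq_sum_block_le` are added by Cauchy–Schwarz: the test parts belong to disjoint
sets of intervals, and in the ancestor parts the factor `2⁻ʲ` makes the sum over `j` converge. The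
constant is `8192 · 8`. -/
theorem sq_sum_ancSum₁_le {φ y : DyadicRect → ℝ≥0∞} {A B : ℝ≥0∞}
    (hφ : IsLogCarleson (fun R => φ R ^ 2) A)
    (hy : IsCarleson (fun R => y R ^ 2 * volume R.1.toSet) B) (hyt : ∀ R, y R ≠ ⊤)
    {T : Finset DyadicRect} (hT : ∀ R ∈ T, 0 ≤ R.1.gen ∧ 0 ≤ R.2.gen)
    {G : DyadicInterval → ℝ → ℝ≥0∞} (hG : ∀ K, Measurable (G K))
    (hGt : ∀ K L : DyadicInterval, L.avg (G K) ≠ ⊤) :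
    (∑ R ∈ T, φ R * (ancSum₁ y R * R.2.avg (G R.1))) ^ 2 ≤
      65536 * A * B * volume (⋃ R ∈ T, R.toSet) * ∑ K ∈ T.image Prod.fst, ∫⁻ t, G K t ^ 2 := by
  set U := ⋃ R ∈ T, R.toSet with hU
  obtain ⟨u, hu1, hu2⟩ := exists_weight₁ (measurableSet_biUnion T)
  rw [← hU] at hu1 hu2
  set b : DyadicRect → ℕ := fun R => logBlock 0 R.1.gen.toNat with hb
  set J : Finset ℕ := T.image b
  let Tj : ℕ → Finset DyadicRect := fun j => T.filter fun R => b R = j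
  have hTj : ∀ j, ∀ R ∈ Tj j, R.toSet ⊆ U ∧ 0 ≤ R.1.gen ∧ 0 ≤ R.2.gen ∧
      logBlock 0 R.1.gen.toNat = j := fun j R hR => by
    obtain ⟨h1, h2⟩ := Finset.mem_filter.1 hR
    exact ⟨subset_biUnion_of_mem (u := fun R : DyadicRect => R.toSet) h1, (hT R h1).1, (hT R h1).2, h2⟩
  set w : DyadicRect → ℝ≥0∞ := fun R' => sqrtWt (R'.1.gen + 1).toNat *
    (y R' ^ 2 * volume R'.1.toSet * u R') with hw
  have h1 := ENNReal.sq_sum_le_of_sq_le J fun j _ => sq_sum_block_le hφ hyt hu1 (hTj j) hG hGt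
  rw [Finset.sum_fiberwise_of_maps_to (fun R hR => Finset.mem_image_of_mem b hR)] at h1
  refine h1.trans ?_
  -- The block index depends on the first side alone, so each `K` occurs for only one `j`.
  have h2 : ∑ j ∈ J, ∑ K ∈ (Tj j).image Prod.fst, ∫⁻ t, G K t ^ 2 ≤
      ∑ K ∈ T.image Prod.fst, ∫⁻ t, G K t ^ 2 := by
    have hmaps : ∀ K ∈ T.image Prod.fst, logBlock 0 K.gen.toNat ∈ J := fun K hK => by
      obtain ⟨R, hR, rfl⟩ := Finset.mem_image.1 hK
      exact Finset.mem_image_of_mem b hR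
    rw [← Finset.sum_fiberwise_of_maps_to hmaps]
    refine Finset.sum_le_sum fun j _ => Finset.sum_le_sum_of_subset fun K hK => ?_
    obtain ⟨R, hR, rfl⟩ := Finset.mem_image.1 hK
    obtain ⟨hR1, hR2⟩ := Finset.mem_filter.1 hR
    exact Finset.mem_filter.2 ⟨Finset.mem_image_of_mem _ hR1, hR2⟩
  -- An ancestor of a rectangle in block `j` has block index `i ≤ j`. The tail `∑_{j ≥ i} 2⁻ʲ ≤ 2 ·
  -- 2⁻ⁱ` cancels the weight, which is at most `2 · 2ⁱ`.
  have h3 : ∑ j ∈ J, ∑ R' ∈ ancs₁ (Tj j), 2⁻¹ ^ j * w R' ≤ 8 * B * volume U := by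
    calc ∑ j ∈ J, ∑ R' ∈ ancs₁ (Tj j), 2⁻¹ ^ j * w R'
        ≤ ∑ j ∈ J, ∑ R' ∈ ancs₁ T with logBlock 0 (R'.1.gen + 1).toNat ≤ j, 2⁻¹ ^ j * w R' := by
          refine Finset.sum_le_sum fun j _ => Finset.sum_le_sum_of_subset fun R' hR' => ?_
          obtain ⟨R, hR, h4, h5⟩ := mem_ancs₁.1 hR'
          obtain ⟨hR1, hR2⟩ := Finset.mem_filter.1 hR
          refine Finset.mem_filter.2 ⟨mem_ancs₁.2 ⟨R, hR1, h4, h5⟩, ?_⟩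
          rw [← hR2]
          have := (DyadicInterval.mem_ancs.1 h4).2.1
          exact Nat.log_mono_right (Nat.div_le_div_right (by omega))
      _ = ∑ R' ∈ ancs₁ T, ∑ j ∈ J with logBlock 0 (R'.1.gen + 1).toNat ≤ j, 2⁻¹ ^ j * w R' := by
          refine Finset.sum_comm' fun j R' => ?_
          simp only [Finset.mem_filter]
          tauto
      _ ≤ ∑ R' ∈ ancs₁ T, 4 * (y R' ^ 2 * volume R'.1.toSet * u R') := by
          refine Finset.sum_le_sum fun R' _ => ?_
          rw [← Finset.sum_mul, hw]
          have h5 := sqrtWt_le_logBlock 0 (R'.1.gen + 1).toNat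
          set i := logBlock 0 (R'.1.gen + 1).toNat
          have h6 : (2⁻¹ : ℝ≥0∞) ^ i * 2 ^ i = 1 := by
            rw [← mul_pow, ENNReal.inv_mul_cancel two_ne_zero ENNReal.ofNat_ne_top, one_pow]
          have h7 : sqrtWt 0 = 1 := by simp [sqrtWt]
          calc _ ≤ (2 * 2⁻¹ ^ i) * ((2 * 2 ^ i * sqrtWt 0) * (y R' ^ 2 * volume R'.1.toSet * u R')) :=
                mul_le_mul' (ENNReal.sum_inv_two_pow_le J i) (mul_le_mul_left h5 _)
            _ = 4 * (2⁻¹ ^ i * 2 ^ i) * sqrtWt 0 * (y R' ^ 2 * volume R'.1.toSet * u R') := by ring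
            _ = _ := by rw [h6, h7, mul_one, mul_one]
      _ = 4 * ∑ R' ∈ ancs₁ T, y R' ^ 2 * volume R'.1.toSet * u R' := by rw [Finset.mul_sum]
      _ ≤ 4 * (B * (2 * volume U)) := by
          refine mul_le_mul_right (hu2 _ B _ hy fun R' hR' => ?_) _
          obtain ⟨R, hR, h4, h5⟩ := mem_ancs₁.1 hR'
          exact ⟨(DyadicInterval.mem_ancs.1 h4).1, h5 ▸ (hT R hR).2⟩
      _ = 8 * B * volume U := by ring
  rw [← Finset.mul_sum]
  exact (mul_le_mul' (mul_le_mul_right h2 _) h3).trans_eq (by ring)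

/-! ### Exchange of the coordinates -/

theorem volume_swap (T : Finset DyadicRect) :
    volume (⋃ R ∈ T.image Prod.swap, toSet R) = volume (⋃ R ∈ T, R.toSet) := by
  have h : (⋃ R ∈ T.image Prod.swap, toSet R) = Prod.swap ⁻¹' ⋃ R ∈ T, R.toSet := by
    ext z
    simp only [mem_iUnion, exists_prop, Finset.mem_image, mem_preimage]
    constructor
    · rintro ⟨_, ⟨R, hR, rfl⟩, hz⟩
      exact ⟨R, hR, hz.2, hz.1⟩
    · rintro ⟨R, hR, hz⟩
      exact ⟨_, ⟨R, hR, rfl⟩, hz.2, hz.1⟩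
  rw [h]
  exact (Measure.measurePreserving_swap (μ := (volume : Measure ℝ)) (ν := volume)).measure_preimage
    (measurableSet_biUnion T).nullMeasurableSet

theorem sum_swap (c : DyadicRect → ℝ≥0∞) (T : Finset DyadicRect) :
    ∑ R ∈ T, c R.swap = ∑ R ∈ T.image Prod.swap, c R :=
  (Finset.sum_image fun _ _ _ _ h => Prod.swap_injective h).symm

theorem IsCarleson.swap {c : DyadicRect → ℝ≥0∞} {A : ℝ≥0∞} (h : IsCarleson c A) :
    IsCarleson (fun R => c R.swap) A := fun T => by
  rw [sum_swap c T, ← volume_swap T]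
  exact h _

theorem IsLogCarleson.swap {c : DyadicRect → ℝ≥0∞} {A : ℝ≥0∞} (h : IsLogCarleson c A) :
    IsLogCarleson (fun R => c R.swap) A := fun k l T hT => by
  rw [sum_swap c T, ← volume_swap T, mul_comm ((k : ℝ≥0∞) + 1)]
  refine h l k _ fun R' hR' => ?_
  obtain ⟨R, hR, rfl⟩ := Finset.mem_image.1 hR'
  exact ⟨(hT R hR).2, (hT R hR).1⟩

/-- The sum over the strict ancestors of length at most two in the second variable. -/
noncomputable def ancSum₃ (y : DyadicRect → ℝ≥0∞) (R : DyadicRect) : ℝ≥0∞ :=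
  ∑ J ∈ ancs R.2, y (R.1, J)

theorem sq_sum_ancSum₃_le {φ y : DyadicRect → ℝ≥0∞} {A B : ℝ≥0∞}
    (hφ : IsLogCarleson (fun R => φ R ^ 2) A)
    (hy : IsCarleson (fun R => y R ^ 2 * volume R.2.toSet) B) (hyt : ∀ R, y R ≠ ⊤)
    {T : Finset DyadicRect} (hT : ∀ R ∈ T, 0 ≤ R.1.gen ∧ 0 ≤ R.2.gen)
    {G : DyadicInterval → ℝ → ℝ≥0∞} (hG : ∀ K, Measurable (G K))
    (hGt : ∀ K L : DyadicInterval, L.avg (G K) ≠ ⊤) :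
    (∑ R ∈ T, φ R * (ancSum₃ y R * R.1.avg (G R.2))) ^ 2 ≤
      65536 * A * B * volume (⋃ R ∈ T, R.toSet) * ∑ K ∈ T.image Prod.snd, ∫⁻ t, G K t ^ 2 := by
  have h := sq_sum_ancSum₁_le (φ := fun R => φ R.swap) (y := fun R => y R.swap) hφ.swap hy.swap
    (fun R => hyt _) (T := T.image Prod.swap) (fun R' hR' => by
      obtain ⟨R, hR, rfl⟩ := Finset.mem_image.1 hR'
      exact ⟨(hT R hR).2, (hT R hR).1⟩) hG hGt
  rw [volume_swap, Finset.image_image, ← sum_swap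
    (fun R => φ R.swap * (ancSum₁ (fun R => y R.swap) R * R.2.avg (G R.1)))] at h
  exact h

end DyadicRect

/-! ### Fourth moments of Haar sums and the John–Nirenberg inequality. -/

namespace DyadicInterval

/-- A finite Haar sum with vector coefficients. -/
noncomputable def haarSum {H : Type*} [NormedAddCommGroup H] [InnerProductSpace ℝ H]
    (F : Finset DyadicInterval) (v : DyadicInterval → H) (x : ℝ) : H :=
  ∑ I ∈ F, I.haar x • v I

/-- The square of the square function of a finite Haar sum. -/
noncomputable def haarSq {H : Type*} [NormedAddCommGroup H] (F : Finset DyadicInterval) (v : DyadicInterval → H) (x : ℝ) : ℝ :=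
  ∑ I ∈ F, I.haar x ^ 2 * ‖v I‖ ^ 2

theorem haarSq_nonneg {H : Type*} [NormedAddCommGroup H] (F : Finset DyadicInterval) (v : DyadicInterval → H) (x : ℝ) :
    0 ≤ haarSq F v x := Finset.sum_nonneg fun _ _ => by positivity

theorem measurable_haarSq {H : Type*} [NormedAddCommGroup H] (F : Finset DyadicInterval) (v : DyadicInterval → H) :
    Measurable (haarSq F v) :=
  Finset.measurable_fun_sum _ fun I _ => (I.measurable_haar.pow_const 2).mul_const _

theorem measurable_norm_haarSum {H : Type*} [NormedAddCommGroup H] [InnerProductSpace ℝ H]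
    (F : Finset DyadicInterval) (v : DyadicInterval → H) :
    Measurable fun x => ‖haarSum F v x‖ := by
  have h : StronglyMeasurable (haarSum F v) :=
    Finset.stronglyMeasurable_fun_sum _ fun I _ =>
      I.measurable_haar.stronglyMeasurable.smul stronglyMeasurable_const
  exact h.norm.measurable

theorem haar_of_mem_right {I : DyadicInterval} {x : ℝ} (h : x ∈ I.right.toSet) : I.haar x = I.amp := by
  have h1 : x ∈ I.toSet := by simpa using mem_parent h
  rw [haar_eq, indicator_of_mem h1, show I.gen + 1 = I.right.gen from rfl, mem_toSet_iff.1 h, sgn_right,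
    mul_one]

theorem haar_of_mem_left {I : DyadicInterval} {x : ℝ} (h : x ∈ I.left.toSet) : I.haar x = -I.amp := by
  have h1 : x ∈ I.toSet := by simpa using mem_parent h
  rw [haar_eq, indicator_of_mem h1, show I.gen + 1 = I.left.gen from rfl, mem_toSet_iff.1 h, sgn_left,
    mul_neg_one]

theorem toSet_eq_union (I : DyadicInterval) : I.toSet = I.right.toSet ∪ I.left.toSet := by
  ext x
  constructor
  · intro h
    have h1 : (cell (I.gen + 1) x).parent = I := by
      rw [parent_cell, add_sub_cancel_right, mem_toSet_iff.1 h]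
    rcases eq_right_or_left (cell (I.gen + 1) x) with h2 | h2
    · left; rw [← h1, ← h2]; exact mem_cell _ _
    · right; rw [← h1, ← h2]; exact mem_cell _ _
  · rintro (h | h)
    · simpa using mem_parent h
    · simpa using mem_parent h

theorem disjoint_right_left (I : DyadicInterval) : Disjoint I.right.toSet I.left.toSet := by
  rw [Set.disjoint_left]
  intro x h1 h2
  exact right_ne_left I I (eq_of_mem h1 h2 rfl)

theorem setLIntegral_haar_comp (I : DyadicInterval) (Φ : ℝ → ℝ≥0∞) :
    ∫⁻ x in I.toSet, Φ (I.haar x) =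
      volume I.right.toSet * Φ I.amp + volume I.right.toSet * Φ (-I.amp) := by
  have hv : volume I.left.toSet = volume I.right.toSet := by
    rw [volume_toSet, volume_toSet, length_left, length_right]
  rw [toSet_eq_union, lintegral_union I.left.measurableSet_toSet (disjoint_right_left I),
    setLIntegral_congr_fun (g := fun _ => Φ I.amp) I.right.measurableSet_toSet
      (fun x hx => by simp only [haar_of_mem_right hx]),
    setLIntegral_congr_fun (g := fun _ => Φ (-I.amp)) I.left.measurableSet_toSet
      (fun x hx => by simp only [haar_of_mem_left hx]), setLIntegral_const, setLIntegral_const, hv,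
    mul_comm (Φ _), mul_comm (Φ _)]

theorem haar_const_of_gen_le {I K : DyadicInterval} (hIK : I ≠ K) (h : I.gen ≤ K.gen) {x y : ℝ}
    (hx : x ∈ K.toSet) (hy : y ∈ K.toSet) : I.haar x = I.haar y := by
  rcases h.lt_or_eq with h | h
  · exact haar_const h hx hy
  · rw [haar_of_notMem fun hI => hIK (eq_of_mem hI hx h),
      haar_of_notMem fun hI => hIK (eq_of_mem hI hy h)]

/-- Induction that adds a finest interval `K` last: the old sum is a constant `c` on `K`, while the
new one is `c + w` and `c - w` on the two halves. The odd powers cancel, and the increment of the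
left side is compared with that of the right. -/
theorem lintegral_norm_haarSum_pow_four_le {H : Type*} [NormedAddCommGroup H] [InnerProductSpace ℝ H]
    (F : Finset DyadicInterval) (v : DyadicInterval → H) :
    ∫⁻ x, ENNReal.ofReal (‖haarSum F v x‖ ^ 4) ≤
      6 * ∫⁻ x, ENNReal.ofReal (‖haarSum F v x‖ ^ 2 * haarSq F v x) := by
  induction F using Finset.induction_on_max_value gen with
  | empty => simp [haarSum]
  | insert K F hK hmax ih =>
    set c := haarSum F v K.base
    set κ := haarSq F v K.base
    set w : H := K.amp • v K
    have hne : ∀ I ∈ F, I ≠ K := fun I hI e => hK (e ▸ hI)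
    have hc : ∀ x ∈ K.toSet, haarSum F v x = c := fun x hx => Finset.sum_congr rfl fun I hI => by
      rw [haar_const_of_gen_le (hne I hI) (hmax I hI) hx K.base_mem]
    have hκ : ∀ x ∈ K.toSet, haarSq F v x = κ := fun x hx => Finset.sum_congr rfl fun I hI => by
      rw [haar_const_of_gen_le (hne I hI) (hmax I hI) hx K.base_mem]
    have hκ0 : 0 ≤ κ := haarSq_nonneg _ _ _
    have hi : ∀ x, haarSum (insert K F) v x = K.haar x • v K + haarSum F v x := fun x =>
      Finset.sum_insert hK
    have hq : ∀ x, haarSq (insert K F) v x = K.haar x ^ 2 * ‖v K‖ ^ 2 + haarSq F v x := fun x =>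
      Finset.sum_insert hK
    have hw : K.amp ^ 2 * ‖v K‖ ^ 2 = ‖w‖ ^ 2 := by
      rw [norm_smul, mul_pow, Real.norm_eq_abs, sq_abs]
    set V := volume K.right.toSet
    set a := ‖c‖ ^ 2 with ha
    set b := ‖w‖ ^ 2 with hb
    set X := ENNReal.ofReal (2 * a * b + 2 * b ^ 2) with hX
    have hp := norm_add_sq_real w c
    have hm := norm_add_sq_real (-w) c
    rw [inner_neg_left, norm_neg] at hm
    set y := 2 * inner ℝ w c with hy
    have hy2 : y ^ 2 ≤ 4 * (a * b) := by
      have := abs_real_inner_le_norm w c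
      have h2 : inner ℝ w c ^ 2 ≤ (‖w‖ * ‖c‖) ^ 2 := sq_le_sq' (by linarith [neg_abs_le (inner ℝ w c)])
        ((le_abs_self _).trans this)
      rw [hy, ha, hb]; nlinarith
    have ha0 : 0 ≤ a := by positivity
    have hb0 : 0 ≤ b := by positivity
    have hsplit : ∀ g : ℝ → ℝ≥0∞, ∫⁻ x, g x = (∫⁻ x in K.toSet, g x) + ∫⁻ x in K.toSetᶜ, g x :=
      fun g => (lintegral_add_compl g K.measurableSet_toSet).symm
    have e1 : ∫⁻ x, ENNReal.ofReal (‖haarSum (insert K F) v x‖ ^ 4) =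
        (V * ENNReal.ofReal (‖w + c‖ ^ 4) + V * ENNReal.ofReal (‖-w + c‖ ^ 4)) +
          ∫⁻ x in K.toSetᶜ, ENNReal.ofReal (‖haarSum F v x‖ ^ 4) := by
      rw [hsplit]
      congr 1
      · rw [setLIntegral_congr_fun (g := fun x => ENNReal.ofReal (‖K.haar x • v K + c‖ ^ 4))
          K.measurableSet_toSet (fun x hx => by simp only [hi, hc x hx]),
          setLIntegral_haar_comp K fun r => ENNReal.ofReal (‖r • v K + c‖ ^ 4)]
        simp only [neg_smul]
        rfl
      · refine setLIntegral_congr_fun K.measurableSet_toSet.compl fun x hx => ?_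
        simp only [hi, haar_of_notMem hx, zero_smul, zero_add]
    have e2 : ∫⁻ x, ENNReal.ofReal (‖haarSum (insert K F) v x‖ ^ 2 * haarSq (insert K F) v x) =
        (V * ENNReal.ofReal (‖w + c‖ ^ 2 * (b + κ)) + V * ENNReal.ofReal (‖-w + c‖ ^ 2 * (b + κ))) +
          ∫⁻ x in K.toSetᶜ, ENNReal.ofReal (‖haarSum F v x‖ ^ 2 * haarSq F v x) := by
      rw [hsplit]
      congr 1
      · rw [setLIntegral_congr_fun (g := fun x => ENNReal.ofReal (‖K.haar x • v K + c‖ ^ 2 *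
            (K.haar x ^ 2 * ‖v K‖ ^ 2 + κ)))
          K.measurableSet_toSet (fun x hx => by simp only [hi, hq, hc x hx, hκ x hx]),
          setLIntegral_haar_comp K fun r => ENNReal.ofReal (‖r • v K + c‖ ^ 2 *
            (r ^ 2 * ‖v K‖ ^ 2 + κ))]
        simp only [neg_smul, neg_sq, hw]
        rfl
      · refine setLIntegral_congr_fun K.measurableSet_toSet.compl fun x hx => ?_
        simp only [hi, hq, haar_of_notMem hx, zero_smul, zero_add]
        norm_num
    have e3 : ∫⁻ x, ENNReal.ofReal (‖haarSum F v x‖ ^ 4) = (V * ENNReal.ofReal (a ^ 2) +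
        V * ENNReal.ofReal (a ^ 2)) + ∫⁻ x in K.toSetᶜ, ENNReal.ofReal (‖haarSum F v x‖ ^ 4) := by
      rw [hsplit, setLIntegral_congr_fun (g := fun x => (fun _ => ENNReal.ofReal (a ^ 2)) (K.haar x))
          K.measurableSet_toSet (fun x hx => by simp only [hc x hx, ha, ← pow_mul]),
        setLIntegral_haar_comp K fun _ => ENNReal.ofReal (a ^ 2)]
    have e4 : ∫⁻ x, ENNReal.ofReal (‖haarSum F v x‖ ^ 2 * haarSq F v x) =
        (V * ENNReal.ofReal (a * κ) + V * ENNReal.ofReal (a * κ)) +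
          ∫⁻ x in K.toSetᶜ, ENNReal.ofReal (‖haarSum F v x‖ ^ 2 * haarSq F v x) := by
      rw [hsplit, setLIntegral_congr_fun (g := fun x => (fun _ => ENNReal.ofReal (a * κ)) (K.haar x))
          K.measurableSet_toSet (fun x hx => by simp only [hc x hx, hκ x hx, ha]),
        setLIntegral_haar_comp K fun _ => ENNReal.ofReal (a * κ)]
    -- With `a = ‖c‖²` and `b = ‖w‖²`, the fourth powers sum to `2(a+b)² + 2y²`, and `y² ≤ 4ab`. The
    -- excess over `2a²` is at most `12ab + 2b²`, hence at most `6X`.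
    have n1 : ENNReal.ofReal (‖w + c‖ ^ 4) + ENNReal.ofReal (‖-w + c‖ ^ 4) ≤
        ENNReal.ofReal (a ^ 2) + ENNReal.ofReal (a ^ 2) + 6 * X := by
      rw [hX, show (6 : ℝ≥0∞) = ENNReal.ofReal 6 by simp, ← ENNReal.ofReal_mul (by norm_num),
        ← ENNReal.ofReal_add (by positivity) (by positivity),
        ← ENNReal.ofReal_add (by positivity) (by positivity),
        ← ENNReal.ofReal_add (by positivity) (by positivity)]
      apply ENNReal.ofReal_le_ofReal
      rw [show ‖w + c‖ ^ 4 = (‖w + c‖ ^ 2) ^ 2 by ring, show ‖-w + c‖ ^ 4 = (‖-w + c‖ ^ 2) ^ 2 by ring,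
        hp, hm, ← ha, ← hb]
      nlinarith
    have n2 : ENNReal.ofReal (a * κ) + ENNReal.ofReal (a * κ) + X ≤
        ENNReal.ofReal (‖w + c‖ ^ 2 * (b + κ)) + ENNReal.ofReal (‖-w + c‖ ^ 2 * (b + κ)) := by
      rw [hX, ← ENNReal.ofReal_add (by positivity) (by positivity),
        ← ENNReal.ofReal_add (by positivity) (by positivity),
        ← ENNReal.ofReal_add (by positivity) (by positivity)]
      apply ENNReal.ofReal_le_ofReal
      rw [hp, hm, ← ha, ← hb]
      nlinarith [mul_nonneg hb0 hκ0]
    rw [e1, e2]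
    rw [e3, e4] at ih
    set Y := ∫⁻ x in K.toSetᶜ, ENNReal.ofReal (‖haarSum F v x‖ ^ 4)
    set Z := ∫⁻ x in K.toSetᶜ, ENNReal.ofReal (‖haarSum F v x‖ ^ 2 * haarSq F v x)
    calc _ = V * (ENNReal.ofReal (‖w + c‖ ^ 4) + ENNReal.ofReal (‖-w + c‖ ^ 4)) + Y := by ring
      _ ≤ V * (ENNReal.ofReal (a ^ 2) + ENNReal.ofReal (a ^ 2) + 6 * X) + Y := by gcongr
      _ = (V * ENNReal.ofReal (a ^ 2) + V * ENNReal.ofReal (a ^ 2) + Y) + 6 * (V * X) := by ring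
      _ ≤ 6 * (V * ENNReal.ofReal (a * κ) + V * ENNReal.ofReal (a * κ) + Z) + 6 * (V * X) := by gcongr
      _ = 6 * (V * (ENNReal.ofReal (a * κ) + ENNReal.ofReal (a * κ) + X) + Z) := by ring
      _ ≤ 6 * (V * (ENNReal.ofReal (‖w + c‖ ^ 2 * (b + κ)) +
            ENNReal.ofReal (‖-w + c‖ ^ 2 * (b + κ))) + Z) := by gcongr
      _ = _ := by ring

/-- A finite Haar sum is bounded and dominated by an integrable function. Finiteness permits the
cancellation in the next lemma. -/
theorem lintegral_norm_haarSum_pow_four_lt_top {H : Type*} [NormedAddCommGroup H] [InnerProductSpace ℝ H]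
    (F : Finset DyadicInterval) (v : DyadicInterval → H) :
    ∫⁻ x, ENNReal.ofReal (‖haarSum F v x‖ ^ 4) < ⊤ := by
  set M := ∑ I ∈ F, I.amp * ‖v I‖
  have hg : ∀ x, ‖haarSum F v x‖ ≤ ∑ I ∈ F, |I.haar x| * ‖v I‖ := fun x =>
    (norm_sum_le _ _).trans (Finset.sum_le_sum fun I _ => by rw [norm_smul, Real.norm_eq_abs])
  have hM : ∀ x, ‖haarSum F v x‖ ≤ M := fun x => (hg x).trans <| Finset.sum_le_sum fun I _ => by
    gcongr
    rw [abs_haar]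
    exact indicator_le_self' (fun _ _ => I.amp_pos.le) x
  have hint : Integrable fun x => M ^ 3 * ∑ I ∈ F, |I.haar x| * ‖v I‖ :=
    (integrable_finsetSum _ fun I _ => I.integrable_haar.abs.mul_const _).const_mul _
  refine (lintegral_mono fun x => ENNReal.ofReal_le_ofReal ?_).trans_lt hint.lintegral_lt_top
  rw [pow_succ]
  have h0 : 0 ≤ M := (norm_nonneg _).trans (hM x)
  exact mul_le_mul (pow_le_pow_left₀ (norm_nonneg _) (hM x) 3) (hg x) (norm_nonneg _) (pow_nonneg h0 3)

/-- Cauchy–Schwarz on the right side of the preceding bound, after which one factor of the left side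
is cancelled; `36 = 6²`. -/
theorem lintegral_norm_haarSum_pow_four_le_sq {H : Type*} [NormedAddCommGroup H] [InnerProductSpace ℝ H]
    (F : Finset DyadicInterval) (v : DyadicInterval → H) :
    ∫⁻ x, ENNReal.ofReal (‖haarSum F v x‖ ^ 4) ≤ 36 * ∫⁻ x, ENNReal.ofReal (haarSq F v x ^ 2) := by
  have h1 := lintegral_norm_haarSum_pow_four_le F v
  have h2 := lintegral_norm_haarSum_pow_four_lt_top F v
  set L := ∫⁻ x, ENNReal.ofReal (‖haarSum F v x‖ ^ 4)
  have h3 : (∫⁻ x, ENNReal.ofReal (‖haarSum F v x‖ ^ 2 * haarSq F v x)) ^ 2 ≤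
      L * ∫⁻ x, ENNReal.ofReal (haarSq F v x ^ 2) := by
    have := ENNReal.sq_lintegral_mul_le (μ := volume)
      (f := fun x => ENNReal.ofReal (‖haarSum F v x‖ ^ 2))
      (g := fun x => ENNReal.ofReal (haarSq F v x))
      ((measurable_norm_haarSum F v).pow_const 2).ennreal_ofReal.aemeasurable
      (measurable_haarSq F v).ennreal_ofReal.aemeasurable
    simp only [← ENNReal.ofReal_pow (haarSq_nonneg F v _), ← ENNReal.ofReal_pow (sq_nonneg ‖_‖),
      ← ENNReal.ofReal_mul (sq_nonneg ‖_‖), ← pow_mul] at this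
    exact this
  by_cases h0 : L = 0
  · rw [h0]; exact bot_le
  rw [← ENNReal.mul_le_mul_iff_right h0 h2.ne]
  calc L * L = L ^ 2 := (sq L).symm
    _ ≤ _ := pow_le_pow_left' h1 2
    _ = 36 * (∫⁻ x, ENNReal.ofReal (‖haarSum F v x‖ ^ 2 * haarSq F v x)) ^ 2 := by
      rw [mul_pow]; norm_num
    _ ≤ 36 * (L * ∫⁻ x, ENNReal.ofReal (haarSq F v x ^ 2)) := mul_le_mul_right h3 _
    _ = _ := by ring

end DyadicInterval

namespace DyadicRect

open DyadicInterval (haarSum haarSq)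

/-- A finite Haar sum in two variables. -/
noncomputable def haarSum (T : Finset DyadicRect) (c : DyadicRect → ℂ) (z : ℝ × ℝ) : ℂ :=
  ∑ R ∈ T, c R * R.haar z

theorem measurable_haar (R : DyadicRect) : Measurable R.haar :=
  Complex.measurable_ofReal.comp
    ((R.1.measurable_haar.comp measurable_fst).mul (R.2.measurable_haar.comp measurable_snd))

theorem measurable_haarSum (T : Finset DyadicRect) (c : DyadicRect → ℂ) : Measurable (haarSum T c) :=
  Finset.measurable_fun_sum _ fun R _ => R.measurable_haar.const_mul _

/-- For fixed `t` the sum is a Haar sum in `s` with scalar coefficients. Its squared square function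
is the squared norm of a Haar sum in `t` with coefficients in `ℓ²(F₁)`, to which the Hilbert-space
valued bound applies again. The constant is `36²`. -/
theorem lintegral_norm_haarSum_prod_pow_four_le (F₁ F₂ : Finset DyadicInterval) (c : DyadicRect → ℂ) :
    ∫⁻ z, ENNReal.ofReal (‖haarSum (F₁ ×ˢ F₂) c z‖ ^ 4) ≤
      1296 * ∫⁻ z : ℝ × ℝ, ENNReal.ofReal ((∑ R ∈ F₁ ×ˢ F₂,
        R.1.haar z.1 ^ 2 * (R.2.haar z.2 ^ 2 * ‖c R‖ ^ 2)) ^ 2) := by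
  let v : DyadicInterval → ℝ → ℂ := fun I t => DyadicInterval.haarSum F₂ (fun J => c (I, J)) t
  let u : DyadicInterval → ℝ → EuclideanSpace ℂ F₁ := fun J s =>
    WithLp.toLp 2 fun I : F₁ => I.1.haar s • c (I, J)
  have e1 : ∀ z : ℝ × ℝ, haarSum (F₁ ×ˢ F₂) c z = DyadicInterval.haarSum F₁ (fun I => v I z.2) z.1 := by
    intro z
    simp only [haarSum, DyadicInterval.haarSum, v, Finset.sum_product, Finset.smul_sum, haar]
    refine Finset.sum_congr rfl fun I _ => Finset.sum_congr rfl fun J _ => ?_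
    simp only [Complex.real_smul, Complex.ofReal_mul]
    ring
  have e2 : ∀ s t, haarSq F₁ (fun I => v I t) s = ‖DyadicInterval.haarSum F₂ (fun J => u J s) t‖ ^ 2 := by
    intro s t
    rw [EuclideanSpace.norm_sq_eq, haarSq, ← Finset.sum_coe_sort]
    refine Finset.sum_congr rfl fun I _ => ?_
    rw [← sq_abs (I.1.haar s), ← Real.norm_eq_abs, ← mul_pow, ← norm_smul]
    congr 2
    simp only [v, DyadicInterval.haarSum, u, WithLp.ofLp_sum, Finset.sum_apply, WithLp.ofLp_smul,
      Pi.smul_apply, Finset.smul_sum]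
    exact Finset.sum_congr rfl fun J _ => smul_comm _ _ _
  have e3 : ∀ s t, haarSq F₂ (fun J => u J s) t = ∑ R ∈ F₁ ×ˢ F₂,
      R.1.haar s ^ 2 * (R.2.haar t ^ 2 * ‖c R‖ ^ 2) := by
    intro s t
    rw [Finset.sum_product_right, haarSq]
    refine Finset.sum_congr rfl fun J _ => ?_
    rw [EuclideanSpace.norm_sq_eq, Finset.mul_sum, ← Finset.sum_coe_sort F₁]
    refine Finset.sum_congr rfl fun I _ => ?_
    simp only [u, norm_smul, mul_pow, Real.norm_eq_abs, sq_abs]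
    ring
  have m1 : Measurable fun z : ℝ × ℝ => ENNReal.ofReal (‖haarSum (F₁ ×ˢ F₂) c z‖ ^ 4) :=
    ((measurable_haarSum _ _).norm.pow_const 4).ennreal_ofReal
  have m2 : Measurable fun z : ℝ × ℝ => ENNReal.ofReal ((∑ R ∈ F₁ ×ˢ F₂,
        R.1.haar z.1 ^ 2 * (R.2.haar z.2 ^ 2 * ‖c R‖ ^ 2)) ^ 2) := by
    refine Measurable.ennreal_ofReal (Measurable.pow_const (Finset.measurable_fun_sum _ fun R _ => ?_) 2)
    exact ((R.1.measurable_haar.comp measurable_fst).pow_const 2).mul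
      (((R.2.measurable_haar.comp measurable_snd).pow_const 2).mul_const _)
  have mv : ∀ I, Measurable (v I) := fun I =>
    Finset.measurable_fun_sum _ fun J _ => J.measurable_haar.smul_const _
  have m3 : Measurable fun z : ℝ × ℝ => ENNReal.ofReal (haarSq F₁ (fun I => v I z.2) z.1 ^ 2) := by
    refine Measurable.ennreal_ofReal (Measurable.pow_const (Finset.measurable_fun_sum _ fun I _ => ?_) 2)
    exact ((I.measurable_haar.comp measurable_fst).pow_const 2).mul
      (((mv I).comp measurable_snd).norm.pow_const 2)
  calc ∫⁻ z, ENNReal.ofReal (‖haarSum (F₁ ×ˢ F₂) c z‖ ^ 4)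
      = ∫⁻ t, ∫⁻ s, ENNReal.ofReal (‖haarSum (F₁ ×ˢ F₂) c (s, t)‖ ^ 4) := lintegral_prod_symm' _ m1
    _ ≤ ∫⁻ t, 36 * ∫⁻ s, ENNReal.ofReal (haarSq F₁ (fun I => v I t) s ^ 2) := by
        refine lintegral_mono fun t => ?_
        simp only [e1]
        exact DyadicInterval.lintegral_norm_haarSum_pow_four_le_sq F₁ fun I => v I t
    _ = 36 * ∫⁻ s, ∫⁻ t, ENNReal.ofReal (haarSq F₁ (fun I => v I t) s ^ 2) := by
        rw [lintegral_const_mul' _ _ (by norm_num)]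
        congr 1
        exact (lintegral_lintegral_swap (f := fun s t => ENNReal.ofReal
          (haarSq F₁ (fun I => v I t) s ^ 2)) m3.aemeasurable).symm
    _ ≤ 36 * ∫⁻ s, 36 * ∫⁻ t, ENNReal.ofReal ((∑ R ∈ F₁ ×ˢ F₂,
          R.1.haar s ^ 2 * (R.2.haar t ^ 2 * ‖c R‖ ^ 2)) ^ 2) := by
        refine mul_le_mul_right (lintegral_mono fun s => ?_) _
        simp only [e2, ← e3, ← pow_mul]
        exact DyadicInterval.lintegral_norm_haarSum_pow_four_le_sq F₂ fun J => u J s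
    _ = 1296 * ∫⁻ s, ∫⁻ t, ENNReal.ofReal ((∑ R ∈ F₁ ×ˢ F₂,
          R.1.haar s ^ 2 * (R.2.haar t ^ 2 * ‖c R‖ ^ 2)) ^ 2) := by
        rw [lintegral_const_mul' _ _ (by norm_num), ← mul_assoc]
        norm_num
    _ = _ := by
        congr 1
        exact (lintegral_prod (μ := volume) (ν := volume) (fun z : ℝ × ℝ =>
          ENNReal.ofReal ((∑ R ∈ F₁ ×ˢ F₂,
            R.1.haar z.1 ^ 2 * (R.2.haar z.2 ^ 2 * ‖c R‖ ^ 2)) ^ 2)) m2.aemeasurable).symm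

theorem ofReal_haar_sq_mul (R : DyadicRect) (c : ℂ) (z : ℝ × ℝ) :
    ENNReal.ofReal (R.1.haar z.1 ^ 2 * (R.2.haar z.2 ^ 2 * ‖c‖ ^ 2)) =
      R.toSet.indicator (fun _ => ‖c‖ₑ ^ 2 / volume R.toSet) z := by
  rw [sq (R.1.haar _), sq (R.2.haar _), DyadicInterval.haar_sq, DyadicInterval.haar_sq]
  by_cases h : z ∈ R.toSet
  · rw [indicator_of_mem h, indicator_of_mem h.1, indicator_of_mem h.2, volume_toSet,
      DyadicInterval.volume_toSet, DyadicInterval.volume_toSet,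
      ← ENNReal.ofReal_mul R.1.length_pos.le, ENNReal.div_eq_inv_mul,
      ← ENNReal.ofReal_inv_of_pos (mul_pos R.1.length_pos R.2.length_pos), ← ofReal_norm,
      ← ENNReal.ofReal_pow (norm_nonneg _), ← ENNReal.ofReal_mul
        (inv_nonneg.2 (mul_pos R.1.length_pos R.2.length_pos).le), mul_inv, mul_assoc]
  · rw [indicator_of_notMem h]
    have h' : z.1 ∉ R.1.toSet ∨ z.2 ∉ R.2.toSet := by
      by_contra! hc
      exact h ⟨hc.1, hc.2⟩
    rcases h' with h' | h' <;> simp [h']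

theorem lintegral_norm_haarSum_pow_four_le_sqFun (T : Finset DyadicRect) (c : DyadicRect → ℂ) :
    ∫⁻ z, ‖haarSum T c z‖ₑ ^ 4 ≤ 1296 * ∫⁻ z, sqFun T (fun R => ‖c R‖ₑ) z ^ 2 := by
  have key : ∀ F₁ F₂ : Finset DyadicInterval, ∀ c : DyadicRect → ℂ,
      ∫⁻ z, ‖haarSum (F₁ ×ˢ F₂) c z‖ₑ ^ 4 ≤
        1296 * ∫⁻ z, sqFun (F₁ ×ˢ F₂) (fun R => ‖c R‖ₑ) z ^ 2 := by
    intro F₁ F₂ c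
    have h := lintegral_norm_haarSum_prod_pow_four_le F₁ F₂ c
    have e : ∀ z : ℝ × ℝ, ENNReal.ofReal ((∑ R ∈ F₁ ×ˢ F₂,
        R.1.haar z.1 ^ 2 * (R.2.haar z.2 ^ 2 * ‖c R‖ ^ 2)) ^ 2) =
        sqFun (F₁ ×ˢ F₂) (fun R => ‖c R‖ₑ) z ^ 2 := by
      intro z
      rw [ENNReal.ofReal_pow (Finset.sum_nonneg fun R _ => by positivity),
        ENNReal.ofReal_sum_of_nonneg fun R _ => by positivity]
      simp only [ofReal_haar_sq_mul, sqFun]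
    simp only [e] at h
    simpa only [← ofReal_norm, ← ENNReal.ofReal_pow (norm_nonneg _)] using h
  -- An arbitrary finite family becomes a product family when its coefficients are extended by zero.
  let c' : DyadicRect → ℂ := fun R => if R ∈ T then c R else 0
  have hsub : T ⊆ T.image Prod.fst ×ˢ T.image Prod.snd := fun R hR =>
    Finset.mem_product.2 ⟨Finset.mem_image_of_mem _ hR, Finset.mem_image_of_mem _ hR⟩
  have h := key (T.image Prod.fst) (T.image Prod.snd) c'
  have e1 : ∀ z, haarSum (T.image Prod.fst ×ˢ T.image Prod.snd) c' z = haarSum T c z := by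
    intro z
    rw [haarSum, haarSum, ← Finset.sum_subset hsub]
    · exact Finset.sum_congr rfl fun R hR => by simp [c', hR]
    · intro R _ hR; simp [c', hR]
  have e2 : ∀ z, sqFun (T.image Prod.fst ×ˢ T.image Prod.snd) (fun R => ‖c' R‖ₑ) z =
      sqFun T (fun R => ‖c R‖ₑ) z := by
    intro z
    rw [sqFun, sqFun, ← Finset.sum_subset hsub]
    · exact Finset.sum_congr rfl fun R hR => by simp [c', hR]
    · intro R _ hR; simp [c', hR]
  simpa only [e1, e2] using h

/-- With `q` the squared square function, `L = ∫ q² = ∑ x_R² avg_R q`. Carleson embedding bounds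
this by `B ∫_U Mq`, and Cauchy–Schwarz with the maximal theorem gives `L² ≤ 64 B² |U| L`. Finiteness
of `L` allows division. -/
theorem lintegral_sqFun_sq_le {x : DyadicRect → ℝ≥0∞} {B : ℝ≥0∞} {T : Finset DyadicRect}
    (hx : ∀ T' ⊆ T, ∑ R ∈ T', x R ^ 2 ≤ B * volume (⋃ R ∈ T', R.toSet)) (hxt : ∀ R ∈ T, x R ≠ ⊤) :
    ∫⁻ z, sqFun T x z ^ 2 ≤ 64 * B ^ 2 * volume (⋃ R ∈ T, R.toSet) := by
  set q := sqFun T x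
  have hq : Measurable q := measurable_sqFun T x
  set U := ⋃ R ∈ T, R.toSet
  have hU : MeasurableSet U := measurableSet_biUnion T
  set L := ∫⁻ z, q z ^ 2
  have hLt : L ≠ ⊤ := by
    set M := ∑ R ∈ T, x R ^ 2 / volume R.toSet
    have hM : M ≠ ⊤ := ENNReal.sum_ne_top.2 fun R hR =>
      ENNReal.div_ne_top (ENNReal.pow_ne_top (hxt R hR)) R.volume_ne_zero
    have h1 : ∀ z, q z ^ 2 ≤ U.indicator (fun _ => M ^ 2) z := by
      intro z
      by_cases hz : z ∈ U
      · rw [indicator_of_mem hz]; exact pow_le_pow_left' (sqFun_le x z) 2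
      · have : q z = 0 := Finset.sum_eq_zero fun R hR => indicator_of_notMem
          (fun h => hz (mem_biUnion (Finset.mem_coe.2 hR) h)) _
        rw [this]; simp
    refine ne_top_of_le_ne_top ?_ (lintegral_mono h1)
    rw [lintegral_indicator hU, setLIntegral_const]
    refine ENNReal.mul_ne_top (ENNReal.pow_ne_top hM) ?_
    exact ne_top_of_le_ne_top (ENNReal.sum_ne_top.2 fun R _ => R.volume_ne_top)
      (measure_biUnion_finset_le T _)
  have h1 : L = ∑ R ∈ T, x R ^ 2 * R.avg q := by
    rw [sum_sq_mul_avg T x hq]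
    simp only [L, sq]
    rfl
  have h2 : L ≤ B * ∫⁻ z, U.indicator 1 z * maxFun q z := by
    rw [h1]
    refine IsCarleson.embedding hx (fun R => R.avg q) _ fun R hR z hz => ?_
    have hz' : z ∈ U := mem_biUnion (Finset.mem_coe.2 hR) hz
    rw [indicator_of_mem hz']
    simpa using avg_le_maxFun hz q
  have h3 : (∫⁻ z, U.indicator 1 z * maxFun q z) ^ 2 ≤ volume U * (64 * L) := by
    refine (ENNReal.sq_lintegral_mul_le (measurable_one.indicator hU).aemeasurable
      (measurable_maxFun q).aemeasurable).trans (mul_le_mul' (le_of_eq ?_) (lintegral_maxFun_sq_le hq))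
    rw [← lintegral_indicator_one hU]
    refine lintegral_congr fun z => ?_
    by_cases hz : z ∈ U <;> simp [hz]
  by_cases h0 : L = 0
  · rw [h0]; exact bot_le
  rw [← ENNReal.mul_le_mul_iff_right h0 hLt]
  calc L * L = L ^ 2 := (sq L).symm
    _ ≤ (B * ∫⁻ z, U.indicator 1 z * maxFun q z) ^ 2 := pow_le_pow_left' h2 2
    _ = B ^ 2 * (∫⁻ z, U.indicator 1 z * maxFun q z) ^ 2 := mul_pow _ _ _
    _ ≤ B ^ 2 * (volume U * (64 * L)) := mul_le_mul_right h3 _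
    _ = _ := by ring

/-- The dyadic product John–Nirenberg inequality in `L⁴`. -/
theorem lintegral_norm_haarSum_pow_four_le {c : DyadicRect → ℂ} {B : ℝ≥0∞} {T : Finset DyadicRect}
    (hc : ∀ T' ⊆ T, ∑ R ∈ T', ‖c R‖ₑ ^ 2 ≤ B * volume (⋃ R ∈ T', R.toSet)) :
    ∫⁻ z, ‖haarSum T c z‖ₑ ^ 4 ≤ 82944 * B ^ 2 * volume (⋃ R ∈ T, R.toSet) := by
  refine (lintegral_norm_haarSum_pow_four_le_sqFun T c).trans ?_
  refine (mul_le_mul_right (lintegral_sqFun_sq_le hc fun R _ => enorm_ne_top) _).trans_eq ?_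
  rw [← mul_assoc, ← mul_assoc]
  norm_num

end DyadicRect

/-! ### The Haar basis of `L²(ℝ²)` -/

theorem haarL2_ae (R : DyadicRect) : haarL2 R =ᵐ[volume] R.haar := MemLp.coeFn_toLp _

theorem DyadicRect.conj_haar (R : DyadicRect) (z : ℝ × ℝ) :
    (starRingEnd ℂ) (R.haar z) = R.haar z := Complex.conj_ofReal _

theorem inner_haarL2 (R : DyadicRect) (f : L2Plane) : inner ℂ (haarL2 R) f = haarCoeff f R := by
  rw [L2.inner_def, haarCoeff]
  refine integral_congr_ae ?_
  filter_upwards [haarL2_ae R] with z hz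
  rw [hz, RCLike.inner_apply, DyadicRect.conj_haar]

theorem DyadicRect.integral_haar_mul_haar (R Q : DyadicRect) :
    ∫ z, R.haar z * Q.haar z = if R = Q then 1 else 0 := by
  have h : ∀ z, R.haar z * Q.haar z =
      (((R.1.haar z.1 * Q.1.haar z.1) * (R.2.haar z.2 * Q.2.haar z.2) : ℝ) : ℂ) := fun z => by
    simp only [DyadicRect.haar]; push_cast; ring
  simp only [h]
  rw [integral_complex_ofReal, Measure.volume_eq_prod,
    integral_prod_mul (fun s => R.1.haar s * Q.1.haar s) (fun t => R.2.haar t * Q.2.haar t),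
    DyadicInterval.integral_haar_mul_haar, DyadicInterval.integral_haar_mul_haar]
  by_cases h1 : R.1 = Q.1 <;> by_cases h2 : R.2 = Q.2 <;> simp [h1, h2, Prod.ext_iff]

theorem haarCoeff_haarL2 (R Q : DyadicRect) :
    haarCoeff (haarL2 R) Q = if R = Q then 1 else 0 := by
  rw [← DyadicRect.integral_haar_mul_haar, haarCoeff]
  refine integral_congr_ae ?_
  filter_upwards [haarL2_ae R] with z hz
  rw [hz]

theorem orthonormal_haarL2 : Orthonormal ℂ haarL2 := by
  rw [orthonormal_iff_ite]
  intro R Q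
  rw [inner_haarL2, haarCoeff_haarL2]
  simp only [eq_comm]

namespace DyadicInterval

/-- Additivity and equality on the two halves make `|g|` double from an interval to its parent, but
the bound allows growth by only `√2` per generation. Iteration upwards forces `g = 0`. -/
theorem eq_zero_of_children {g : DyadicInterval → ℂ} {C : ℝ}
    (h : ∀ I : DyadicInterval, g I.right = g I.left)
    (h2 : ∀ I : DyadicInterval, g I = g I.right + g I.left) (hb : ∀ I, ‖g I‖ ^ 2 ≤ C * I.length)
    (I : DyadicInterval) : g I = 0 := by
  have hp : ∀ I : DyadicInterval, ‖g I.parent‖ = 2 * ‖g I‖ := by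
    intro I
    have h3 : g I.parent = 2 * g I := by
      rcases eq_right_or_left I with e | e
      · rw [h2 I.parent, ← h, ← e]; ring
      · rw [h2 I.parent, h, ← e]; ring
    rw [h3, norm_mul]; norm_num
  have key : ∀ n : ℕ, ∀ I, ‖g I‖ ^ 2 ≤ C * I.length * (1 / 2) ^ n := by
    intro n
    induction n with
    | zero => simpa using hb
    | succ n ih =>
      intro I
      have := ih I.parent
      rw [hp, length_parent] at this
      rw [pow_succ (1 / 2 : ℝ) n]
      linarith
  have hlim : Filter.Tendsto (fun n : ℕ => C * I.length * (1 / 2 : ℝ) ^ n) Filter.atTop (nhds 0) := by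
    simpa using (tendsto_pow_atTop_nhds_zero_of_lt_one (r := (1 / 2 : ℝ)) (by norm_num)
      (by norm_num)).const_mul (C * I.length)
  have h0 : ‖g I‖ ^ 2 ≤ 0 := ge_of_tendsto' hlim fun n => key n I
  exact norm_eq_zero.1 (pow_eq_zero_iff two_ne_zero |>.1 (le_antisymm h0 (sq_nonneg _)))

end DyadicInterval

namespace DyadicRect

theorem norm_sq_setIntegral_le (f : L2Plane) (R : DyadicRect) :
    ‖∫ z in R.toSet, f z‖ ^ 2 ≤ ‖f‖ ^ 2 * (R.1.length * R.2.length) := by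
  rw [← L2.inner_indicatorConstLp_one (𝕜 := ℂ) R.measurableSet_toSet R.volume_ne_top f]
  have h := norm_inner_le_norm (𝕜 := ℂ) (indicatorConstLp 2 R.measurableSet_toSet R.volume_ne_top (1 : ℂ)) f
  rw [norm_indicatorConstLp two_ne_zero ENNReal.ofNat_ne_top, norm_one, one_mul] at h
  have hv : volume.real R.toSet = R.1.length * R.2.length := by
    rw [Measure.real, volume_toSet, ENNReal.toReal_mul, DyadicInterval.volume_toSet,
      DyadicInterval.volume_toSet, ENNReal.toReal_ofReal R.1.length_pos.le,
      ENNReal.toReal_ofReal R.2.length_pos.le]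
  rw [hv] at h
  have hl : 0 ≤ R.1.length * R.2.length := (mul_pos R.1.length_pos R.2.length_pos).le
  refine (pow_le_pow_left₀ (norm_nonneg _) h 2).trans_eq ?_
  rw [mul_pow, ← Real.rpow_natCast (_ ^ _), ← Real.rpow_mul hl]
  norm_num
  ring

theorem integrableOn_toSet (f : L2Plane) (R : DyadicRect) : IntegrableOn f R.toSet := by
  have : IsFiniteMeasure (volume.restrict R.toSet) := ⟨by
    rw [Measure.restrict_apply_univ]; exact R.volume_ne_top.lt_top⟩
  exact ((Lp.memLp f).restrict R.toSet).integrable (by norm_num)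

theorem setIntegral_children₁ (f : L2Plane) (I J : DyadicInterval) :
    ∫ z in toSet (I, J), f z = (∫ z in toSet (I.right, J), f z) + ∫ z in toSet (I.left, J), f z := by
  have h : toSet (I, J) = toSet (I.right, J) ∪ toSet (I.left, J) := by
    simp only [toSet]
    rw [← union_prod, ← DyadicInterval.toSet_eq_union]
  rw [h, setIntegral_union _ (measurableSet_toSet _) (integrableOn_toSet f _) (integrableOn_toSet f _)]
  exact (I.disjoint_right_left).set_prod_left _ _

theorem setIntegral_children₂ (f : L2Plane) (I J : DyadicInterval) :
    ∫ z in toSet (I, J), f z = (∫ z in toSet (I, J.right), f z) + ∫ z in toSet (I, J.left), f z := by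
  have h : toSet (I, J) = toSet (I, J.right) ∪ toSet (I, J.left) := by
    simp only [toSet]
    rw [← prod_union, ← DyadicInterval.toSet_eq_union]
  rw [h, setIntegral_union _ (measurableSet_toSet _) (integrableOn_toSet f _) (integrableOn_toSet f _)]
  exact (J.disjoint_right_left).set_prod_right _ _

theorem haarCoeff_eq (f : L2Plane) (I J : DyadicInterval) :
    haarCoeff f (I, J) = ((I.amp * J.amp : ℝ) : ℂ) *
      (((∫ z in toSet (I.right, J.right), f z) - ∫ z in toSet (I.right, J.left), f z) -
        ((∫ z in toSet (I.left, J.right), f z) - ∫ z in toSet (I.left, J.left), f z)) := by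
  have hp : ∀ z : ℝ × ℝ, f z * haar (I, J) z = ((I.amp * J.amp : ℝ) : ℂ) *
      (((toSet (I.right, J.right)).indicator f z - (toSet (I.right, J.left)).indicator f z) -
        ((toSet (I.left, J.right)).indicator f z - (toSet (I.left, J.left)).indicator f z)) := by
    intro z
    simp only [haar, DyadicInterval.haar, DyadicInterval.amp, toSet, indicator, mem_prod]
    push_cast
    split_ifs <;> simp_all <;> ring
  have hi : ∀ R : DyadicRect, Integrable (R.toSet.indicator f) := fun R =>
    (integrableOn_toSet f R).integrable_indicator R.measurableSet_toSet
  have hs : ∀ R Q : DyadicRect, ∫ z, (R.toSet.indicator f z - Q.toSet.indicator f z) =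
      (∫ z in R.toSet, f z) - ∫ z in Q.toSet, f z := fun R Q => by
    rw [integral_sub (hi R) (hi Q), integral_indicator R.measurableSet_toSet,
      integral_indicator Q.measurableSet_toSet]
  have hi' : ∀ R Q : DyadicRect, Integrable fun z => R.toSet.indicator f z - Q.toSet.indicator f z :=
    fun R Q => (hi R).sub (hi Q)
  rw [haarCoeff]
  simp only [hp]
  rw [integral_const_mul, integral_sub (hi' _ _) (hi' _ _), hs, hs]

/-- Vanishing Haar coefficients say that the difference of the integrals over `I × J⁺` and `I × J⁻`
takes equal values at the two halves of `I`. `eq_zero_of_children` in the first variable kills this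
difference, and a second application in the other variable kills the integral itself. -/
theorem setIntegral_eq_zero {f : L2Plane} (hf : ∀ R, haarCoeff f R = 0) (R : DyadicRect) :
    ∫ z in R.toSet, f z = 0 := by
  let a : DyadicInterval → DyadicInterval → ℂ := fun I J => ∫ z in toSet (I, J), f z
  have hb : ∀ I J, ‖a I J‖ ^ 2 ≤ ‖f‖ ^ 2 * (I.length * J.length) := fun I J =>
    norm_sq_setIntegral_le f (I, J)
  have h1 : ∀ J I : DyadicInterval, a I J.right - a I J.left = 0 := by
    intro J
    refine DyadicInterval.eq_zero_of_children (g := fun I => a I J.right - a I J.left)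
      (C := ‖f‖ ^ 2 * (4 * J.length)) ?_ ?_ ?_
    · intro I
      have h := hf (I, J)
      rw [haarCoeff_eq] at h
      have h0 : ((I.amp * J.amp : ℝ) : ℂ) ≠ 0 :=
        Complex.ofReal_ne_zero.2 (mul_pos I.amp_pos J.amp_pos).ne'
      exact sub_eq_zero.1 ((mul_eq_zero.1 h).resolve_left h0)
    · intro I
      simp only [a]
      rw [setIntegral_children₁ f I J.right, setIntegral_children₁ f I J.left]
      ring
    · intro I
      have e1 := hb I J.right
      have e2 := hb I J.left
      rw [DyadicInterval.length_right] at e1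
      rw [DyadicInterval.length_left] at e2
      have e3 := norm_sub_le (a I J.right) (a I J.left)
      have e4 : ‖a I J.right - a I J.left‖ ^ 2 ≤ (‖a I J.right‖ + ‖a I J.left‖) ^ 2 :=
        pow_le_pow_left₀ (norm_nonneg _) e3 2
      have e5 : 0 ≤ ‖f‖ ^ 2 * (I.length * J.length) :=
        mul_nonneg (sq_nonneg _) (mul_pos I.length_pos J.length_pos).le
      nlinarith [sq_nonneg (‖a I J.right‖ - ‖a I J.left‖)]
  refine DyadicInterval.eq_zero_of_children (g := fun J => a R.1 J) (C := ‖f‖ ^ 2 * R.1.length)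
    (fun J => sub_eq_zero.1 (h1 J R.1)) (fun J => setIntegral_children₂ f R.1 J) (fun J => ?_) R.2
  rw [mul_assoc]
  exact hb R.1 J

/-- Dyadic squares are balls of the sup metric up to null sets, so the Lebesgue differentiation
theorem for balls applies to them. -/
theorem ae_eq_closedBall (n : ℕ) (z : ℝ × ℝ) :
    Metric.closedBall ((DyadicInterval.cell n z.1).base + (1 / 2) ^ n / 2,
      (DyadicInterval.cell n z.2).base + (1 / 2) ^ n / 2) ((1 / 2 : ℝ) ^ n / 2) =ᵐ[volume]
      (cell (n, n) z).toSet := by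
  have h1 : ∀ x : ℝ, Metric.closedBall ((DyadicInterval.cell n x).base + (1 / 2) ^ n / 2)
      ((1 / 2 : ℝ) ^ n / 2) =ᵐ[volume] (DyadicInterval.cell n x).toSet := by
    intro x
    have hl : (DyadicInterval.cell n x).length = (1 / 2 : ℝ) ^ n := by
      rw [DyadicInterval.length, DyadicInterval.cell_gen, zpow_neg, zpow_natCast, one_div, inv_pow]
    rw [Real.closedBall_eq_Icc, DyadicInterval.toSet, DyadicInterval.base, hl]
    refine Filter.EventuallyEq.trans (Filter.EventuallyEq.of_eq ?_) Ico_ae_eq_Icc.symm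
    congr 1 <;> ring
  rw [← closedBall_prod_same, toSet, Measure.volume_eq_prod]
  exact Measure.set_prod_ae_eq (h1 z.1) (h1 z.2)

end DyadicRect

theorem eq_zero_of_haarCoeff_eq_zero {f : L2Plane} (hf : ∀ R, haarCoeff f R = 0) : f = 0 := by
  have hloc : LocallyIntegrable f volume := (Lp.memLp f).locallyIntegrable (by norm_num)
  have h := IsUnifLocDoublingMeasure.ae_tendsto_average volume hloc 1
  rw [Lp.ext_iff]
  filter_upwards [h, Lp.coeFn_zero ℂ 2 (volume : Measure (ℝ × ℝ))] with z hz h0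
  rw [h0, Pi.zero_apply]
  have hδ : Filter.Tendsto (fun n : ℕ => (1 / 2 : ℝ) ^ n / 2) Filter.atTop (nhdsWithin 0 (Ioi 0)) := by
    rw [tendsto_nhdsWithin_iff]
    refine ⟨?_, Filter.Eventually.of_forall fun n => by simp only [mem_Ioi]; positivity⟩
    simpa using (tendsto_pow_atTop_nhds_zero_of_lt_one (r := (1 / 2 : ℝ)) (by norm_num)
      (by norm_num)).div_const 2
  have key := hz (fun n : ℕ => ((DyadicInterval.cell n z.1).base + (1 / 2) ^ n / 2,
      (DyadicInterval.cell n z.2).base + (1 / 2) ^ n / 2)) (fun n : ℕ => (1 / 2 : ℝ) ^ n / 2) hδ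
    (Filter.Eventually.of_forall fun n => by
      have hx : ∀ x : ℝ, x ∈ Metric.closedBall ((DyadicInterval.cell n x).base + (1 / 2) ^ n / 2)
          ((1 / 2 : ℝ) ^ n / 2) := fun x => by
        have hl : (DyadicInterval.cell n x).length = (1 / 2 : ℝ) ^ n := by
          rw [DyadicInterval.length, DyadicInterval.cell_gen, zpow_neg, zpow_natCast, one_div, inv_pow]
        have := DyadicInterval.mem_cell n x
        rw [DyadicInterval.toSet, hl, mem_Ico] at this
        rw [Real.closedBall_eq_Icc, DyadicInterval.base, hl, mem_Icc]
        constructor <;> linarith [this.1, this.2]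
      rw [one_mul, ← closedBall_prod_same]
      exact ⟨hx z.1, hx z.2⟩)
  refine tendsto_nhds_unique key ?_
  refine (tendsto_const_nhds (x := (0 : ℂ))).congr fun n => ?_
  rw [setAverage_eq, setIntegral_congr_set (DyadicRect.ae_eq_closedBall n z),
    DyadicRect.setIntegral_eq_zero hf, smul_zero]

/-- The Haar basis of `L²(ℝ²)`. -/
noncomputable def haarBasis : HilbertBasis DyadicRect ℂ L2Plane :=
  HilbertBasis.mkOfOrthogonalEqBot orthonormal_haarL2 (by
    rw [Submodule.eq_bot_iff]
    intro f hf
    refine eq_zero_of_haarCoeff_eq_zero fun R => ?_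
    rw [← inner_haarL2]
    exact hf _ (Submodule.subset_span ⟨R, rfl⟩))

theorem haarBasis_apply (R : DyadicRect) : haarBasis R = haarL2 R := by
  simp [haarBasis]

theorem hasSum_haarL2 (f : L2Plane) : HasSum (fun R => haarCoeff f R • haarL2 R) f := by
  have h := haarBasis.hasSum_repr f
  simpa only [HilbertBasis.repr_apply_apply, haarBasis_apply, inner_haarL2] using h

theorem summable_norm_haarCoeff_sq (f : L2Plane) : Summable fun R => ‖haarCoeff f R‖ ^ 2 := by
  simpa only [inner_haarL2] using orthonormal_haarL2.inner_products_summable f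

theorem haarCoeff_sub (f g : L2Plane) (R : DyadicRect) :
    haarCoeff (f - g : L2Plane) R = haarCoeff f R - haarCoeff g R := by
  simp only [← inner_haarL2, inner_sub_right]

theorem haarCoeff_congr {f g : ℝ × ℝ → ℂ} (h : f =ᵐ[volume] g) (R : DyadicRect) :
    haarCoeff f R = haarCoeff g R :=
  integral_congr_ae (h.mono fun z hz => by simp only [hz])

theorem hasSum_haarCoeff_mul (f w : L2Plane) :
    HasSum (fun R => haarCoeff f R * haarCoeff w R) (∫ z, f z * w z) := by
  -- The pairing is bilinear while the inner product is conjugate-linear on one side; `star` undoes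
  -- the conjugation.
  have h := haarBasis.hasSum_inner_mul_inner (star w) f
  have hs := Lp.coeFn_star w
  have e1 : ∀ R, inner ℂ (star w) (haarL2 R) = haarCoeff w R := fun R => by
    rw [L2.inner_def, haarCoeff]
    refine integral_congr_ae ?_
    filter_upwards [hs, haarL2_ae R] with z h1 h2
    rw [h1, h2, RCLike.inner_apply, Pi.star_apply, RCLike.star_def, Complex.conj_conj, mul_comm]
  have e2 : inner ℂ (star w) f = ∫ z, f z * w z := by
    rw [L2.inner_def]
    refine integral_congr_ae ?_
    filter_upwards [hs] with z h1
    rw [h1, RCLike.inner_apply, Pi.star_apply, RCLike.star_def, Complex.conj_conj]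
  simp only [e1, e2, haarBasis_apply, inner_haarL2] at h
  simpa only [mul_comm] using h

/-! ### Coefficients of shifts and projections -/

theorem summable_smul_haarL2 {c : DyadicRect → ℂ} (hc : Summable fun R => ‖c R‖ ^ 2)
    {ι : Type*} {e : ι → DyadicRect} {d : ι → DyadicRect} (he : e.Injective) (hd : d.Injective) :
    Summable fun i => c (d i) • haarL2 (e i) := by
  have h := (orthonormal_haarL2.comp e he).orthogonalFamily.summable_iff_norm_sq_summable
    (fun i => c (d i))
  simp only [LinearIsometry.toSpanSingleton_apply, Function.comp_apply] at h
  exact h.2 (hc.comp_injective hd)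

theorem injective_right₁ : Function.Injective fun R : DyadicRect => ((R.1.right, R.2) : DyadicRect) :=
  fun R Q h => by
    simp only [Prod.mk.injEq] at h
    exact Prod.ext (DyadicInterval.right_injective h.1) h.2

theorem injective_left₁ : Function.Injective fun R : DyadicRect => ((R.1.left, R.2) : DyadicRect) :=
  fun R Q h => by
    simp only [Prod.mk.injEq] at h
    exact Prod.ext (DyadicInterval.left_injective h.1) h.2

theorem injective_right₂ : Function.Injective fun R : DyadicRect => ((R.1, R.2.right) : DyadicRect) :=
  fun R Q h => by
    simp only [Prod.mk.injEq] at h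
    exact Prod.ext h.1 (DyadicInterval.right_injective h.2)

theorem injective_left₂ : Function.Injective fun R : DyadicRect => ((R.1, R.2.left) : DyadicRect) :=
  fun R Q h => by
    simp only [Prod.mk.injEq] at h
    exact Prod.ext h.1 (DyadicInterval.left_injective h.2)

theorem hasSum_haarCoeff {ι : Type*} {u : ι → L2Plane} {f : L2Plane} (h : HasSum u f) (Q : DyadicRect) :
    HasSum (fun i => haarCoeff (u i) Q) (haarCoeff f Q) := by
  have h2 := h.mapL (innerSL ℂ (haarL2 Q))
  simp only [innerSL_apply_apply, inner_haarL2] at h2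
  exact h2

theorem haarCoeff_smul (c : ℂ) (f : L2Plane) (Q : DyadicRect) :
    haarCoeff (c • f : L2Plane) Q = c * haarCoeff f Q := by
  simp only [← inner_haarL2, inner_smul_right]

theorem haarCoeff_shift₁ (f : L2Plane) (Q : DyadicRect) :
    haarCoeff (shift₁ f) Q = Q.1.sgn * haarCoeff f (Q.1.parent, Q.2) := by
  have hs : Summable fun R : DyadicRect =>
      haarCoeff f R • (haarL2 (R.1.right, R.2) - haarL2 (R.1.left, R.2)) := by
    simp only [smul_sub]
    exact (summable_smul_haarL2 (summable_norm_haarCoeff_sq f) injective_right₁ (d := id)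
      Function.injective_id).sub (summable_smul_haarL2 (summable_norm_haarCoeff_sq f) injective_left₁
        (d := id) Function.injective_id)
  refine (hasSum_haarCoeff hs.hasSum Q).unique ?_
  have h := hasSum_single (f := fun R : DyadicRect => haarCoeff
    (haarCoeff f R • (haarL2 (R.1.right, R.2) - haarL2 (R.1.left, R.2)) : L2Plane) Q) (Q.1.parent, Q.2)
  have e : ∀ R : DyadicRect, haarCoeff
      (haarCoeff f R • (haarL2 (R.1.right, R.2) - haarL2 (R.1.left, R.2)) : L2Plane) Q =
      if R = (Q.1.parent, Q.2) then Q.1.sgn * haarCoeff f R else 0 := by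
    intro R
    have h1 := DyadicInterval.sub_ite_children Q.1 R.1 1
    rw [haarCoeff_smul, haarCoeff_sub, haarCoeff_haarL2, haarCoeff_haarL2]
    by_cases h2 : R.2 = Q.2
    · have h3 : ((if ((R.1.right, R.2) : DyadicRect) = Q then (1 : ℂ) else 0) -
          if ((R.1.left, R.2) : DyadicRect) = Q then 1 else 0) =
          (((if Q.1 = R.1.right then (1 : ℝ) else 0) - (if Q.1 = R.1.left then 1 else 0) : ℝ) : ℂ) := by
        simp only [Prod.ext_iff, h2, and_true, eq_comm (a := Q.1)]
        split_ifs <;> simp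
      rw [h3, h1]
      simp only [Prod.ext_iff, h2, and_true]
      split_ifs
      · push_cast; ring
      · simp
    · simp [Prod.ext_iff, h2]
  simp only [e] at h ⊢
  simpa using h fun R hR => by simp [hR]

theorem haarCoeff_shift₂ (f : L2Plane) (Q : DyadicRect) :
    haarCoeff (shift₂ f) Q = Q.2.sgn * haarCoeff f (Q.1, Q.2.parent) := by
  have hs : Summable fun R : DyadicRect =>
      haarCoeff f R • (haarL2 (R.1, R.2.right) - haarL2 (R.1, R.2.left)) := by
    simp only [smul_sub]
    exact (summable_smul_haarL2 (summable_norm_haarCoeff_sq f) injective_right₂ (d := id)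
      Function.injective_id).sub (summable_smul_haarL2 (summable_norm_haarCoeff_sq f) injective_left₂
        (d := id) Function.injective_id)
  refine (hasSum_haarCoeff hs.hasSum Q).unique ?_
  have h := hasSum_single (f := fun R : DyadicRect => haarCoeff
    (haarCoeff f R • (haarL2 (R.1, R.2.right) - haarL2 (R.1, R.2.left)) : L2Plane) Q) (Q.1, Q.2.parent)
  have e : ∀ R : DyadicRect, haarCoeff
      (haarCoeff f R • (haarL2 (R.1, R.2.right) - haarL2 (R.1, R.2.left)) : L2Plane) Q =
      if R = (Q.1, Q.2.parent) then Q.2.sgn * haarCoeff f R else 0 := by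
    intro R
    have h1 := DyadicInterval.sub_ite_children Q.2 R.2 1
    rw [haarCoeff_smul, haarCoeff_sub, haarCoeff_haarL2, haarCoeff_haarL2]
    by_cases h2 : R.1 = Q.1
    · have h3 : ((if ((R.1, R.2.right) : DyadicRect) = Q then (1 : ℂ) else 0) -
          if ((R.1, R.2.left) : DyadicRect) = Q then 1 else 0) =
          (((if Q.2 = R.2.right then (1 : ℝ) else 0) - (if Q.2 = R.2.left then 1 else 0) : ℝ) : ℂ) := by
        simp only [Prod.ext_iff, h2, true_and, eq_comm (a := Q.2)]
        split_ifs <;> simp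
      rw [h3, h1]
      simp only [Prod.ext_iff, h2, true_and]
      split_ifs
      · push_cast; ring
      · simp
    · simp [Prod.ext_iff, h2]
  simp only [e] at h ⊢
  simpa using h fun R hR => by simp [hR]

theorem haarCoeff_projQ (k : ℕ × ℕ) (f : L2Plane) {Q : DyadicRect} (h1 : (k.1 : ℤ) ≤ Q.1.gen)
    (h2 : (k.2 : ℤ) ≤ Q.2.gen) : haarCoeff (projQ k f) Q = haarCoeff f Q := by
  have hs : Summable fun R : {R : DyadicRect // (k.1 : ℤ) ≤ R.1.gen ∧ (k.2 : ℤ) ≤ R.2.gen} =>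
      haarCoeff f R.1 • haarL2 R.1 :=
    summable_smul_haarL2 (summable_norm_haarCoeff_sq f) Subtype.val_injective Subtype.val_injective
  refine (hasSum_haarCoeff hs.hasSum Q).unique ?_
  have h := hasSum_single (f := fun R : {R : DyadicRect // (k.1 : ℤ) ≤ R.1.gen ∧ (k.2 : ℤ) ≤ R.2.gen} =>
    haarCoeff (haarCoeff f R.1 • haarL2 R.1 : L2Plane) Q) ⟨Q, h1, h2⟩
  simp only [haarCoeff_smul, haarCoeff_haarL2] at h ⊢
  simpa using h fun R hR => by
    rw [if_neg, mul_zero]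
    exact fun e => hR (Subtype.ext e)

/-! ### The norms in terms of Carleson conditions -/

/-- A finite union of half-open rectangles is not open, so outer regularity supplies open sets of
almost the same measure. The case of infinite norm is handled apart. -/
theorem sum_enorm_haarCoeff_sq_le (f : ℝ × ℝ → ℂ) :
    DyadicRect.IsCarleson (fun R => ‖haarCoeff f R‖ₑ ^ 2) (bmoNorm f ^ 2) := by
  intro T
  by_cases hT : T = ∅
  · simp [hT]
  set V := volume (⋃ R ∈ T, R.toSet)
  have hVt : V ≠ ⊤ := ne_top_of_le_ne_top (ENNReal.sum_ne_top.2 fun R _ => R.volume_ne_top)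
    (measure_biUnion_finset_le T _)
  have hne : (⋃ R ∈ T, R.toSet).Nonempty := by
    obtain ⟨R, hR⟩ := Finset.nonempty_iff_ne_empty.2 hT
    obtain ⟨s, hs⟩ := R.1.nonempty_toSet
    obtain ⟨t, ht⟩ := R.2.nonempty_toSet
    exact ⟨(s, t), mem_biUnion (Finset.mem_coe.2 hR) ⟨hs, ht⟩⟩
  have key : ∀ r, V < r → ∑ R ∈ T, ‖haarCoeff f R‖ₑ ^ 2 ≤ bmoNorm f ^ 2 * r := by
    intro r hr
    obtain ⟨Ω, hΩ, hΩo, hΩr⟩ := Set.exists_isOpen_lt_of_lt _ r hr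
    have h1 : ((∑' R : {R : DyadicRect // R.toSet ⊆ Ω}, ‖haarCoeff f R.1‖ₑ ^ 2) / volume Ω) ^
        (1 / 2 : ℝ) ≤ bmoNorm f :=
      le_iSup_of_le Ω (le_iSup_of_le hΩo (le_iSup_of_le (hne.mono hΩ)
        (le_iSup_of_le (hΩr.trans_le le_top) le_rfl)))
    have h2 := pow_le_pow_left' h1 2
    rw [← ENNReal.rpow_natCast, ← ENNReal.rpow_mul] at h2
    norm_num at h2
    have hΩ0 : volume Ω ≠ 0 := (hΩo.measure_pos volume (hne.mono hΩ)).ne'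
    rw [ENNReal.div_le_iff hΩ0 (hΩr.trans_le le_top).ne] at h2
    refine le_trans ?_ (h2.trans (mul_le_mul_right hΩr.le _))
    have hsub : ∀ R ∈ T, R.toSet ⊆ Ω := fun R hR =>
      (subset_biUnion_of_mem (u := fun R : DyadicRect => R.toSet) hR).trans hΩ
    classical
    rw [← Finset.sum_subtype_of_mem (fun R => ‖haarCoeff f R‖ₑ ^ 2) hsub]
    exact ENNReal.sum_le_tsum (T.subtype fun R : DyadicRect => R.toSet ⊆ Ω)
  by_cases hb : bmoNorm f = ⊤
  · rw [hb]
    have hV0 : V ≠ 0 := by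
      obtain ⟨R, hR⟩ := Finset.nonempty_iff_ne_empty.2 hT
      exact fun h => R.volume_ne_zero (measure_mono_null
        (subset_biUnion_of_mem (u := fun R : DyadicRect => R.toSet) hR) h)
    simp [ENNReal.top_mul hV0]
  · refine ENNReal.le_of_forall_pos_le_add fun ε hε _ => ?_
    by_cases hb0 : bmoNorm f ^ 2 = 0
    · have := key (V + 1) (ENNReal.lt_add_right hVt one_ne_zero)
      rw [hb0, zero_mul] at this
      exact this.trans bot_le
    have hbt : bmoNorm f ^ 2 ≠ ⊤ := ENNReal.pow_ne_top hb
    refine (key (V + ε / bmoNorm f ^ 2) (ENNReal.lt_add_right hVt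
      (ENNReal.div_ne_zero.2 ⟨by exact_mod_cast hε.ne', hbt⟩))).trans_eq ?_
    rw [mul_add, ENNReal.mul_div_cancel hb0 hbt]

theorem bmoNorm_le {f : ℝ × ℝ → ℂ} {C : ℝ≥0∞}
    (h : DyadicRect.IsCarleson (fun R => ‖haarCoeff f R‖ₑ ^ 2) (C ^ 2)) : bmoNorm f ≤ C := by
  refine iSup_le fun Ω => iSup_le fun hΩo => iSup_le fun hne => iSup_le fun hΩt => ?_
  have hΩ0 : volume Ω ≠ 0 := (hΩo.measure_pos volume hne).ne'
  have h1 : (∑' R : {R : DyadicRect // R.toSet ⊆ Ω}, ‖haarCoeff f R.1‖ₑ ^ 2) ≤ C ^ 2 * volume Ω := by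
    rw [ENNReal.tsum_eq_iSup_sum]
    refine iSup_le fun S => ?_
    have h2 := h (S.image Subtype.val)
    rw [Finset.sum_image fun _ _ _ _ h => Subtype.ext h] at h2
    refine h2.trans (mul_le_mul_right (measure_mono ?_) _)
    refine iUnion₂_subset fun R hR => ?_
    obtain ⟨R, -, rfl⟩ := Finset.mem_image.1 hR
    exact R.2
  calc _ ≤ (C ^ 2 * volume Ω / volume Ω) ^ (1 / 2 : ℝ) :=
        ENNReal.rpow_le_rpow (ENNReal.div_le_div_right h1 _) (by norm_num)
    _ = C := by
        rw [ENNReal.mul_div_cancel_right hΩ0 hΩt.ne, ← ENNReal.rpow_natCast, ← ENNReal.rpow_mul]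
        norm_num

theorem bmoNorm_projQ_le (f : L2Plane) (k : ℕ × ℕ) :
    bmoNorm (projQ k f) ≤ lmoNorm f / (((k.1 : ℝ≥0∞) + 1) * ((k.2 : ℝ≥0∞) + 1)) := by
  have h0 : ((k.1 : ℝ≥0∞) + 1) * ((k.2 : ℝ≥0∞) + 1) ≠ 0 := mul_ne_zero (by simp) (by simp)
  have ht : ((k.1 : ℝ≥0∞) + 1) * ((k.2 : ℝ≥0∞) + 1) ≠ ⊤ := by finiteness
  rw [ENNReal.le_div_iff_mul_le (Or.inl h0) (Or.inl ht)]
  refine le_sInf fun C hC => ?_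
  rw [← ENNReal.le_div_iff_mul_le (Or.inl h0) (Or.inl ht)]
  exact hC k

/-- On rectangles of generations at least `(k, l)` the coefficients of `f` are those of `projQ (k,
l) f`, whose BMO norm has the required decay. -/
theorem isLogCarleson_haarCoeff (f : L2Plane) :
    DyadicRect.IsLogCarleson (fun R => ‖haarCoeff f R‖ₑ ^ 2) (lmoNorm f ^ 2) := by
  intro k l T hT
  set w := ((k : ℝ≥0∞) + 1) * (l + 1)
  have h0 : w ≠ 0 := mul_ne_zero (by simp) (by simp)
  have ht : w ≠ ⊤ := by finiteness
  have h1 := sum_enorm_haarCoeff_sq_le (projQ (k, l) f) T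
  have h2 : ∑ R ∈ T, ‖haarCoeff f R‖ₑ ^ 2 ≤
      bmoNorm (projQ (k, l) f) ^ 2 * volume (⋃ R ∈ T, R.toSet) := by
    refine le_trans (le_of_eq (Finset.sum_congr rfl fun R hR => ?_)) h1
    simp only
    rw [haarCoeff_projQ (k, l) f (hT R hR).1 (hT R hR).2]
  calc w ^ 2 * ∑ R ∈ T, ‖haarCoeff f R‖ₑ ^ 2
      ≤ w ^ 2 * ((lmoNorm f / w) ^ 2 * volume (⋃ R ∈ T, R.toSet)) := by
        refine mul_le_mul_right (h2.trans (mul_le_mul_left (pow_le_pow_left' ?_ 2) _)) _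
        exact bmoNorm_projQ_le f (k, l)
    _ = (w * (lmoNorm f / w)) ^ 2 * volume (⋃ R ∈ T, R.toSet) := by ring
    _ = _ := by rw [ENNReal.mul_div_cancel h0 ht]

/-! ### Passage to parents and decay at large scales. -/

namespace DyadicInterval

/-- The parent of `I` if `p` holds, otherwise `I` itself. -/
def par (p : Bool) (I : DyadicInterval) : DyadicInterval := if p then I.parent else I

theorem par_subset_parent (p : Bool) (I : DyadicInterval) : (par p I).toSet ⊆ I.parent.toSet := by
  cases p
  · exact subset_parent I
  · exact subset_rfl

theorem par_cell (p : Bool) (n : ℤ) (x : ℝ) : par p (cell n x) = cell (n - p.toNat) x := by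
  cases p
  · simp [par]
  · simp [par, parent_cell]

/-- The intervals whose image under `par p` is `I`. -/
noncomputable def fibre (p : Bool) (I : DyadicInterval) : Finset DyadicInterval :=
  if p then {I.right, I.left} else {I}

theorem mem_fibre {p : Bool} {I K : DyadicInterval} (h : par p K = I) : K ∈ fibre p I := by
  subst h
  cases p
  · simp [fibre, par]
  · simp only [fibre, par, if_true, Finset.mem_insert, Finset.mem_singleton]
    exact eq_right_or_left K

theorem card_fibre_le (p : Bool) (I : DyadicInterval) : (fibre p I).card ≤ 2 := by
  cases p
  · simp [fibre]
  · exact Finset.card_le_two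

/-- The normalisation `|I| ^ (-1/2)` of the Haar functions in `[0, ∞]`. -/
noncomputable def eamp (I : DyadicInterval) : ℝ≥0∞ := ENNReal.ofReal I.amp

theorem eamp_ne_top (I : DyadicInterval) : eamp I ≠ ⊤ := ENNReal.ofReal_ne_top

theorem eamp_sq_mul_volume (I : DyadicInterval) : eamp I ^ 2 * volume I.toSet = 1 := by
  rw [eamp, ← ENNReal.ofReal_pow I.amp_pos.le, amp_sq, volume_toSet,
    ← ENNReal.ofReal_mul (inv_nonneg.2 I.length_pos.le), inv_mul_cancel₀ I.length_pos.ne',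
    ENNReal.ofReal_one]

theorem amp_parent (I : DyadicInterval) : I.parent.amp = 2 ^ (-(1 / 2) : ℝ) * I.amp := by
  rw [amp, length_parent, Real.mul_rpow zero_le_two I.length_pos.le, amp]

/-- The constant `2 ^ (-1/2)`. -/
noncomputable def rootHalf : ℝ≥0∞ := ENNReal.ofReal (2 ^ (-(1 / 2) : ℝ))

theorem rootHalf_mul_self : rootHalf * rootHalf = 2⁻¹ := by
  rw [rootHalf, ← ENNReal.ofReal_mul (by positivity), ← Real.rpow_add two_pos]
  norm_num
  rw [one_div, ENNReal.ofReal_inv_of_pos two_pos]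
  simp

theorem eamp_parent (I : DyadicInterval) : I.parent.eamp = rootHalf * I.eamp := by
  rw [eamp, amp_parent, ENNReal.ofReal_mul (by positivity)]
  rfl

/-- The decay of the coefficients at the large intervals around `0` of a function that is
supported in the unit interval. -/
def Decays (F : DyadicInterval → ℝ≥0∞) : Prop :=
  ∀ n : ℤ, n ≤ -1 → F (cell (n - 1) 0) ≤ rootHalf * F (cell n 0)

theorem Decays.par {F : DyadicInterval → ℝ≥0∞} (h : Decays F) (p : Bool) :
    Decays fun I => F (par p I) := by
  intro n hn
  simp only [par_cell]
  have := h (n - p.toNat) (by omega)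
  rwa [show n - (p.toNat : ℤ) - 1 = n - 1 - p.toNat by ring] at this

theorem Decays.sum {ι : Type*} {s : Finset ι} {F : ι → DyadicInterval → ℝ≥0∞} {c : ι → ℝ≥0∞}
    (h : ∀ i ∈ s, Decays (F i)) : Decays fun I => ∑ i ∈ s, F i I * c i := by
  intro n hn
  simp only [Finset.mul_sum, ← mul_assoc]
  exact Finset.sum_le_sum fun i hi => mul_le_mul_left (h i hi n hn) _

open Classical in
theorem enorm_meanHaar (K I : DyadicInterval) :
    ‖meanHaar K I‖ₑ = if I.gen < K.gen ∧ K.base ∈ I.toSet then eamp I else 0 := by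
  rw [← ofReal_norm, Real.norm_eq_abs, abs_meanHaar]
  by_cases h1 : I.gen < K.gen <;> by_cases h2 : K.base ∈ I.toSet <;> simp [h1, h2, eamp]

/-- The unit interval `[0, 1)`. -/
def unit : DyadicInterval := ⟨0, 0⟩

theorem unit_eq_cell : unit = cell 0 0 := by simp [unit, cell]

theorem zero_mem_unit : (0 : ℝ) ∈ unit.toSet := unit_eq_cell ▸ mem_cell 0 0

theorem eq_cell_zero {I K : DyadicInterval} {x : ℝ} (hK : K.toSet ⊆ unit.toSet) (hxK : x ∈ K.toSet)
    (hx : x ∈ I.toSet) (hg : I.gen ≤ 0) : I = cell I.gen 0 :=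
  (mem_toSet_iff.1 (subset_of_mem hx (hK hxK) hg zero_mem_unit)).symm

/-- Intervals longer than 2 that contain `K` also contain 0. Per generation upwards both `F` and the
height of `h_I` lose at least a factor `√2`, so their product at least halves, and the whole tail is
at most the term of `[0, 2)`, which already occurs in `ancs K`. -/
theorem tsum_meanHaar_le {K : DyadicInterval} (hK : K.toSet ⊆ unit.toSet) (hg : 0 ≤ K.gen)
    {F : DyadicInterval → ℝ≥0∞} (hF : Decays F) :
    ∑' I, ‖meanHaar K I‖ₑ * F I ≤ 2 * ∑ I ∈ ancs K, F I * eamp I := by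
  set y : DyadicInterval → ℝ≥0∞ := fun I => F I * eamp I with hy
  have hstep : ∀ n : ℤ, n ≤ -1 → y (cell (n - 1) 0) ≤ 2⁻¹ * y (cell n 0) := by
    intro n hn
    simp only [hy]
    rw [← parent_cell, eamp_parent, ← rootHalf_mul_self]
    have := hF n hn
    rw [← parent_cell] at this
    exact (mul_le_mul_left this _).trans_eq (by ring)
  have hpow : ∀ n : ℕ, y (cell (-1 - n) 0) ≤ 2⁻¹ ^ n * y (cell (-1) 0) := by
    intro n
    induction n with
    | zero => simp
    | succ n ih =>
      have := hstep (-1 - n) (by omega)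
      rw [show (-1 - (n : ℤ)) - 1 = -1 - (n + 1 : ℕ) by push_cast; ring] at this
      refine this.trans ((mul_le_mul_right ih _).trans_eq ?_)
      rw [pow_succ]; ring
  have hle : ∀ I, ‖meanHaar K I‖ₑ * F I ≤ (if I ∈ ancs K then y I else 0) +
      ∑' n : ℕ, if I = cell (-1 - (n + 1 : ℕ)) 0 then y I else 0 := by
    intro I
    rw [enorm_meanHaar]
    split_ifs with h1 h2
    · exact le_add_right (by rw [mul_comm])
    · have h3 : I.gen < -1 := by
        by_contra! h3
        exact h2 (mem_ancs.2 ⟨h3, h1.1, subset_of_mem h1.2 K.base_mem h1.1.le⟩)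
      have h4 := eq_cell_zero hK K.base_mem h1.2 (by omega)
      refine le_add_left (le_trans ?_ (ENNReal.le_tsum (-2 - I.gen).toNat))
      rw [if_pos, mul_comm]
      rw [show (-1 - (((-2 - I.gen).toNat + 1 : ℕ) : ℤ)) = I.gen by push_cast; omega]
      exact h4
    · rw [zero_mul]; exact bot_le
    · rw [zero_mul]; exact bot_le
  have hmem : cell (-1) 0 ∈ ancs K := by
    refine mem_ancs.2 ⟨le_rfl, by simp only [cell_gen]; omega, hK.trans ?_⟩
    exact subset_of_mem (mem_cell _ _) zero_mem_unit (by simp [unit])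
  calc ∑' I, ‖meanHaar K I‖ₑ * F I ≤ ∑' I, ((if I ∈ ancs K then y I else 0) +
      ∑' n : ℕ, if I = cell (-1 - (n + 1 : ℕ)) 0 then y I else 0) := ENNReal.tsum_le_tsum hle
    _ = ∑ I ∈ ancs K, y I + ∑' n : ℕ, y (cell (-1 - (n + 1 : ℕ)) 0) := by
        rw [ENNReal.tsum_add, ENNReal.tsum_comm]
        congr 1
        · rw [tsum_eq_sum (s := ancs K) fun I hI => if_neg hI]
          exact Finset.sum_congr rfl fun I hI => if_pos hI
        · congr 1
          ext n
          rw [tsum_eq_single (cell (-1 - (n + 1 : ℕ)) 0) fun I hI => if_neg hI, if_pos rfl]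
    _ ≤ ∑ I ∈ ancs K, y I + ∑' n : ℕ, 2⁻¹ ^ (n + 1) * y (cell (-1) 0) := by
        gcongr with n
        exact hpow (n + 1)
    _ = ∑ I ∈ ancs K, y I + y (cell (-1) 0) := by
        rw [ENNReal.tsum_mul_right]
        simp only [pow_succ]
        rw [ENNReal.tsum_mul_right, ENNReal.tsum_inv_two_pow,
          ENNReal.mul_inv_cancel two_ne_zero ENNReal.ofNat_ne_top, one_mul]
    _ ≤ _ := by
        rw [two_mul]
        gcongr
        exact Finset.single_le_sum (f := y) (fun _ _ => bot_le) hmem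

end DyadicInterval

namespace DyadicRect

open DyadicInterval (par fibre)

/-- Passage to parents in the two coordinates. -/
def par₂ (p q : Bool) (R : DyadicRect) : DyadicRect := (par p R.1, par q R.2)

theorem card_filter_par₂_le (p q : Bool) (T : Finset DyadicRect) (N : DyadicRect) :
    (T.filter fun R => par₂ p q R = N).card ≤ 4 := by
  calc _ ≤ (fibre p N.1 ×ˢ fibre q N.2).card := by
        refine Finset.card_le_card fun R hR => ?_
        have h := (Finset.mem_filter.1 hR).2
        rw [Finset.mem_product]
        exact ⟨DyadicInterval.mem_fibre (congrArg Prod.fst h), DyadicInterval.mem_fibre (congrArg Prod.snd h)⟩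
    _ ≤ 4 := by
        rw [Finset.card_product]
        exact Nat.mul_le_mul (DyadicInterval.card_fibre_le _ _) (DyadicInterval.card_fibre_le _ _)

/-- The enlarged rectangles lie where the strong maximal function of `1_U` is at least `1/4`; its
`L²` bound gives `16 · 64`. -/
theorem volume_parents_le (T : Finset DyadicRect) :
    volume (⋃ R ∈ T, toSet (R.1.parent, R.2.parent)) ≤ 1024 * volume (⋃ R ∈ T, R.toSet) := by
  set U := ⋃ R ∈ T, R.toSet
  have hU : MeasurableSet U := measurableSet_biUnion T
  set V := ⋃ R ∈ T, toSet (R.1.parent, R.2.parent)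
  have hV : MeasurableSet V := Finset.measurableSet_biUnion _ fun R _ => measurableSet_toSet _
  have h1 : ∀ z, V.indicator 1 z ≤ 16 * maxFun (U.indicator 1) z ^ 2 := by
    intro z
    by_cases hz : z ∈ V
    swap
    · rw [indicator_of_notMem hz]; exact bot_le
    rw [indicator_of_mem hz, Pi.one_apply]
    obtain ⟨R, hR, hz⟩ := mem_iUnion₂.1 hz
    have h2 := avg_le_maxFun hz (U.indicator 1)
    set R' : DyadicRect := (R.1.parent, R.2.parent)
    have hv : volume R'.toSet = 4 * volume R.toSet := by
      rw [volume_toSet, volume_toSet, DyadicInterval.volume_toSet, DyadicInterval.volume_toSet,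
        DyadicInterval.volume_toSet, DyadicInterval.volume_toSet, DyadicInterval.length_parent,
        DyadicInterval.length_parent, ENNReal.ofReal_mul zero_le_two, ENNReal.ofReal_mul zero_le_two,
        show ENNReal.ofReal 2 = 2 by simp]
      ring
    have h3 : 1 ≤ 4 * R'.avg (U.indicator 1) := by
      have h4 : volume R.toSet ≤ ∫⁻ z in R'.toSet, U.indicator 1 z := by
        rw [← lintegral_indicator R'.measurableSet_toSet, ← lintegral_indicator_one R.measurableSet_toSet]
        refine lintegral_mono fun x => ?_
        by_cases hx : x ∈ R.toSet
        · have hx1 : x ∈ R'.toSet := ⟨R.1.subset_parent hx.1, R.2.subset_parent hx.2⟩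
          have hx2 : x ∈ U := mem_biUnion (Finset.mem_coe.2 hR) hx
          rw [indicator_of_mem hx, indicator_of_mem hx1, indicator_of_mem hx2]
        · rw [indicator_of_notMem hx]; exact bot_le
      rw [← volume_mul_avg, hv] at h4
      rw [← ENNReal.mul_le_mul_iff_right R.volume_ne_zero R.volume_ne_top, mul_one]
      exact h4.trans_eq (by ring)
    calc (1 : ℝ≥0∞) = 1 ^ 2 := by norm_num
      _ ≤ (4 * maxFun (U.indicator 1) z) ^ 2 :=
        pow_le_pow_left' (h3.trans (mul_le_mul_right h2 _)) 2
      _ = _ := by rw [mul_pow]; norm_num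
  calc volume V = ∫⁻ z, V.indicator 1 z := (lintegral_indicator_one hV).symm
    _ ≤ ∫⁻ z, 16 * maxFun (U.indicator 1) z ^ 2 := lintegral_mono h1
    _ = 16 * ∫⁻ z, maxFun (U.indicator 1) z ^ 2 :=
        lintegral_const_mul _ ((measurable_maxFun _).pow_const 2)
    _ ≤ 16 * (64 * ∫⁻ z, U.indicator 1 z ^ 2) :=
        mul_le_mul_right (lintegral_maxFun_sq_le (measurable_one.indicator hU)) _
    _ = 1024 * volume U := by
        rw [← mul_assoc, ← lintegral_indicator_one hU]
        congr 1
        · norm_num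
        · refine lintegral_congr fun z => ?_
          by_cases hz : z ∈ U <;> simp [hz]

/-- Each rectangle has at most four preimages, and the union of the parents has measure at most 1024
times the original. -/
theorem IsCarleson.comp_par₂ {c : DyadicRect → ℝ≥0∞} {B : ℝ≥0∞} (h : IsCarleson c B) (p q : Bool) :
    IsCarleson (fun R => c (par₂ p q R)) (4096 * B) := by
  intro T
  calc ∑ R ∈ T, c (par₂ p q R)
      = ∑ N ∈ T.image (par₂ p q), ∑ R ∈ T with par₂ p q R = N, c N :=
        (Finset.sum_fiberwise_of_maps_to' (fun R hR => Finset.mem_image_of_mem _ hR) c).symm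
    _ ≤ ∑ N ∈ T.image (par₂ p q), 4 * c N := by
        refine Finset.sum_le_sum fun N _ => ?_
        rw [Finset.sum_const, nsmul_eq_mul]
        gcongr
        exact_mod_cast card_filter_par₂_le p q T N
    _ = 4 * ∑ N ∈ T.image (par₂ p q), c N := by rw [Finset.mul_sum]
    _ ≤ 4 * (B * (1024 * volume (⋃ R ∈ T, R.toSet))) := by
        refine mul_le_mul_right ((h _).trans (mul_le_mul_right (le_trans (measure_mono ?_)
          (volume_parents_le T)) _)) _
        refine iUnion₂_subset fun N hN => ?_
        obtain ⟨R, hR, rfl⟩ := Finset.mem_image.1 hN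
        exact subset_trans (prod_mono (DyadicInterval.par_subset_parent _ _)
          (DyadicInterval.par_subset_parent _ _)) (subset_biUnion_of_mem
            (u := fun R : DyadicRect => toSet (R.1.parent, R.2.parent)) hR)
    _ = _ := by ring

/-- The signed sums of `g` over the fibres of the passage to parents. -/
noncomputable def fibreSum (p q : Bool) (T : Finset DyadicRect) (g : DyadicRect → ℂ) (N : DyadicRect) : ℂ :=
  ∑ Q ∈ T with par₂ p q Q = N, g Q

theorem enorm_fibreSum_sq_le (p q : Bool) (T : Finset DyadicRect) (g : DyadicRect → ℂ)
    (N : DyadicRect) : ‖fibreSum p q T g N‖ₑ ^ 2 ≤ 4 * ∑ Q ∈ T with par₂ p q Q = N, ‖g Q‖ₑ ^ 2 := by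
  have h := ENNReal.sq_sum_mul_le (T.filter fun Q => par₂ p q Q = N) (fun _ => 1) fun Q => ‖g Q‖ₑ
  simp only [one_mul, one_pow, Finset.sum_const, nsmul_eq_mul, mul_one] at h
  refine (pow_le_pow_left' (enorm_sum_le _ _) 2).trans (h.trans (mul_le_mul_left ?_ _))
  exact_mod_cast card_filter_par₂_le p q T N

theorem sum_enorm_fibreSum_sq_le (p q : Bool) (T : Finset DyadicRect) (g : DyadicRect → ℂ) :
    ∑ N ∈ T.image (par₂ p q), ‖fibreSum p q T g N‖ₑ ^ 2 ≤ 4 * ∑ Q ∈ T, ‖g Q‖ₑ ^ 2 := by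
  rw [← Finset.sum_fiberwise_of_maps_to (s := T) (fun R hR => Finset.mem_image_of_mem (par₂ p q) hR)
    fun Q => ‖g Q‖ₑ ^ 2, Finset.mul_sum]
  exact Finset.sum_le_sum fun N _ => enorm_fibreSum_sq_le p q T g N

end DyadicRect

namespace DyadicInterval

/-! ### The five terms of the kernel -/

/-- Whether the coefficient part of a term of the kernel sums over strict ancestors. -/
def termA : Fin 5 → Bool := ![false, false, true, true, false]

/-- Whether the coefficient part of a term involves parents. -/
def termP : Fin 5 → Bool := ![false, false, false, true, true]

/-- Whether the test part of a term involves parents. -/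
def termQ : Fin 5 → Bool := ![true, true, true, false, false]

/-- The sign in the test part of a term. -/
noncomputable def termSgn (i : Fin 5) (Q : DyadicInterval) : ℝ := ![Q.sgn, 1, Q.sgn, 1, 1] i

/-- The coefficient part of a term of the kernel. -/
noncomputable def coefPart (i : Fin 5) (K I : DyadicInterval) : ℝ :=
  ![if I = K then 1 else 0, if I = K then 1 else 0, meanHaar K I,
    meanHaar K I.left - meanHaar K I.right, if I = K.parent then 1 else 0] i

/-- The function against which the test part of a term is integrated. -/
noncomputable def testFun (i : Fin 5) (K : DyadicInterval) (x : ℝ) : ℝ :=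
  ![K.nind x, -K.amp * K.haar x, K.haar x, K.haar x, -K.sgn * K.nind x] i

/-- The test part of a term of the kernel. -/
noncomputable def testPart (i : Fin 5) (K M : DyadicInterval) : ℝ :=
  ∫ x, testFun i K x * M.haar x

theorem testPart_eq (i : Fin 5) (K M : DyadicInterval) :
    testPart i K M = ![meanHaar K M, -K.amp * if K = M then 1 else 0, if K = M then 1 else 0,
      if K = M then 1 else 0, -K.sgn * meanHaar K M] i := by
  fin_cases i
  · exact integral_nind_mul_haar K M
  · simp only [testPart, testFun, Fin.mk_one, Matrix.cons_val_one, Matrix.cons_val_zero, mul_assoc]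
    rw [integral_const_mul, integral_haar_mul_haar]
  · exact integral_haar_mul_haar K M
  · exact integral_haar_mul_haar K M
  · simp only [testPart, testFun, Matrix.cons_val, mul_assoc, Fin.reduceFinMk]
    rw [integral_const_mul, integral_nind_mul_haar]

theorem kernel_eq_sum (K I Q : DyadicInterval) :
    kernel K I Q = ∑ i, coefPart i K I * (termSgn i Q * testPart i K (par (termQ i) Q)) := by
  have e1 : (if Q = K then (1 : ℝ) else 0) = if K = Q then 1 else 0 := if_congr eq_comm rfl rfl
  have e2 : (if Q.parent = K then (1 : ℝ) else 0) = if K = Q.parent then 1 else 0 :=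
    if_congr eq_comm rfl rfl
  rw [kernel_eq, e1, e2, Fin.sum_univ_five]
  simp only [testPart_eq, coefPart, termSgn, termQ, par, Matrix.cons_val, if_true,
    Bool.false_eq_true, if_false]
  ring

theorem abs_termSgn (i : Fin 5) (Q : DyadicInterval) : |termSgn i Q| = 1 := by
  fin_cases i <;> simp [termSgn, abs_sgn]

theorem measurable_nind (K : DyadicInterval) : Measurable K.nind :=
  measurable_const.indicator K.measurableSet_toSet

theorem measurable_testFun (i : Fin 5) (K : DyadicInterval) : Measurable (testFun i K) := by
  fin_cases i
  · exact K.measurable_nind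
  · exact K.measurable_haar.const_mul _
  · exact K.measurable_haar
  · exact K.measurable_haar
  · exact K.measurable_nind.const_mul _

/-- In the terms without ancestors, pairing with the test function is dominated by a mean over `K`.
In the others the test function is `h_K` itself, so the pairing selects one Haar coefficient. -/
theorem abs_testFun_le {i : Fin 5} (hi : termA i = false) (K : DyadicInterval) (x : ℝ) :
    |testFun i K x| ≤ K.nind x := by
  have h0 : 0 ≤ K.nind x := indicator_nonneg (fun _ _ => (inv_pos.2 K.length_pos).le) x
  have h2 : |-K.amp * K.haar x| = K.nind x := by
    rw [abs_mul, abs_neg, abs_of_pos K.amp_pos, abs_haar, nind]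
    by_cases h : x ∈ K.toSet
    · simp [h, ← sq, amp_sq]
    · simp [h]
  have h4 : |-K.sgn * K.nind x| = K.nind x := by
    rw [abs_mul, abs_neg, abs_sgn, one_mul, abs_of_nonneg h0]
  fin_cases i
  · exact (abs_of_nonneg h0).le
  · exact h2.le
  · exact absurd hi (by decide)
  · exact absurd hi (by decide)
  · exact h4.le

theorem integrable_testFun_mul (i : Fin 5) (K M : DyadicInterval) :
    Integrable fun x => testFun i K x * M.haar x := by
  obtain ⟨C, hC⟩ : ∃ C, ∀ x, |testFun i K x| ≤ C := by
    have h0 : ∀ x, |K.nind x| ≤ K.length⁻¹ := fun x => by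
      have hl := (inv_pos.2 K.length_pos).le
      rw [nind, abs_of_nonneg (indicator_nonneg (fun _ _ => hl) x)]
      exact indicator_le_self' (fun _ _ => hl) x
    have h1 : ∀ x, |K.haar x| ≤ K.amp := fun x => by
      rw [abs_haar]; exact indicator_le_self' (fun _ _ => K.amp_pos.le) x
    fin_cases i
    · exact ⟨_, h0⟩
    · refine ⟨K.amp * K.amp, fun x => ?_⟩
      change |-K.amp * K.haar x| ≤ _
      rw [abs_mul, abs_neg, abs_of_pos K.amp_pos]
      exact mul_le_mul_of_nonneg_left (h1 x) K.amp_pos.le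
    · exact ⟨_, h1⟩
    · exact ⟨_, h1⟩
    · refine ⟨K.length⁻¹, fun x => ?_⟩
      change |-K.sgn * K.nind x| ≤ _
      rw [abs_mul, abs_neg, abs_sgn, one_mul]
      exact h0 x
  exact M.integrable_haar.bdd_mul (c := C) (measurable_testFun i K).aestronglyMeasurable
    (Filter.Eventually.of_forall hC)

theorem testPart_of_termA {i : Fin 5} (hi : termA i = true) (K M : DyadicInterval) :
    testPart i K M = if K = M then 1 else 0 := by
  rw [testPart_eq]
  fin_cases i
  · exact absurd hi (by decide)
  · exact absurd hi (by decide)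
  · rfl
  · rfl
  · exact absurd hi (by decide)

theorem subset_of_meanHaar_ne_zero {K M : DyadicInterval} (h : meanHaar K M ≠ 0) :
    K.toSet ⊆ M.toSet := by
  have h1 : ‖meanHaar K M‖ₑ ≠ 0 := enorm_ne_zero.2 h
  rw [enorm_meanHaar] at h1
  split_ifs at h1 with h2
  · exact subset_of_mem h2.2 K.base_mem h2.1.le
  · exact absurd rfl h1

theorem subset_of_testPart_ne_zero {i : Fin 5} {K M : DyadicInterval} (h : testPart i K M ≠ 0) :
    K.toSet ⊆ M.toSet := by
  rw [testPart_eq] at h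
  have hite : ∀ c : ℝ, c * (if K = M then 1 else 0) ≠ 0 → K.toSet ⊆ M.toSet := fun c hc => by
    by_cases e : K = M
    · rw [e]
    · simp [e] at hc
  fin_cases i
  · exact subset_of_meanHaar_ne_zero h
  · exact hite _ h
  · exact hite 1 (by simpa using h)
  · exact hite 1 (by simpa using h)
  · exact subset_of_meanHaar_ne_zero (right_ne_zero_of_mul h)

theorem tsum_ite_eq_mul (K : DyadicInterval) (F : DyadicInterval → ℝ≥0∞) :
    ∑' I, ‖(if I = K then 1 else 0 : ℝ)‖ₑ * F I = F K := by
  rw [tsum_eq_single K fun I hI => by simp [hI]]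
  simp

theorem tsum_coefPart_le (i : Fin 5) (K : DyadicInterval) (F : DyadicInterval → ℝ≥0∞) :
    ∑' I, ‖coefPart i K I‖ₑ * F I ≤
      if termA i then ∑' I, ‖meanHaar K I‖ₑ * F (par (termP i) I) else F (par (termP i) K) := by
  fin_cases i
  · exact (tsum_ite_eq_mul K F).le
  · exact (tsum_ite_eq_mul K F).le
  · exact le_rfl
  -- The fourth term takes means of the Haar functions of both halves of `I`. No interval is both a
  -- left and a right half, so the sum is reindexed by the halves, with `F` evaluated at the parent.
  · change ∑' I, ‖meanHaar K I.left - meanHaar K I.right‖ₑ * F I ≤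
      ∑' I, ‖meanHaar K I‖ₑ * F (par true I)
    set u : DyadicInterval → ℝ≥0∞ := fun I => ‖meanHaar K I‖ₑ * F (par true I)
    have h1 : ∀ I : DyadicInterval, ‖meanHaar K I.left - meanHaar K I.right‖ₑ * F I ≤
        u I.left + u I.right := fun I => by
      simp only [u, par, if_true, parent_left, parent_right]
      rw [← add_mul]
      exact mul_le_mul_left (enorm_sub_le) _
    refine (ENNReal.tsum_le_tsum h1).trans ?_
    rw [ENNReal.tsum_add, ← tsum_range u left_injective, ← tsum_range u right_injective,
      tsum_subtype, tsum_subtype, ← ENNReal.tsum_add]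
    refine ENNReal.tsum_le_tsum fun I => ?_
    by_cases hl : I ∈ range left
    · have hr : I ∉ range right := by
        rintro ⟨J, rfl⟩
        obtain ⟨J', h⟩ := hl
        exact right_ne_left J J' h.symm
      rw [indicator_of_mem hl, indicator_of_notMem hr, add_zero]
    · rw [indicator_of_notMem hl, zero_add]
      exact indicator_le_self _ _ I
  · exact (tsum_ite_eq_mul K.parent F).le

theorem nind_eq (K : DyadicInterval) (x : ℝ) :
    ENNReal.ofReal (K.nind x) = K.toSet.indicator (fun _ => (volume K.toSet)⁻¹) x := by
  by_cases h : x ∈ K.toSet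
  · rw [nind, indicator_of_mem h, indicator_of_mem h, volume_toSet, ENNReal.ofReal_inv_of_pos K.length_pos]
  · rw [nind, indicator_of_notMem h, indicator_of_notMem h, ENNReal.ofReal_zero]

theorem enorm_testFun_le {i : Fin 5} (hi : termA i = false) (K : DyadicInterval) (x : ℝ) :
    ‖testFun i K x‖ₑ ≤ K.toSet.indicator (fun _ => (volume K.toSet)⁻¹) x := by
  rw [← nind_eq, ← ofReal_norm]
  exact ENNReal.ofReal_le_ofReal (abs_testFun_le hi K x)

theorem lintegral_indicator_mul_eq_avg (K : DyadicInterval) (g : ℝ → ℝ≥0∞) :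
    ∫⁻ x, K.toSet.indicator (fun _ => (volume K.toSet)⁻¹) x * g x = K.avg g := by
  have h : ∀ x, K.toSet.indicator (fun _ => (volume K.toSet)⁻¹) x * g x =
      K.toSet.indicator (fun x => (volume K.toSet)⁻¹ * g x) x := fun x => by
    by_cases h : x ∈ K.toSet <;> simp [h]
  simp only [h]
  rw [lintegral_indicator K.measurableSet_toSet, lintegral_const_mul' _ _
    (ENNReal.inv_ne_top.2 K.volume_ne_zero), avg]

end DyadicInterval

namespace DyadicInterval

theorem tsum_coefPart_le_ancs (i : Fin 5) {K : DyadicInterval} (hK : K.toSet ⊆ unit.toSet)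
    (hg : 0 ≤ K.gen) {F : DyadicInterval → ℝ≥0∞} (hF : Decays F) :
    ∑' I, ‖coefPart i K I‖ₑ * F I ≤
      if termA i then 2 * ∑ I ∈ ancs K, F (par (termP i) I) * eamp I else F (par (termP i) K) := by
  refine (tsum_coefPart_le i K F).trans ?_
  split_ifs
  · exact tsum_meanHaar_le hK hg (hF.par _)
  · exact le_rfl

theorem integral_testFun_mul_sum {ι : Type*} (j : Fin 5) (K : DyadicInterval) (s : Finset ι)
    (D : ι → ℂ) (e : ι → DyadicInterval) :
    ∫ x, (testFun j K x : ℂ) * ∑ N ∈ s, D N * ((e N).haar x : ℂ) =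
      ∑ N ∈ s, D N * (testPart j K (e N) : ℂ) := by
  simp only [Finset.mul_sum]
  have h : ∀ N x, (testFun j K x : ℂ) * (D N * ((e N).haar x : ℂ)) =
      D N * ((testFun j K x * (e N).haar x : ℝ) : ℂ) := fun N x => by push_cast; ring
  simp only [h]
  rw [integral_finsetSum _ fun N _ => ((integrable_testFun_mul j K (e N)).ofReal).const_mul _]
  refine Finset.sum_congr rfl fun N _ => ?_
  rw [integral_const_mul, integral_complex_ofReal, testPart]

theorem enorm_sum_testPart_le {ι : Type*} {j : Fin 5} (hj : termA j = false) (K : DyadicInterval)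
    (s : Finset ι) (D : ι → ℂ) (e : ι → DyadicInterval) :
    ‖∑ N ∈ s, D N * (testPart j K (e N) : ℂ)‖ₑ ≤
      K.avg fun x => ‖∑ N ∈ s, D N * ((e N).haar x : ℂ)‖ₑ := by
  rw [← integral_testFun_mul_sum, ← lintegral_indicator_mul_eq_avg]
  refine (enorm_integral_le_lintegral_enorm _).trans (lintegral_mono fun x => ?_)
  rw [enorm_mul]
  refine mul_le_mul_left (le_trans (le_of_eq ?_) (enorm_testFun_le hj K x)) _
  rw [← ofReal_norm, ← ofReal_norm, Complex.norm_real]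

theorem enorm_haar_le (I : DyadicInterval) (x : ℝ) : ‖(I.haar x : ℂ)‖ₑ ≤ eamp I := by
  rw [← ofReal_norm, Complex.norm_real, Real.norm_eq_abs, abs_haar]
  exact ENNReal.ofReal_le_ofReal (indicator_le_self' (fun _ _ => I.amp_pos.le) x)

theorem lintegral_enorm_haar_sq (I : DyadicInterval) : ∫⁻ x, ‖(I.haar x : ℂ)‖ₑ ^ 2 = 1 := by
  have h : ∀ x, ‖(I.haar x : ℂ)‖ₑ ^ 2 = I.toSet.indicator (fun _ => eamp I ^ 2) x := fun x => by
    rw [← ofReal_norm, Complex.norm_real, Real.norm_eq_abs, abs_haar]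
    by_cases hx : x ∈ I.toSet <;> simp [hx, eamp]
  simp only [h]
  rw [lintegral_indicator_const I.measurableSet_toSet, eamp_sq_mul_volume]

theorem avg_ne_top (L : DyadicInterval) {f : ℝ → ℝ≥0∞} {C : ℝ≥0∞} (hC : C ≠ ⊤) (hf : ∀ x, f x ≤ C) :
    L.avg f ≠ ⊤ := by
  refine ne_top_of_le_ne_top hC ((avg_mono fun x _ => hf x).trans_eq (avg_const L C))

end DyadicInterval

/-! ### Estimates for the 25 pairs of kernel terms. -/

namespace DyadicRect

open DyadicInterval

/-- The coefficient part of a pair of terms of the product kernel. -/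
noncomputable def pairCoef (i j : Fin 5) (f : DyadicRect → ℝ≥0∞) (R : DyadicRect) : ℝ≥0∞ :=
  ∑' N : DyadicRect, ‖coefPart i R.1 N.1‖ₑ * ‖coefPart j R.2 N.2‖ₑ * f N

/-- The test part of a pair of terms of the product kernel. -/
noncomputable def pairTest (i j : Fin 5) (T : Finset DyadicRect) (D : DyadicRect → ℂ)
    (R : DyadicRect) : ℂ :=
  ∑ N ∈ T, D N * ((testPart i R.1 N.1 : ℂ) * (testPart j R.2 N.2 : ℂ))

/-- A rectangle in the unit square. -/
def IsUnit (R : DyadicRect) : Prop :=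
  (R.1.toSet ⊆ unit.toSet ∧ 0 ≤ R.1.gen) ∧ (R.2.toSet ⊆ unit.toSet ∧ 0 ≤ R.2.gen)

theorem pairCoef_eq (i j : Fin 5) (f : DyadicRect → ℝ≥0∞) (R : DyadicRect) :
    pairCoef i j f R = ∑' I, ‖coefPart i R.1 I‖ₑ * ∑' J, ‖coefPart j R.2 J‖ₑ * f (I, J) := by
  rw [pairCoef, ENNReal.tsum_prod (f := fun I J => ‖coefPart i R.1 I‖ₑ * ‖coefPart j R.2 J‖ₑ * f (I, J))]
  simp only [mul_assoc, ENNReal.tsum_mul_left]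

theorem pairCoef_le_of_local_local {i j : Fin 5} (hi : termA i = false) (hj : termA j = false)
    {f : DyadicRect → ℝ≥0∞} (hf1 : ∀ J, Decays fun I => f (I, J)) (hf2 : ∀ I, Decays fun J => f (I, J))
    {R : DyadicRect} (hR : R.IsUnit) : pairCoef i j f R ≤ f (par₂ (termP i) (termP j) R) := by
  rw [pairCoef_eq]
  have h1 := fun I => tsum_coefPart_le_ancs j hR.2.1 hR.2.2 (hf2 I)
  have h2 := fun J => tsum_coefPart_le_ancs i hR.1.1 hR.1.2 (hf1 J)
  simp only [hi, hj, if_false, Bool.false_eq_true] at h1 h2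
  exact (ENNReal.tsum_le_tsum fun I => mul_le_mul_right (h1 I) _).trans (h2 _)

theorem pairCoef_le_of_anc_local {i j : Fin 5} (hi : termA i = true) (hj : termA j = false)
    {f : DyadicRect → ℝ≥0∞} (hf1 : ∀ J, Decays fun I => f (I, J)) (hf2 : ∀ I, Decays fun J => f (I, J))
    {R : DyadicRect} (hR : R.IsUnit) : pairCoef i j f R ≤
      2 * ancSum₁ (fun N => f (par₂ (termP i) (termP j) N) * eamp N.1) R := by
  rw [pairCoef_eq]
  have h1 := fun I => tsum_coefPart_le_ancs j hR.2.1 hR.2.2 (hf2 I)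
  have h2 := fun J => tsum_coefPart_le_ancs i hR.1.1 hR.1.2 (hf1 J)
  simp only [hi, hj, if_false, if_true, Bool.false_eq_true] at h1 h2
  exact (ENNReal.tsum_le_tsum fun I => mul_le_mul_right (h1 I) _).trans (h2 _)

theorem pairCoef_le_of_local_anc {i j : Fin 5} (hi : termA i = false) (hj : termA j = true)
    {f : DyadicRect → ℝ≥0∞} (hf1 : ∀ J, Decays fun I => f (I, J)) (hf2 : ∀ I, Decays fun J => f (I, J))
    {R : DyadicRect} (hR : R.IsUnit) : pairCoef i j f R ≤
      2 * ancSum₃ (fun N => f (par₂ (termP i) (termP j) N) * eamp N.2) R := by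
  rw [pairCoef_eq]
  have h1 := fun I => tsum_coefPart_le_ancs j hR.2.1 hR.2.2 (hf2 I)
  have h2 := tsum_coefPart_le_ancs i hR.1.1 hR.1.2 (F := fun I => ∑ J ∈ ancs R.2,
    f (I, par (termP j) J) * eamp J) (Decays.sum fun J _ => hf1 _)
  simp only [hi, hj, if_false, if_true, Bool.false_eq_true] at h1 h2
  refine (ENNReal.tsum_le_tsum fun I => mul_le_mul_right (h1 I) _).trans ?_
  simp only [mul_left_comm _ (2 : ℝ≥0∞), ENNReal.tsum_mul_left]
  exact mul_le_mul_right h2 _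

theorem pairCoef_le_of_anc_anc {i j : Fin 5} (hi : termA i = true) (hj : termA j = true)
    {f : DyadicRect → ℝ≥0∞} (hf1 : ∀ J, Decays fun I => f (I, J)) (hf2 : ∀ I, Decays fun J => f (I, J))
    {R : DyadicRect} (hR : R.IsUnit) : pairCoef i j f R ≤
      4 * ancSum₂ (fun N => f (par₂ (termP i) (termP j) N) * eamp N.1 * eamp N.2) R := by
  rw [pairCoef_eq]
  have h1 := fun I => tsum_coefPart_le_ancs j hR.2.1 hR.2.2 (hf2 I)
  have h2 := tsum_coefPart_le_ancs i hR.1.1 hR.1.2 (F := fun I => ∑ J ∈ ancs R.2,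
    f (I, par (termP j) J) * eamp J) (Decays.sum fun J _ => hf1 _)
  simp only [hi, hj, if_true] at h1 h2
  refine (ENNReal.tsum_le_tsum fun I => mul_le_mul_right (h1 I) _).trans ?_
  simp only [mul_left_comm _ (2 : ℝ≥0∞), ENNReal.tsum_mul_left]
  refine (mul_le_mul_right h2 _).trans_eq ?_
  rw [← mul_assoc, ancSum₂]
  congr 1
  · norm_num
  · refine Finset.sum_congr rfl fun I _ => ?_
    rw [Finset.sum_mul]
    exact Finset.sum_congr rfl fun J _ => by rw [mul_right_comm]; rfl

/-- The squared height of the Haar function cancels the length, which turns the BMO condition on `f`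
into the form required for ancestor sums. -/
theorem isCarleson_fst {f : DyadicRect → ℝ≥0∞} {B : ℝ≥0∞} (h : IsCarleson (fun R => f R ^ 2) B)
    (p q : Bool) :
    IsCarleson (fun N => (f (par₂ p q N) * eamp N.1) ^ 2 * volume N.1.toSet) (4096 * B) := by
  have := h.comp_par₂ p q
  simpa only [mul_pow, mul_assoc, eamp_sq_mul_volume, mul_one] using this

theorem isCarleson_snd {f : DyadicRect → ℝ≥0∞} {B : ℝ≥0∞} (h : IsCarleson (fun R => f R ^ 2) B)
    (p q : Bool) :
    IsCarleson (fun N => (f (par₂ p q N) * eamp N.2) ^ 2 * volume N.2.toSet) (4096 * B) := by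
  have := h.comp_par₂ p q
  simpa only [mul_pow, mul_assoc, eamp_sq_mul_volume, mul_one] using this

theorem isCarleson_both {f : DyadicRect → ℝ≥0∞} {B : ℝ≥0∞} (h : IsCarleson (fun R => f R ^ 2) B)
    (p q : Bool) : IsCarleson (fun N => (f (par₂ p q N) * eamp N.1 * eamp N.2) ^ 2 *
      volume N.toSet) (4096 * B) := by
  have := h.comp_par₂ p q
  convert this using 2 with N
  rw [volume_toSet, mul_pow, mul_pow, mul_mul_mul_comm, mul_assoc (_ ^ 2), eamp_sq_mul_volume,
    eamp_sq_mul_volume, mul_one, mul_one]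

theorem integral_testFun_mul_haarSum (i j : Fin 5) (T : Finset DyadicRect) (D : DyadicRect → ℂ)
    (R : DyadicRect) :
    ∫ z : ℝ × ℝ, ((testFun i R.1 z.1 * testFun j R.2 z.2 : ℝ) : ℂ) * haarSum T D z =
      pairTest i j T D R := by
  have h : ∀ z : ℝ × ℝ, ((testFun i R.1 z.1 * testFun j R.2 z.2 : ℝ) : ℂ) * haarSum T D z =
      ∑ N ∈ T, D N * (((testFun i R.1 z.1 * N.1.haar z.1 : ℝ) : ℂ) *
        ((testFun j R.2 z.2 * N.2.haar z.2 : ℝ) : ℂ)) := fun z => by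
    rw [haarSum, Finset.mul_sum]
    refine Finset.sum_congr rfl fun N _ => ?_
    rw [haar]; push_cast; ring
  simp only [h]
  rw [integral_finsetSum _ fun N _ => ((integrable_testFun_mul i R.1 N.1).ofReal.mul_prod
    (integrable_testFun_mul j R.2 N.2).ofReal).const_mul _]
  refine Finset.sum_congr rfl fun N _ => ?_
  rw [integral_const_mul, Measure.volume_eq_prod,
    integral_prod_mul (fun s => ((testFun i R.1 s * N.1.haar s : ℝ) : ℂ))
      (fun t => ((testFun j R.2 t * N.2.haar t : ℝ) : ℂ)),
    integral_complex_ofReal, integral_complex_ofReal]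
  rfl

theorem enorm_pairTest_le_of_local_local {i j : Fin 5} (hi : termA i = false) (hj : termA j = false)
    (T : Finset DyadicRect) (D : DyadicRect → ℂ) (R : DyadicRect) :
    ‖pairTest i j T D R‖ₑ ≤ R.avg fun z => ‖haarSum T D z‖ₑ := by
  have h2 : ∀ z : ℝ × ℝ, R.1.toSet.indicator (fun _ => (volume R.1.toSet)⁻¹) z.1 *
      R.2.toSet.indicator (fun _ => (volume R.2.toSet)⁻¹) z.2 * ‖haarSum T D z‖ₑ =
      R.toSet.indicator (fun z => (volume R.toSet)⁻¹ * ‖haarSum T D z‖ₑ) z := fun z => by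
    rw [volume_toSet, ENNReal.mul_inv (Or.inl R.1.volume_ne_zero) (Or.inl R.1.volume_ne_top)]
    by_cases h1 : z.1 ∈ R.1.toSet <;> by_cases h2 : z.2 ∈ R.2.toSet <;>
      simp [h1, h2, toSet, indicator, mem_prod]
  have h3 : R.avg (fun z => ‖haarSum T D z‖ₑ) =
      ∫⁻ z, R.toSet.indicator (fun z => (volume R.toSet)⁻¹ * ‖haarSum T D z‖ₑ) z := by
    rw [lintegral_indicator R.measurableSet_toSet, lintegral_const_mul' _ _
      (ENNReal.inv_ne_top.2 R.volume_ne_zero), avg]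
  rw [← integral_testFun_mul_haarSum, h3]
  refine (enorm_integral_le_lintegral_enorm _).trans (lintegral_mono fun z => ?_)
  rw [enorm_mul, ← h2]
  refine mul_le_mul_left ?_ _
  rw [← ofReal_norm, Complex.norm_real, ofReal_norm, enorm_mul]
  exact mul_le_mul' (enorm_testFun_le hi R.1 _) (enorm_testFun_le hj R.2 _)

theorem lintegral_enorm_haarSum_sq (T : Finset DyadicRect) (D : DyadicRect → ℂ) :
    ∫⁻ z, ‖haarSum T D z‖ₑ ^ 2 = ∑ N ∈ T, ‖D N‖ₑ ^ 2 := by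
  set f : L2Plane := ∑ N ∈ T, D N • haarL2 N with hf
  have h1 : f =ᵐ[volume] haarSum T D := by
    have h0 : ∀ᵐ z, ∀ N, haarL2 N z = N.haar z := ae_all_iff.2 haarL2_ae
    have h0' : ∀ᵐ z, ∀ N, (D N • haarL2 N : L2Plane) z = D N • haarL2 N z :=
      ae_all_iff.2 fun N => Lp.coeFn_smul _ _
    filter_upwards [Lp.coeFn_finsetSum T fun N => D N • haarL2 N, h0, h0'] with z h2 h3 h4
    rw [hf, h2, haarSum, Finset.sum_apply]
    refine Finset.sum_congr rfl fun N _ => ?_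
    rw [h4, h3, smul_eq_mul]
  have h2 : ‖f‖ ^ 2 = ∑ N ∈ T, ‖D N‖ ^ 2 := by
    have h := orthonormal_haarL2.inner_sum D D T
    rw [← hf, inner_self_eq_norm_sq_to_K] at h
    simp only [Complex.conj_mul'] at h
    have h' : ((‖f‖ ^ 2 : ℝ) : ℂ) = ((∑ N ∈ T, ‖D N‖ ^ 2 : ℝ) : ℂ) := by
      push_cast
      exact h
    exact Complex.ofReal_injective h'
  have h3 : ∫⁻ z, ‖haarSum T D z‖ₑ ^ 2 = ‖f‖ₑ ^ 2 := by
    rw [Lp.enorm_def, eLpNorm_congr_ae h1]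
    rw [eLpNorm_eq_lintegral_rpow_enorm_toReal two_ne_zero ENNReal.ofNat_ne_top,
      ← ENNReal.rpow_natCast, ← ENNReal.rpow_mul]
    norm_num
  rw [h3, ← ofReal_norm, ← ENNReal.ofReal_pow (norm_nonneg _), h2,
    ENNReal.ofReal_sum_of_nonneg fun _ _ => by positivity]
  refine Finset.sum_congr rfl fun N _ => ?_
  rw [ENNReal.ofReal_pow (norm_nonneg _), ofReal_norm]

/-- The part of a Haar sum with a given first factor, as a function of the second variable. -/
noncomputable def rowSum (T : Finset DyadicRect) (D : DyadicRect → ℂ) (K : DyadicInterval) (t : ℝ) : ℂ :=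
  ∑ N ∈ T with N.1 = K, D N * (N.2.haar t : ℂ)

/-- The part of a Haar sum with a given second factor, as a function of the first variable. -/
noncomputable def colSum (T : Finset DyadicRect) (D : DyadicRect → ℂ) (K : DyadicInterval) (s : ℝ) : ℂ :=
  ∑ N ∈ T with N.2 = K, D N * (N.1.haar s : ℂ)

theorem measurable_rowSum (T : Finset DyadicRect) (D : DyadicRect → ℂ) (K : DyadicInterval) :
    Measurable (rowSum T D K) :=
  Finset.measurable_fun_sum _ fun N _ =>
    (Complex.measurable_ofReal.comp N.2.measurable_haar).const_mul _

theorem measurable_colSum (T : Finset DyadicRect) (D : DyadicRect → ℂ) (K : DyadicInterval) :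
    Measurable (colSum T D K) :=
  Finset.measurable_fun_sum _ fun N _ =>
    (Complex.measurable_ofReal.comp N.1.measurable_haar).const_mul _

/-- Multiplication by the unit vector `h_K` in the other variable reduces this to orthonormality in
the plane. -/
theorem lintegral_enorm_rowSum_sq (T : Finset DyadicRect) (D : DyadicRect → ℂ) (K : DyadicInterval) :
    ∫⁻ t, ‖rowSum T D K t‖ₑ ^ 2 = ∑ N ∈ T with N.1 = K, ‖D N‖ₑ ^ 2 := by
  have h : ∀ z : ℝ × ℝ, ‖haarSum (T.filter fun N => N.1 = K) D z‖ₑ ^ 2 =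
      ‖(K.haar z.1 : ℂ)‖ₑ ^ 2 * ‖rowSum T D K z.2‖ₑ ^ 2 := fun z => by
    rw [← mul_pow, ← enorm_mul, haarSum, rowSum, Finset.mul_sum]
    congr 2
    refine Finset.sum_congr rfl fun N hN => ?_
    rw [haar, (Finset.mem_filter.1 hN).2]; push_cast; ring
  have h1 := lintegral_enorm_haarSum_sq (T.filter fun N => N.1 = K) D
  have hm : Measurable fun x => (K.haar x : ℂ) := Complex.measurable_ofReal.comp K.measurable_haar
  simp only [h] at h1
  rw [Measure.volume_eq_prod, lintegral_prod_mul
    (hm.enorm.pow_const 2).aemeasurable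
    ((measurable_rowSum T D K).enorm.pow_const 2).aemeasurable, lintegral_enorm_haar_sq, one_mul] at h1
  exact h1

theorem lintegral_enorm_colSum_sq (T : Finset DyadicRect) (D : DyadicRect → ℂ) (K : DyadicInterval) :
    ∫⁻ t, ‖colSum T D K t‖ₑ ^ 2 = ∑ N ∈ T with N.2 = K, ‖D N‖ₑ ^ 2 := by
  have h : ∀ z : ℝ × ℝ, ‖haarSum (T.filter fun N => N.2 = K) D z‖ₑ ^ 2 =
      ‖colSum T D K z.1‖ₑ ^ 2 * ‖(K.haar z.2 : ℂ)‖ₑ ^ 2 := fun z => by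
    rw [← mul_pow, ← enorm_mul, haarSum, colSum, Finset.sum_mul]
    congr 2
    refine Finset.sum_congr rfl fun N hN => ?_
    rw [haar, (Finset.mem_filter.1 hN).2]; push_cast; ring
  have h1 := lintegral_enorm_haarSum_sq (T.filter fun N => N.2 = K) D
  have hm : Measurable fun x => (K.haar x : ℂ) := Complex.measurable_ofReal.comp K.measurable_haar
  simp only [h] at h1
  rw [Measure.volume_eq_prod, lintegral_prod_mul
    ((measurable_colSum T D K).enorm.pow_const 2).aemeasurable
    (hm.enorm.pow_const 2).aemeasurable,
    lintegral_enorm_haar_sq, mul_one] at h1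
  exact h1

theorem sum_sum_filter_le {ι κ : Type*} [DecidableEq κ] (S : Finset κ) (T : Finset ι) (e : ι → κ)
    (F : ι → ℝ≥0∞) : ∑ K ∈ S, ∑ N ∈ T with e N = K, F N ≤ ∑ N ∈ T, F N := by
  simp only [Finset.sum_filter]
  rw [Finset.sum_comm]
  refine Finset.sum_le_sum fun N _ => ?_
  rw [Finset.sum_ite_eq]
  split_ifs
  · exact le_rfl
  · exact bot_le

theorem enorm_pairTest_le_of_anc_local {i j : Fin 5} (hi : termA i = true) (hj : termA j = false)
    (T : Finset DyadicRect) (D : DyadicRect → ℂ) (R : DyadicRect) :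
    ‖pairTest i j T D R‖ₑ ≤ R.2.avg fun t => ‖rowSum T D R.1 t‖ₑ := by
  have e : pairTest i j T D R = ∑ N ∈ T with N.1 = R.1, D N * (testPart j R.2 N.2 : ℂ) := by
    rw [Finset.sum_filter, pairTest]
    refine Finset.sum_congr rfl fun N _ => ?_
    rw [testPart_of_termA hi]
    by_cases h : N.1 = R.1
    · simp [h]
    · simp [h, Ne.symm h]
  rw [e]
  exact enorm_sum_testPart_le hj R.2 _ D Prod.snd

theorem enorm_pairTest_le_of_local_anc {i j : Fin 5} (hi : termA i = false) (hj : termA j = true)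
    (T : Finset DyadicRect) (D : DyadicRect → ℂ) (R : DyadicRect) :
    ‖pairTest i j T D R‖ₑ ≤ R.1.avg fun t => ‖colSum T D R.2 t‖ₑ := by
  have e : pairTest i j T D R = ∑ N ∈ T with N.2 = R.2, D N * (testPart i R.1 N.1 : ℂ) := by
    rw [Finset.sum_filter, pairTest]
    refine Finset.sum_congr rfl fun N _ => ?_
    rw [testPart_of_termA hj]
    by_cases h : N.2 = R.2
    · simp [h]
    · simp [h, Ne.symm h]
  rw [e]
  exact enorm_sum_testPart_le hi R.1 _ D Prod.fst

/-- Both test functions are Haar functions, so the test part at `R` is just the coefficient `D R`,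
or 0 if `R ∉ T`. -/
theorem sum_enorm_pairTest_sq_le_of_anc_anc {i j : Fin 5} (hi : termA i = true) (hj : termA j = true)
    (S T : Finset DyadicRect) (D : DyadicRect → ℂ) :
    ∑ R ∈ S, ‖pairTest i j T D R‖ₑ ^ 2 ≤ ∑ N ∈ T, ‖D N‖ₑ ^ 2 := by
  refine le_trans (le_of_eq (Finset.sum_congr rfl fun R _ => ?_))
    (sum_sum_filter_le S T id fun N => ‖D N‖ₑ ^ 2)
  have h : pairTest i j T D R = if R ∈ T then D R else 0 := by
    rw [pairTest, ← Finset.sum_ite_eq' T R D]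
    refine Finset.sum_congr rfl fun N _ => ?_
    rw [testPart_of_termA hi, testPart_of_termA hj]
    by_cases h1 : R.1 = N.1 <;> by_cases h2 : R.2 = N.2 <;> simp [h1, h2, Prod.ext_iff, eq_comm]
  rw [h, Finset.sum_filter]
  simp only [id]
  rw [Finset.sum_ite_eq']
  split_ifs <;> simp

/-- The four cases are local or ancestor type in each variable. The largest constant occurs in the
mixed cases: `4 · 65536 · 4096 = 2 ^ 30`. -/
theorem sq_sum_pair_le (i j : Fin 5) {φ f : DyadicRect → ℝ≥0∞} {A B : ℝ≥0∞}
    (hφ : IsLogCarleson (fun R => φ R ^ 2) A) (hf : IsCarleson (fun R => f R ^ 2) B)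
    (hft : ∀ R, f R ≠ ⊤) (hf1 : ∀ J, Decays fun I => f (I, J)) (hf2 : ∀ I, Decays fun J => f (I, J))
    {S : Finset DyadicRect} (hS : ∀ R ∈ S, R.IsUnit) (T : Finset DyadicRect) (D : DyadicRect → ℂ) :
    (∑ R ∈ S, φ R * (pairCoef i j f R * ‖pairTest i j T D R‖ₑ)) ^ 2 ≤
      2 ^ 30 * A * B * volume (⋃ R ∈ S, R.toSet) * ∑ N ∈ T, ‖D N‖ₑ ^ 2 := by
  have hS' : ∀ R ∈ S, 0 ≤ R.1.gen ∧ 0 ≤ R.2.gen := fun R hR => ⟨(hS R hR).1.2, (hS R hR).2.2⟩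
  have hfin : ∀ (s : Finset DyadicRect) (e : DyadicRect → DyadicInterval),
      ∑ N ∈ s, ‖D N‖ₑ * eamp (e N) ≠ ⊤ := fun s e =>
    ENNReal.sum_ne_top.2 fun N _ => ENNReal.mul_ne_top enorm_ne_top (eamp_ne_top _)
  have hrow : ∀ (s : Finset DyadicRect) (e : DyadicRect → DyadicInterval) (t : ℝ),
      ‖∑ N ∈ s, D N * ((e N).haar t : ℂ)‖ₑ ≤ ∑ N ∈ s, ‖D N‖ₑ * eamp (e N) := fun s e t =>
    (enorm_sum_le _ _).trans (Finset.sum_le_sum fun N _ => by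
      rw [enorm_mul]; exact mul_le_mul_right (enorm_haar_le _ _) _)
  set V := volume (⋃ R ∈ S, R.toSet)
  set E := ∑ N ∈ T, ‖D N‖ₑ ^ 2
  cases hi : termA i <;> cases hj : termA j
  · have h := sq_sum_mul_avg_le hφ (hf.comp_par₂ (termP i) (termP j)) hS'
      (measurable_haarSum T D).enorm
    calc _ ≤ (∑ R ∈ S, φ R * (f (par₂ (termP i) (termP j) R) * R.avg fun z => ‖haarSum T D z‖ₑ)) ^ 2 := by
          refine pow_le_pow_left' (Finset.sum_le_sum fun R hR => mul_le_mul_right (mul_le_mul' ?_ ?_) _) 2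
          · exact pairCoef_le_of_local_local hi hj hf1 hf2 (hS R hR)
          · exact enorm_pairTest_le_of_local_local hi hj T D R
      _ ≤ 64 * A * (4096 * B) * V * E := by
          rw [lintegral_enorm_haarSum_sq] at h
          exact h
      _ = 2 ^ 18 * (A * B * V * E) := by ring
      _ ≤ 2 ^ 30 * (A * B * V * E) := by
          refine mul_le_mul_left ?_ _
          exact pow_le_pow_right₀ one_le_two (by norm_num)
      _ = _ := by ring
  · have h := sq_sum_ancSum₃_le hφ (isCarleson_snd hf (termP i) (termP j))
      (fun R => ENNReal.mul_ne_top (hft _) (eamp_ne_top _)) hS'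
      (G := fun K t => ‖colSum T D K t‖ₑ) (fun K => (measurable_colSum T D K).enorm)
      (fun K L => avg_ne_top L (hfin _ _) (hrow _ _))
    simp only [lintegral_enorm_colSum_sq] at h
    calc _ ≤ (∑ R ∈ S, φ R * (2 * ancSum₃ (fun N => f (par₂ (termP i) (termP j) N) * eamp N.2) R *
            R.1.avg fun t => ‖colSum T D R.2 t‖ₑ)) ^ 2 := by
          refine pow_le_pow_left' (Finset.sum_le_sum fun R hR => mul_le_mul_right (mul_le_mul' ?_ ?_) _) 2
          · exact pairCoef_le_of_local_anc hi hj hf1 hf2 (hS R hR)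
          · exact enorm_pairTest_le_of_local_anc hi hj T D R
      _ = 4 * (∑ R ∈ S, φ R * (ancSum₃ (fun N => f (par₂ (termP i) (termP j) N) * eamp N.2) R *
            R.1.avg fun t => ‖colSum T D R.2 t‖ₑ)) ^ 2 := by
          simp only [mul_assoc (2 : ℝ≥0∞), mul_left_comm _ (2 : ℝ≥0∞)]
          rw [← Finset.mul_sum, mul_pow]
          norm_num
      _ ≤ 4 * (65536 * A * (4096 * B) * V * E) :=
          mul_le_mul_right (h.trans (mul_le_mul_right (sum_sum_filter_le _ _ _ _) _)) _
      _ = _ := by ring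
  · have h := sq_sum_ancSum₁_le hφ (isCarleson_fst hf (termP i) (termP j))
      (fun R => ENNReal.mul_ne_top (hft _) (eamp_ne_top _)) hS'
      (G := fun K t => ‖rowSum T D K t‖ₑ) (fun K => (measurable_rowSum T D K).enorm)
      (fun K L => avg_ne_top L (hfin _ _) (hrow _ _))
    simp only [lintegral_enorm_rowSum_sq] at h
    calc _ ≤ (∑ R ∈ S, φ R * (2 * ancSum₁ (fun N => f (par₂ (termP i) (termP j) N) * eamp N.1) R *
            R.2.avg fun t => ‖rowSum T D R.1 t‖ₑ)) ^ 2 := by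
          refine pow_le_pow_left' (Finset.sum_le_sum fun R hR => mul_le_mul_right (mul_le_mul' ?_ ?_) _) 2
          · exact pairCoef_le_of_anc_local hi hj hf1 hf2 (hS R hR)
          · exact enorm_pairTest_le_of_anc_local hi hj T D R
      _ = 4 * (∑ R ∈ S, φ R * (ancSum₁ (fun N => f (par₂ (termP i) (termP j) N) * eamp N.1) R *
            R.2.avg fun t => ‖rowSum T D R.1 t‖ₑ)) ^ 2 := by
          simp only [mul_assoc (2 : ℝ≥0∞), mul_left_comm _ (2 : ℝ≥0∞)]
          rw [← Finset.mul_sum, mul_pow]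
          norm_num
      _ ≤ 4 * (65536 * A * (4096 * B) * V * E) :=
          mul_le_mul_right (h.trans (mul_le_mul_right (sum_sum_filter_le _ _ _ _) _)) _
      _ = _ := by ring
  · set y : DyadicRect → ℝ≥0∞ := fun N => f (par₂ (termP i) (termP j) N) * eamp N.1 * eamp N.2
    have h := sum_mul_sq_ancSum₂_le hφ (isCarleson_both hf (termP i) (termP j)) S
    calc _ ≤ (∑ R ∈ S, φ R * (4 * ancSum₂ y R) * ‖pairTest i j T D R‖ₑ) ^ 2 := by
          refine pow_le_pow_left' (Finset.sum_le_sum fun R hR => ?_) 2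
          rw [← mul_assoc]
          exact mul_le_mul_left (mul_le_mul_right (pairCoef_le_of_anc_anc hi hj hf1 hf2 (hS R hR)) _) _
      _ ≤ (∑ R ∈ S, (φ R * (4 * ancSum₂ y R)) ^ 2) * ∑ R ∈ S, ‖pairTest i j T D R‖ₑ ^ 2 :=
          ENNReal.sq_sum_mul_le _ _ _
      _ = 16 * (∑ R ∈ S, φ R ^ 2 * ancSum₂ y R ^ 2) * ∑ R ∈ S, ‖pairTest i j T D R‖ₑ ^ 2 := by
          rw [Finset.mul_sum S _ (16 : ℝ≥0∞)]
          congr 1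
          exact Finset.sum_congr rfl fun R _ => by ring
      _ ≤ 16 * (4096 * A * (4096 * B) * V) * E :=
          mul_le_mul' (mul_le_mul_right h _) (sum_enorm_pairTest_sq_le_of_anc_anc hi hj S T D)
      _ = 2 ^ 28 * (A * B * V * E) := by ring
      _ ≤ 2 ^ 30 * (A * B * V * E) := by
          refine mul_le_mul_left ?_ _
          exact pow_le_pow_right₀ one_le_two (by norm_num)
      _ = _ := by ring

end DyadicRect

/-! ### Functions supported in the unit square -/

open DyadicInterval (unit cell Decays eamp rootHalf)

/-- The half open unit square as a dyadic rectangle. -/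
def unitRect : DyadicRect := (unit, unit)

theorem ae_mem_unitRect {f : ℝ × ℝ → ℂ} (hf : ∀ᵐ z, z ∉ unitSquare → f z = 0) :
    ∀ᵐ z, z ∉ unitRect.toSet → f z = 0 := by
  have h0 : (unit.toSet : Set ℝ) =ᵐ[volume] Icc (0 : ℝ) 1 := by
    have : unit.toSet = Ico (0 : ℝ) 1 := by
      simp [DyadicInterval.toSet, DyadicInterval.unit, DyadicInterval.length]
    rw [this]
    exact Ico_ae_eq_Icc
  have h1 : (unitRect.toSet : Set (ℝ × ℝ)) =ᵐ[volume] unitSquare := by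
    rw [Measure.volume_eq_prod]
    exact Measure.set_prod_ae_eq h0 h0
  filter_upwards [hf, h1.mem_iff] with z h2 h3 h4
  exact h2 fun h => h4 (h3.2 h)

theorem integrable_of_ae_mem {f : L2Plane} (hf : ∀ᵐ z, z ∉ unitRect.toSet → f z = 0) :
    Integrable f := by
  refine (DyadicRect.integrableOn_toSet f unitRect).integrable_of_ae_notMem_eq_zero hf

theorem integrable_mul_haar {f : ℝ × ℝ → ℂ} (hf : Integrable f) (J : DyadicInterval) {e : ℝ × ℝ → ℝ}
    (he : Measurable e) : Integrable fun z => f z * (J.haar (e z) : ℂ) := by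
  refine hf.mul_bdd (c := J.amp)
    (Complex.measurable_ofReal.comp (J.measurable_haar.comp he)).aestronglyMeasurable ?_
  filter_upwards with z
  rw [Complex.norm_real, Real.norm_eq_abs, DyadicInterval.abs_haar]
  exact indicator_le_self' (fun _ _ => J.amp_pos.le) _

theorem haarCoeff_eq_const_mul₁ {f : ℝ × ℝ → ℂ} (hf : ∀ᵐ z, z ∉ unitRect.toSet → f z = 0)
    {R : DyadicRect} {c : ℝ} (hc : ∀ s ∈ unit.toSet, R.1.haar s = c) :
    haarCoeff f R = c * ∫ z, f z * (R.2.haar z.2 : ℂ) := by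
  rw [haarCoeff, ← integral_const_mul]
  refine integral_congr_ae ?_
  filter_upwards [hf] with z hz
  by_cases h : z ∈ unitRect.toSet
  · rw [DyadicRect.haar, hc _ h.1]; push_cast; ring
  · simp [hz h]

theorem haarCoeff_eq_const_mul₂ {f : ℝ × ℝ → ℂ} (hf : ∀ᵐ z, z ∉ unitRect.toSet → f z = 0)
    {R : DyadicRect} {c : ℝ} (hc : ∀ s ∈ unit.toSet, R.2.haar s = c) :
    haarCoeff f R = c * ∫ z, f z * (R.1.haar z.1 : ℂ) := by
  rw [haarCoeff, ← integral_const_mul]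
  refine integral_congr_ae ?_
  filter_upwards [hf] with z hz
  by_cases h : z ∈ unitRect.toSet
  · rw [DyadicRect.haar, hc _ h.2]; push_cast; ring
  · simp [hz h]

namespace DyadicInterval

/-- An interval longer than 1 has a Haar function constant on `[0, 1)`. A shorter one that is not
inside `[0, 1)` is disjoint from it. -/
theorem exists_haar_eq_const {I : DyadicInterval} (h : ¬ (I.toSet ⊆ unit.toSet ∧ 0 ≤ I.gen)) :
    ∃ c, ∀ s ∈ unit.toSet, I.haar s = c := by
  by_cases hg : I.gen < 0
  · exact ⟨I.haar 0, fun s hs => haar_const (K := unit) hg hs zero_mem_unit⟩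
  · refine ⟨0, fun s hs => haar_of_notMem fun hsI => h ⟨subset_of_mem hs hsI ?_, not_lt.1 hg⟩⟩
    exact not_lt.1 hg

theorem haar_cell_zero {n : ℤ} (hn : n < 0) {s : ℝ} (hs : s ∈ unit.toSet) :
    (cell n 0).haar s = (cell n 0).haar 0 :=
  haar_const (K := unit) hn hs zero_mem_unit

theorem enorm_haar_cell_zero (n : ℤ) : ‖((cell n 0).haar 0 : ℂ)‖ₑ = eamp (cell n 0) := by
  rw [← ofReal_norm, Complex.norm_real, Real.norm_eq_abs, abs_haar, indicator_of_mem (mem_cell n 0),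
    eamp]

end DyadicInterval

/-- On the support of `f` the Haar function of a large interval around 0 is constant, with modulus
its height. The coefficient is therefore that height times a quantity independent of the interval.
-/
theorem decays_haarCoeff₁ {f : ℝ × ℝ → ℂ} (hf : ∀ᵐ z, z ∉ unitRect.toSet → f z = 0)
    (J : DyadicInterval) : Decays fun I => ‖haarCoeff f (I, J)‖ₑ := by
  intro n hn
  simp only
  rw [haarCoeff_eq_const_mul₁ hf fun s hs => DyadicInterval.haar_cell_zero (n := n - 1) (by omega) hs,
    haarCoeff_eq_const_mul₁ hf fun s hs => DyadicInterval.haar_cell_zero (n := n) (by omega) hs,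
    enorm_mul, enorm_mul, DyadicInterval.enorm_haar_cell_zero, DyadicInterval.enorm_haar_cell_zero,
    ← DyadicInterval.parent_cell, DyadicInterval.eamp_parent, mul_assoc]

theorem decays_haarCoeff₂ {f : ℝ × ℝ → ℂ} (hf : ∀ᵐ z, z ∉ unitRect.toSet → f z = 0)
    (I : DyadicInterval) : Decays fun J => ‖haarCoeff f (I, J)‖ₑ := by
  intro n hn
  simp only
  rw [haarCoeff_eq_const_mul₂ hf fun s hs => DyadicInterval.haar_cell_zero (n := n - 1) (by omega) hs,
    haarCoeff_eq_const_mul₂ hf fun s hs => DyadicInterval.haar_cell_zero (n := n) (by omega) hs,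
    enorm_mul, enorm_mul, DyadicInterval.enorm_haar_cell_zero, DyadicInterval.enorm_haar_cell_zero,
    ← DyadicInterval.parent_cell, DyadicInterval.eamp_parent, mul_assoc]

/-- If a side of `R` does not lie in the unit interval, its Haar function is constant on the
support, and integrating in that variable gives a vanishing marginal. -/
theorem isUnit_of_haarCoeff_ne_zero {f : ℝ × ℝ → ℂ} (hi : Integrable f)
    (hf : ∀ᵐ z, z ∉ unitRect.toSet → f z = 0) (hm : MarginalsVanish f) {R : DyadicRect} (hR : haarCoeff f R ≠ 0) : R.IsUnit := by
  constructor
  · by_contra h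
    obtain ⟨c, hc⟩ := DyadicInterval.exists_haar_eq_const h
    refine hR ?_
    have h1 := integrable_mul_haar hi R.2 measurable_snd
    rw [haarCoeff_eq_const_mul₁ hf hc]
    rw [Measure.volume_eq_prod] at h1 ⊢
    rw [integral_prod_symm _ h1]
    have h2 : ∀ᵐ t : ℝ, ∫ s : ℝ, f (s, t) * (R.2.haar t : ℂ) = 0 := by
      filter_upwards [hm.2] with t ht
      rw [integral_mul_const, ht, zero_mul]
    rw [integral_congr_ae h2]
    simp
  · by_contra h
    obtain ⟨c, hc⟩ := DyadicInterval.exists_haar_eq_const h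
    refine hR ?_
    have h1 := integrable_mul_haar hi R.1 measurable_fst
    rw [haarCoeff_eq_const_mul₂ hf hc]
    rw [Measure.volume_eq_prod] at h1 ⊢
    rw [integral_prod _ h1]
    have h2 : ∀ᵐ s : ℝ, ∫ t : ℝ, f (s, t) * (R.1.haar s : ℂ) = 0 := by
      filter_upwards [hm.1] with s hs
      rw [integral_mul_const, hs, zero_mul]
    rw [integral_congr_ae h2]
    simp

/-! ### Expansion of the commutator -/

/-- Two-to-one reindexing by children in the first variable. -/
theorem HasSum.children₁ {u : DyadicRect → ℂ} {a : ℂ} (h : HasSum u a) :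
    HasSum (fun N : DyadicRect => u (N.1.right, N.2) + u (N.1.left, N.2)) a := by
  have hinj : Function.Injective fun p : DyadicRect × Bool =>
      ((if p.2 then p.1.1.right else p.1.1.left, p.1.2) : DyadicRect) := by
    rintro ⟨N, x⟩ ⟨M, y⟩ hxy
    simp only [Prod.mk.injEq] at hxy
    obtain ⟨h1, h2⟩ := hxy
    have hp := congrArg DyadicInterval.parent h1
    cases x <;> cases y <;>
      simp only [if_true, if_false, Bool.false_eq_true, DyadicInterval.parent_right,
        DyadicInterval.parent_left] at h1 hp
    · rw [Prod.ext hp h2]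
    · exact absurd h1.symm (DyadicInterval.right_ne_left _ _)
    · exact absurd h1 (DyadicInterval.right_ne_left _ _)
    · rw [Prod.ext hp h2]
  have hsurj : Function.Surjective fun p : DyadicRect × Bool =>
      ((if p.2 then p.1.1.right else p.1.1.left, p.1.2) : DyadicRect) := fun N => by
    rcases DyadicInterval.eq_right_or_left N.1 with e | e
    · exact ⟨((N.1.parent, N.2), true), Prod.ext e.symm rfl⟩
    · exact ⟨((N.1.parent, N.2), false), Prod.ext e.symm rfl⟩
  have h1 := (Equiv.ofBijective _ ⟨hinj, hsurj⟩).hasSum_iff.2 h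
  have h2 := h1.prod_fiberwise fun N => hasSum_fintype _
  simp only [Fintype.sum_bool, Function.comp_apply] at h2
  exact h2

/-- Two-to-one reindexing by children in the second variable. -/
theorem HasSum.children₂ {u : DyadicRect → ℂ} {a : ℂ} (h : HasSum u a) :
    HasSum (fun N : DyadicRect => u (N.1, N.2.right) + u (N.1, N.2.left)) a := by
  have h1 := ((Equiv.prodComm DyadicInterval DyadicInterval).hasSum_iff.2 h).children₁
  exact (Equiv.prodComm DyadicInterval DyadicInterval).hasSum_iff.1 h1

namespace DyadicRect

/-- `∫ h_R h_N h_Q` for rectangles. -/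
noncomputable def triple (R N Q : DyadicRect) : ℂ :=
  (DyadicInterval.triple R.1 N.1 Q.1 : ℂ) * (DyadicInterval.triple R.2 N.2 Q.2 : ℂ)

theorem norm_haar_le (R : DyadicRect) (z : ℝ × ℝ) : ‖R.haar z‖ ≤ R.1.amp * R.2.amp := by
  rw [haar, Complex.norm_real, norm_mul, Real.norm_eq_abs, Real.norm_eq_abs]
  have h : ∀ (I : DyadicInterval) x, |I.haar x| ≤ I.amp := fun I x => by
    rw [DyadicInterval.abs_haar]; exact indicator_le_self' (fun _ _ => I.amp_pos.le) x
  exact mul_le_mul (h _ _) (h _ _) (abs_nonneg _) R.1.amp_pos.le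

theorem memLp_mul_haar (f : L2Plane) (Q : DyadicRect) : MemLp (fun z => f z * Q.haar z) 2 := by
  have h := (Lp.memLp f).mul (p := ⊤) (r := 2) (memLp_top_of_bound
    (measurable_haar Q).aestronglyMeasurable _ (Filter.Eventually.of_forall (norm_haar_le Q)))
  exact h.congr_norm (h.1.congr (Filter.Eventually.of_forall fun z => mul_comm _ _))
    (Filter.Eventually.of_forall fun z => by simp [mul_comm])

/-- `∫ f h_Q h_R`. -/
noncomputable def mulCoeff (f : L2Plane) (Q R : DyadicRect) : ℂ := haarCoeff (fun z => f z * Q.haar z) R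

theorem hasSum_mulCoeff (φ f : L2Plane) (Q : DyadicRect) :
    HasSum (fun R => haarCoeff φ R * mulCoeff f Q R) (haarCoeff (fun z => φ z * f z) Q) := by
  have h := hasSum_haarCoeff_mul φ ((memLp_mul_haar f Q).toLp _)
  have h1 := (memLp_mul_haar f Q).coeFn_toLp
  have e : ∫ z, φ z * ((memLp_mul_haar f Q).toLp _ : L2Plane) z = haarCoeff (fun z => φ z * f z) Q := by
    refine integral_congr_ae ?_
    filter_upwards [h1] with z hz
    rw [hz, mul_assoc]
  rw [e] at h
  simpa only [haarCoeff_congr h1, mulCoeff] using h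

theorem haarCoeff_haar_mul_haar (Q R N : DyadicRect) :
    haarCoeff (fun z => R.haar z * Q.haar z) N = triple R N Q := by
  have h : ∀ z : ℝ × ℝ, R.haar z * Q.haar z * N.haar z =
      ((R.1.haar z.1 * N.1.haar z.1 * Q.1.haar z.1 : ℝ) : ℂ) *
        ((R.2.haar z.2 * N.2.haar z.2 * Q.2.haar z.2 : ℝ) : ℂ) := fun z => by
    simp only [haar]; push_cast; ring
  rw [haarCoeff]
  simp only [h]
  rw [Measure.volume_eq_prod,
    integral_prod_mul (fun s => ((R.1.haar s * N.1.haar s * Q.1.haar s : ℝ) : ℂ))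
      (fun t => ((R.2.haar t * N.2.haar t * Q.2.haar t : ℝ) : ℂ)),
    integral_complex_ofReal, integral_complex_ofReal]
  rfl

theorem hasSum_triple (f : L2Plane) (Q R : DyadicRect) :
    HasSum (fun N => haarCoeff f N * triple R N Q) (mulCoeff f Q R) := by
  have hm := memLp_mul_haar (haarL2 R) Q
  have h := hasSum_haarCoeff_mul f (hm.toLp _)
  have h1 : (hm.toLp _ : L2Plane) =ᵐ[volume] fun z => R.haar z * Q.haar z := by
    filter_upwards [hm.coeFn_toLp, haarL2_ae R] with z hz hz2
    rw [hz, hz2]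
  have e : ∫ z, f z * (hm.toLp _ : L2Plane) z = mulCoeff f Q R := by
    refine integral_congr_ae ?_
    filter_upwards [h1] with z hz
    rw [hz]; ring
  rw [e] at h
  simpa only [haarCoeff_congr h1, haarCoeff_haar_mul_haar] using h

/-- The coefficient of `φ_R` in the expansion of the `Q`-th Haar coefficient of the commutator. -/
noncomputable def commCoeff (b : L2Plane) (Q R : DyadicRect) : ℂ :=
  Q.1.sgn * (Q.2.sgn * mulCoeff b (Q.1.parent, Q.2.parent) R - mulCoeff (shift₂ b) (Q.1.parent, Q.2) R) -
    (Q.2.sgn * mulCoeff (shift₁ b) (Q.1, Q.2.parent) R - mulCoeff (shift₂ (shift₁ b)) Q R)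

/-- In the products with shifted `b`, the coefficient at a child is plus or minus that of `b` at its
parent. Summation over pairs of children moves the shift from `b` onto the triple products, and the
four sums combine to the product of two kernels. -/
theorem hasSum_kernel (b : L2Plane) (Q R : DyadicRect) :
    HasSum (fun N => haarCoeff b N * ((DyadicInterval.kernel R.1 N.1 Q.1 : ℂ) *
      (DyadicInterval.kernel R.2 N.2 Q.2 : ℂ))) (commCoeff b Q R) := by
  have h0 := hasSum_triple b (Q.1.parent, Q.2.parent) R
  have h2 := (hasSum_triple (shift₂ b) (Q.1.parent, Q.2) R).children₂
  have h1 := (hasSum_triple (shift₁ b) (Q.1, Q.2.parent) R).children₁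
  have h3 := (hasSum_triple (shift₂ (shift₁ b)) Q R).children₂.children₁
  simp only [haarCoeff_shift₁, haarCoeff_shift₂, DyadicInterval.parent_right,
    DyadicInterval.parent_left, DyadicInterval.sgn_right, DyadicInterval.sgn_left, triple] at h0 h1 h2 h3
  refine ((((h0.mul_left (Q.2.sgn : ℂ)).sub h2).mul_left (Q.1.sgn : ℂ)).sub
    ((h1.mul_left (Q.2.sgn : ℂ)).sub h3)).congr_fun ?_
  intro N
  simp only [DyadicInterval.kernel]
  push_cast
  ring

end DyadicRect

theorem haarCoeff_mulL2 {φ f : L2Plane} (h : InMulDomain φ f) (Q : DyadicRect) :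
    haarCoeff (mulL2 φ f) Q = haarCoeff (fun z => φ z * f z) Q := by
  rw [mulL2, dif_pos h]
  exact haarCoeff_congr h.coeFn_toLp Q

/-- Coefficients of a shifted function are read off at parents. Each product `φ f` tested on `h_Q`
is the pairing of `φ` with the `L²` function `f h_Q`, and Parseval expands it in the coefficients of
`φ`. -/
theorem hasSum_shiftCommutator {φ b : L2Plane} (h : InCommutatorDomain φ b) (Q : DyadicRect) :
    HasSum (fun R => haarCoeff φ R * DyadicRect.commCoeff b Q R)
      (haarCoeff (shiftCommutator φ b) Q) := by
  obtain ⟨h0, h1, h2, h3⟩ := h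
  have e : haarCoeff (shiftCommutator φ b) Q =
      Q.1.sgn * (Q.2.sgn * haarCoeff (fun z => φ z * b z) (Q.1.parent, Q.2.parent) -
        haarCoeff (fun z => φ z * shift₂ b z) (Q.1.parent, Q.2)) -
      (Q.2.sgn * haarCoeff (fun z => φ z * shift₁ b z) (Q.1, Q.2.parent) -
        haarCoeff (fun z => φ z * shift₂ (shift₁ b) z) Q) := by
    simp only [shiftCommutator, opCommutator]
    rw [haarCoeff_sub, haarCoeff_shift₁, haarCoeff_sub, haarCoeff_shift₂, haarCoeff_sub,
      haarCoeff_shift₂, haarCoeff_mulL2 h0, haarCoeff_mulL2 h1, haarCoeff_mulL2 h2,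
      haarCoeff_mulL2 h3]
  rw [e]
  have k0 := DyadicRect.hasSum_mulCoeff φ b (Q.1.parent, Q.2.parent)
  have k2 := DyadicRect.hasSum_mulCoeff φ (shift₂ b) (Q.1.parent, Q.2)
  have k1 := DyadicRect.hasSum_mulCoeff φ (shift₁ b) (Q.1, Q.2.parent)
  have k3 := DyadicRect.hasSum_mulCoeff φ (shift₂ (shift₁ b)) Q
  refine ((((k0.mul_left (Q.2.sgn : ℂ)).sub k2).mul_left (Q.1.sgn : ℂ)).sub
    ((k1.mul_left (Q.2.sgn : ℂ)).sub k3)).congr_fun ?_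
  intro R
  simp only [DyadicRect.commCoeff]
  ring

/-! ### The BMO bound by duality. -/

namespace DyadicRect

open DyadicInterval

/-- The test coefficients for a pair of terms of the kernel. -/
noncomputable def testCoef (i j : Fin 5) (T : Finset DyadicRect) (g : DyadicRect → ℂ) : DyadicRect → ℂ :=
  fibreSum (termQ i) (termQ j) T fun Q => g Q * ((termSgn i Q.1 : ℂ) * (termSgn j Q.2 : ℂ))

theorem sum_testPart_eq (i j : Fin 5) (T : Finset DyadicRect) (g : DyadicRect → ℂ) (R : DyadicRect) :
    ∑ Q ∈ T, g Q * (((termSgn i Q.1 : ℂ) * (testPart i R.1 (par (termQ i) Q.1) : ℂ)) *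
      ((termSgn j Q.2 : ℂ) * (testPart j R.2 (par (termQ j) Q.2) : ℂ))) =
      pairTest i j (T.image (par₂ (termQ i) (termQ j))) (testCoef i j T g) R := by
  rw [pairTest, ← Finset.sum_fiberwise_of_maps_to (s := T)
    (fun Q hQ => Finset.mem_image_of_mem (par₂ (termQ i) (termQ j)) hQ)]
  refine Finset.sum_congr rfl fun M _ => ?_
  rw [testCoef, fibreSum, Finset.sum_mul]
  refine Finset.sum_congr rfl fun Q hQ => ?_
  rw [← (Finset.mem_filter.1 hQ).2, par₂]
  ring

theorem sum_enorm_testCoef_sq_le (i j : Fin 5) (T : Finset DyadicRect) (g : DyadicRect → ℂ) :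
    ∑ N ∈ T.image (par₂ (termQ i) (termQ j)), ‖testCoef i j T g N‖ₑ ^ 2 ≤ 4 * ∑ Q ∈ T, ‖g Q‖ₑ ^ 2 := by
  refine (sum_enorm_fibreSum_sq_le _ _ T _).trans_eq ?_
  have h : ∀ (i : Fin 5) I, ‖(termSgn i I : ℂ)‖ₑ = 1 := fun i I => by
    rw [← ofReal_norm, Complex.norm_real, Real.norm_eq_abs, abs_termSgn, ENNReal.ofReal_one]
  simp only [enorm_mul, h, mul_one]

/-- Since every kernel term factors, the sums over `N` and over `Q` separate for each fixed `R`;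
absolute values are taken only after the sum over `Q` has been formed. -/
theorem enorm_sum_commCoeff_le (b : L2Plane) (T : Finset DyadicRect) (g : DyadicRect → ℂ)
    (R : DyadicRect) :
    ‖∑ Q ∈ T, g Q * commCoeff b Q R‖ₑ ≤ ∑ p : Fin 5 × Fin 5,
      pairCoef p.1 p.2 (fun N => ‖haarCoeff b N‖ₑ) R *
        ‖pairTest p.1 p.2 (T.image (par₂ (termQ p.1) (termQ p.2))) (testCoef p.1 p.2 T g) R‖ₑ := by
  have h := hasSum_sum (s := T) fun Q _ => (hasSum_kernel b Q R).mul_left (g Q)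
  rw [← h.tsum_eq]
  have e : ∀ N, ∑ Q ∈ T, g Q * (haarCoeff b N * ((kernel R.1 N.1 Q.1 : ℂ) * (kernel R.2 N.2 Q.2 : ℂ))) =
      ∑ p : Fin 5 × Fin 5, ((coefPart p.1 R.1 N.1 : ℂ) * (coefPart p.2 R.2 N.2 : ℂ) * haarCoeff b N) *
        pairTest p.1 p.2 (T.image (par₂ (termQ p.1) (termQ p.2))) (testCoef p.1 p.2 T g) R := by
    intro N
    simp only [← sum_testPart_eq, Finset.mul_sum]
    rw [Finset.sum_comm]
    refine Finset.sum_congr rfl fun Q _ => ?_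
    rw [kernel_eq_sum, kernel_eq_sum, Fintype.sum_prod_type]
    push_cast
    rw [Finset.sum_mul_sum, Finset.mul_sum, Finset.mul_sum]
    refine Finset.sum_congr rfl fun i _ => ?_
    rw [Finset.mul_sum, Finset.mul_sum]
    refine Finset.sum_congr rfl fun j _ => ?_
    ring
  have hr : ∀ x : ℝ, ‖(x : ℂ)‖ₑ = ‖x‖ₑ := fun x => by
    rw [← ofReal_norm, ← ofReal_norm, Complex.norm_real]
  calc _ ≤ ∑' N, ∑ p : Fin 5 × Fin 5, (‖coefPart p.1 R.1 N.1‖ₑ * ‖coefPart p.2 R.2 N.2‖ₑ *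
        ‖haarCoeff b N‖ₑ) * ‖pairTest p.1 p.2 (T.image (par₂ (termQ p.1) (termQ p.2)))
          (testCoef p.1 p.2 T g) R‖ₑ := by
        refine enorm_tsum_le_tsum_enorm.trans (ENNReal.tsum_le_tsum fun N => ?_)
        rw [e]
        refine (enorm_sum_le _ _).trans (Finset.sum_le_sum fun p _ => ?_)
        rw [enorm_mul, enorm_mul, enorm_mul, hr, hr]
    _ = _ := by
        rw [Summable.tsum_finsetSum fun _ _ => ENNReal.summable]
        simp only [ENNReal.tsum_mul_right, pairCoef]

/-- Localisation: only rectangles inside the union of the parents of `T` contribute, so the final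
bound involves the measure of the union of `T`. -/
theorem subset_parents {i j : Fin 5} {T : Finset DyadicRect} {D : DyadicRect → ℂ} {R : DyadicRect}
    (h : pairTest i j (T.image (par₂ (termQ i) (termQ j))) D R ≠ 0) :
    R.toSet ⊆ ⋃ Q ∈ T, toSet (Q.1.parent, Q.2.parent) := by
  obtain ⟨M, hM, h1⟩ := Finset.exists_ne_zero_of_sum_ne_zero h
  obtain ⟨Q, hQ, rfl⟩ := Finset.mem_image.1 hM
  have h2 := right_ne_zero_of_mul h1
  have h3 := subset_of_testPart_ne_zero (Complex.ofReal_ne_zero.1 (left_ne_zero_of_mul h2))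
  have h4 := subset_of_testPart_ne_zero (Complex.ofReal_ne_zero.1 (right_ne_zero_of_mul h2))
  exact (prod_mono (h3.trans (par_subset_parent _ _)) (h4.trans (par_subset_parent _ _))).trans
    (subset_biUnion_of_mem (u := fun Q : DyadicRect => toSet (Q.1.parent, Q.2.parent)) hQ)

/-- One pair costs `2^30 · 1024 · 4 = 2^42`, from `sq_sum_pair_le`, the passage to parents and the
fibres of that passage. Cauchy–Schwarz over 25 pairs gives `25² · 2^42`. -/
theorem sq_sum_all_pairs_le {φ b : L2Plane} {A B : ℝ≥0∞}
    (hφ : IsLogCarleson (fun R => ‖haarCoeff φ R‖ₑ ^ 2) A)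
    (hφu : ∀ R, haarCoeff φ R ≠ 0 → R.IsUnit)
    (hb : IsCarleson (fun R => ‖haarCoeff b R‖ₑ ^ 2) B)
    (hb1 : ∀ J, Decays fun I => ‖haarCoeff b (I, J)‖ₑ)
    (hb2 : ∀ I, Decays fun J => ‖haarCoeff b (I, J)‖ₑ)
    (T : Finset DyadicRect) (g : DyadicRect → ℂ) (S : Finset DyadicRect) :
    (∑ R ∈ S, ‖haarCoeff φ R * ∑ Q ∈ T, g Q * commCoeff b Q R‖ₑ) ^ 2 ≤
      (25 * 2 ^ 21) ^ 2 * A * B * volume (⋃ R ∈ T, R.toSet) * ∑ Q ∈ T, ‖g Q‖ₑ ^ 2 := by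
  set X : Fin 5 × Fin 5 → DyadicRect → ℂ := fun p R => pairTest p.1 p.2
    (T.image (par₂ (termQ p.1) (termQ p.2))) (testCoef p.1 p.2 T g) R with hX
  set Y : Fin 5 × Fin 5 → ℝ≥0∞ := fun p => ∑ R ∈ S, ‖haarCoeff φ R‖ₑ *
    (pairCoef p.1 p.2 (fun N => ‖haarCoeff b N‖ₑ) R * ‖X p R‖ₑ) with hY
  set V := volume (⋃ R ∈ T, R.toSet)
  set E := ∑ Q ∈ T, ‖g Q‖ₑ ^ 2
  have h1 : ∑ R ∈ S, ‖haarCoeff φ R * ∑ Q ∈ T, g Q * commCoeff b Q R‖ₑ ≤ ∑ p, Y p := by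
    rw [hY, Finset.sum_comm]
    refine Finset.sum_le_sum fun R _ => ?_
    rw [enorm_mul, ← Finset.mul_sum]
    exact mul_le_mul_right (enorm_sum_commCoeff_le b T g R) _
  have h2 : ∀ p, Y p ^ 2 ≤ 2 ^ 42 * (A * B * V * E) := fun p => by
    set S' := S.filter fun R => haarCoeff φ R ≠ 0 ∧ X p R ≠ 0 with hS'
    have e : Y p = ∑ R ∈ S', ‖haarCoeff φ R‖ₑ *
        (pairCoef p.1 p.2 (fun N => ‖haarCoeff b N‖ₑ) R * ‖X p R‖ₑ) := by
      rw [hS', Finset.sum_filter_of_ne]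
      intro R _ h
      refine ⟨fun h0 => h (by rw [h0, enorm_zero, zero_mul]), fun h0 => h (by
        rw [h0, enorm_zero, mul_zero, mul_zero])⟩
    have h3 := sq_sum_pair_le p.1 p.2 hφ hb (fun R => enorm_ne_top) hb1 hb2 (S := S')
      (fun R hR => hφu R (Finset.mem_filter.1 hR).2.1)
      (T.image (par₂ (termQ p.1) (termQ p.2))) (testCoef p.1 p.2 T g)
    have h4 : volume (⋃ R ∈ S', R.toSet) ≤ 1024 * V :=
      (measure_mono (iUnion₂_subset fun R hR => subset_parents (Finset.mem_filter.1 hR).2.2)).trans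
        (volume_parents_le T)
    rw [e]
    refine h3.trans ((mul_le_mul' (mul_le_mul_right h4 _)
      (sum_enorm_testCoef_sq_le p.1 p.2 T g)).trans_eq ?_)
    change 2 ^ 30 * A * B * (1024 * V) * (4 * E) = _
    ring
  calc _ ≤ (∑ p, Y p) ^ 2 := pow_le_pow_left' h1 2
    _ ≤ 25 * ∑ p, Y p ^ 2 := by
        have h := ENNReal.sq_sum_mul_le Finset.univ (fun _ : Fin 5 × Fin 5 => 1) Y
        simpa using h
    _ ≤ 25 * ∑ p : Fin 5 × Fin 5, 2 ^ 42 * (A * B * V * E) :=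
        mul_le_mul_right (Finset.sum_le_sum fun p _ => h2 p) _
    _ = _ := by
        rw [Finset.sum_const]
        simp only [Finset.card_univ, Fintype.card_prod, Fintype.card_fin, nsmul_eq_mul]
        push_cast
        ring

end DyadicRect

/-- Let `F` be the coefficients of the commutator and `E` the sum of their squared moduli over `T`.
Tested against the conjugate of `F`, the bound for all pairs reads `E² ≤ W E`, and `E` is finite. -/
theorem bmoNorm_shiftCommutator_le {φ b : L2Plane} (hφ : ∀ᵐ z, z ∉ unitSquare → φ z = 0)
    (hm : MarginalsVanish φ) (hb : ∀ᵐ z, z ∉ unitSquare → b z = 0) (h : InCommutatorDomain φ b) :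
    bmoNorm (shiftCommutator φ b) ≤ 25 * 2 ^ 21 * lmoNorm φ * bmoNorm b := by
  refine bmoNorm_le fun T => ?_
  set F : DyadicRect → ℂ := haarCoeff (shiftCommutator φ b)
  set g : DyadicRect → ℂ := fun Q => (starRingEnd ℂ) (F Q)
  set E := ∑ Q ∈ T, ‖F Q‖ₑ ^ 2 with hE
  have hg : ∑ Q ∈ T, ‖g Q‖ₑ ^ 2 = E := by simp [g, hE]
  have hφ' := ae_mem_unitRect hφ
  have hb' := ae_mem_unitRect hb
  set W := (25 * 2 ^ 21) ^ 2 * lmoNorm φ ^ 2 * bmoNorm b ^ 2 * volume (⋃ R ∈ T, R.toSet) with hW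
  have h1 : ∀ S : Finset DyadicRect,
      (∑ R ∈ S, ‖haarCoeff φ R * ∑ Q ∈ T, g Q * DyadicRect.commCoeff b Q R‖ₑ) ^ 2 ≤ W * E := fun S => by
    have := DyadicRect.sq_sum_all_pairs_le (isLogCarleson_haarCoeff φ)
      (fun R hR => isUnit_of_haarCoeff_ne_zero (integrable_of_ae_mem hφ') hφ' hm hR)
      (sum_enorm_haarCoeff_sq_le b) (decays_haarCoeff₁ hb') (decays_haarCoeff₂ hb') T g S
    rwa [hg] at this
  have h2 : HasSum (fun R => haarCoeff φ R * ∑ Q ∈ T, g Q * DyadicRect.commCoeff b Q R)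
      (∑ Q ∈ T, g Q * F Q) := by
    refine (hasSum_sum (s := T) fun Q _ => (hasSum_shiftCommutator h Q).mul_left (g Q)).congr_fun ?_
    intro R
    rw [Finset.mul_sum]
    exact Finset.sum_congr rfl fun Q _ => by ring
  have h3 : ‖∑ Q ∈ T, g Q * F Q‖ₑ = E := by
    have e : ∑ Q ∈ T, g Q * F Q = ((∑ Q ∈ T, ‖F Q‖ ^ 2 : ℝ) : ℂ) := by
      push_cast
      exact Finset.sum_congr rfl fun Q _ => Complex.conj_mul' _
    rw [e, ← ofReal_norm, Complex.norm_real, Real.norm_of_nonneg (by positivity),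
      ENNReal.ofReal_sum_of_nonneg fun _ _ => by positivity]
    refine Finset.sum_congr rfl fun Q _ => ?_
    rw [ENNReal.ofReal_pow (norm_nonneg _), ofReal_norm]
  have h4 : E ^ 2 ≤ W * E := by
    have h5 : E ≤ (W * E) ^ (1 / 2 : ℝ) := by
      refine le_trans (le_of_eq (by rw [h2.tsum_eq, h3])) (enorm_tsum_le_tsum_enorm.trans ?_)
      rw [ENNReal.tsum_eq_iSup_sum]
      refine iSup_le fun S => ENNReal.le_of_sq_le_sq ((h1 S).trans_eq ?_)
      rw [← ENNReal.rpow_natCast, ← ENNReal.rpow_mul]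
      norm_num
    refine (pow_le_pow_left' h5 2).trans_eq ?_
    rw [← ENNReal.rpow_natCast, ← ENNReal.rpow_mul]
    norm_num
  have hEt : E ≠ ⊤ := ENNReal.sum_ne_top.2 fun Q _ => ENNReal.pow_ne_top enorm_ne_top
  have h6 : E ≤ W := by
    by_cases h0 : E = 0
    · rw [h0]; exact bot_le
    · rw [sq, mul_comm W] at h4
      exact (ENNReal.mul_le_mul_iff_right h0 hEt).1 h4
  refine h6.trans_eq ?_
  rw [hW]
  ring

/-! ### Clipping of large intervals and square integrability of the products. -/

namespace DyadicInterval

/-- The interval `[0, 2)`. -/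
noncomputable def two : DyadicInterval := cell (-1) 0

/-- Large intervals are replaced by `[0, 2)`. -/
noncomputable def clip (I : DyadicInterval) : DyadicInterval := if I.gen < -1 then two else I

/-- The ratio of `h_I` and `h_{clip I}` on the unit interval. -/
noncomputable def clipRatio (I : DyadicInterval) : ℝ :=
  if I.gen < -1 then meanHaar unit I / two.haar 0 else 1

theorem abs_two_haar_zero : |two.haar 0| = two.amp := by
  rw [abs_haar, indicator_of_mem]
  exact mem_cell _ _

theorem haar_eq_clip (I : DyadicInterval) {s : ℝ} (hs : s ∈ unit.toSet) :
    I.haar s = clipRatio I * (clip I).haar s := by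
  rw [clipRatio, clip]
  split_ifs with h
  · have h1 : two.haar s = two.haar 0 :=
      haar_const (K := unit) (by simp [two, unit]) hs zero_mem_unit
    have h2 : two.haar 0 ≠ 0 := fun h0 => by
      have := abs_two_haar_zero
      rw [h0, abs_zero] at this
      exact two.amp_pos.ne this
    have hg : I.gen < unit.gen := by simp only [unit]; omega
    rw [h1, div_mul_cancel₀ _ h2, meanHaar, if_pos hg]
    exact haar_const hg hs unit.base_mem
  · rw [one_mul]

theorem ancs_unit : ancs unit = {two} := by
  ext I
  rw [mem_ancs, Finset.mem_singleton]
  constructor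
  · rintro ⟨h1, h2, h3⟩
    simp only [unit] at h2
    have h4 : I.gen = -1 := by omega
    rw [eq_cell_zero subset_rfl zero_mem_unit (h3 zero_mem_unit) (by omega), h4, two]
  · rintro rfl
    exact ⟨by simp [two], by simp [two, unit],
      subset_of_mem (mem_cell _ _) zero_mem_unit (show (-1 : ℤ) ≤ 0 by norm_num)⟩

-- Clipping moves an interval only to `[0, 2)`. The sum that collects there is `tsum_meanHaar_le`
-- for the unit interval, whose only ancestor of length at most two is `[0, 2)`.
open Classical in
theorem tsum_clip_le {F : DyadicInterval → ℝ≥0∞} (hF : Decays F) (I' : DyadicInterval) :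
    ∑' I, (if clip I = I' then ‖clipRatio I‖ₑ * F I else 0) ≤ 2 * F I' := by
  by_cases hI : I' = two
  · subst hI
    have h0 : eamp two ≠ 0 := by
      rw [eamp]; exact (ENNReal.ofReal_pos.2 two.amp_pos).ne'
    have h1 : ∀ I, eamp two * (if clip I = two then ‖clipRatio I‖ₑ * F I else 0) ≤
        ‖meanHaar unit I‖ₑ * F I := fun I => by
      split_ifs with h
      · rw [← mul_assoc]
        refine mul_le_mul_left (le_of_eq ?_) _
        have h3 : eamp two = ‖two.haar 0‖ₑ := by
          rw [eamp, ← abs_two_haar_zero, ← Real.norm_eq_abs, ofReal_norm]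
        have h2 : two.haar 0 ≠ 0 := fun h => h0 (by rw [h3, h, enorm_zero])
        rw [h3, ← enorm_mul]
        by_cases hg : I.gen < -1
        · rw [clipRatio, if_pos hg, mul_div_cancel₀ _ h2]
        · rw [clip, if_neg hg] at h
          rw [clipRatio, if_neg hg, mul_one, h, meanHaar, if_pos (by simp [two, unit])]
          congr 1
          exact haar_const (K := unit) (by simp [two, unit]) zero_mem_unit unit.base_mem
      · rw [mul_zero]; exact bot_le
    have h2 := tsum_meanHaar_le (K := unit) subset_rfl le_rfl hF
    rw [ancs_unit, Finset.sum_singleton] at h2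
    have h3 := (ENNReal.tsum_le_tsum h1).trans h2
    rw [ENNReal.tsum_mul_left] at h3
    refine (ENNReal.mul_le_mul_iff_right h0 (eamp_ne_top _)).1 (h3.trans_eq (by ring))
  · rw [tsum_eq_single I']
    · split_ifs with h
      · have hg : ¬ I'.gen < -1 := fun hg => hI (by rw [clip, if_pos hg] at h; exact h.symm)
        rw [clipRatio, if_neg hg, enorm_one, one_mul, two_mul]
        exact le_self_add
      · exact bot_le
    · intro I hne
      rw [if_neg]
      intro h
      rw [clip] at h
      split_ifs at h with hg
      · exact hI h.symm
      · exact hne h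

theorem clip_subset_two {I : DyadicInterval} {s : ℝ} (hs : s ∈ unit.toSet)
    (h : s ∈ (clip I).toSet) : (clip I).toSet ⊆ two.toSet := by
  have h2 : s ∈ two.toSet := subset_of_mem (mem_cell _ _) zero_mem_unit (show (-1 : ℤ) ≤ 0 by norm_num) hs
  refine subset_of_mem h2 h ?_
  rw [clip]
  split_ifs with hg
  · exact le_rfl
  · simpa [two] using hg

end DyadicInterval

namespace DyadicRect

open DyadicInterval

/-- Large sides are replaced by `[0, 2)`. -/
noncomputable def clip₂ (R : DyadicRect) : DyadicRect := (clip R.1, clip R.2)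

/-- The coefficients of a Haar sum on the unit square after clipping. -/
noncomputable def clipCoef (T : Finset DyadicRect) (c : DyadicRect → ℂ) (R' : DyadicRect) : ℂ :=
  ∑ R ∈ T with clip₂ R = R', c R * ((clipRatio R.1 : ℂ) * (clipRatio R.2 : ℂ))

/-- `tsum_clip_le` in each variable, with a factor 2 each time. -/
theorem enorm_clipCoef_le {c : DyadicRect → ℂ} (h1 : ∀ J, Decays fun I => ‖c (I, J)‖ₑ)
    (h2 : ∀ I, Decays fun J => ‖c (I, J)‖ₑ) (T : Finset DyadicRect) (R' : DyadicRect) :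
    ‖clipCoef T c R'‖ₑ ≤ 4 * ‖c R'‖ₑ := by
  classical
  have hr : ∀ x : ℝ, ‖(x : ℂ)‖ₑ = ‖x‖ₑ := fun x => by
    rw [← ofReal_norm, ← ofReal_norm, Complex.norm_real]
  calc ‖clipCoef T c R'‖ₑ
      ≤ ∑ R ∈ T with clip₂ R = R', ‖c R‖ₑ * (‖clipRatio R.1‖ₑ * ‖clipRatio R.2‖ₑ) := by
        refine (enorm_sum_le _ _).trans (Finset.sum_le_sum fun R _ => ?_)
        rw [enorm_mul, enorm_mul, hr, hr]
    _ = ∑ R ∈ T, if clip R.1 = R'.1 then ‖clipRatio R.1‖ₑ *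
          (if clip R.2 = R'.2 then ‖clipRatio R.2‖ₑ * ‖c (R.1, R.2)‖ₑ else 0) else 0 := by
        rw [Finset.sum_filter]
        refine Finset.sum_congr rfl fun R _ => ?_
        by_cases e1 : clip R.1 = R'.1 <;> by_cases e2 : clip R.2 = R'.2 <;>
          simp [e1, e2, clip₂, Prod.ext_iff]
        ring
    _ ≤ ∑' R : DyadicRect, if clip R.1 = R'.1 then ‖clipRatio R.1‖ₑ *
          (if clip R.2 = R'.2 then ‖clipRatio R.2‖ₑ * ‖c (R.1, R.2)‖ₑ else 0) else 0 :=
        ENNReal.sum_le_tsum T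
    _ = ∑' I, if clip I = R'.1 then ‖clipRatio I‖ₑ *
          (∑' J, if clip J = R'.2 then ‖clipRatio J‖ₑ * ‖c (I, J)‖ₑ else 0) else 0 := by
        rw [ENNReal.tsum_prod (f := fun I J => if clip I = R'.1 then ‖clipRatio I‖ₑ *
          (if clip J = R'.2 then ‖clipRatio J‖ₑ * ‖c (I, J)‖ₑ else 0) else 0)]
        refine tsum_congr fun I => ?_
        split_ifs
        · rw [ENNReal.tsum_mul_left]
        · simp
    _ ≤ ∑' I, 2 * if clip I = R'.1 then ‖clipRatio I‖ₑ * ‖c (I, R'.2)‖ₑ else 0 := by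
        refine ENNReal.tsum_le_tsum fun I => ?_
        split_ifs
        · exact (mul_le_mul_right (tsum_clip_le (h2 I) R'.2) _).trans_eq (by ring)
        · simp
    _ ≤ 2 * (2 * ‖c (R'.1, R'.2)‖ₑ) := by
        rw [ENNReal.tsum_mul_left]
        exact mul_le_mul_right (tsum_clip_le (h1 R'.2) R'.1) _
    _ = _ := by rw [← mul_assoc]; norm_num

open Classical in
theorem haarSum_eq_clip (T : Finset DyadicRect) (c : DyadicRect → ℂ) {z : ℝ × ℝ}
    (hz : z ∈ unitRect.toSet) : haarSum T c z =
      haarSum ((T.image clip₂).filter fun R => R.toSet ⊆ toSet (two, two)) (clipCoef T c) z := by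
  rw [haarSum, haarSum, Finset.sum_filter_of_ne, ← Finset.sum_fiberwise_of_maps_to (s := T)
    (fun R hR => Finset.mem_image_of_mem clip₂ hR)]
  · refine Finset.sum_congr rfl fun R' _ => ?_
    rw [clipCoef, Finset.sum_mul]
    refine Finset.sum_congr rfl fun R hR => ?_
    rw [← (Finset.mem_filter.1 hR).2, haar, haar, haar_eq_clip R.1 hz.1, haar_eq_clip R.2 hz.2, clip₂]
    push_cast
    ring
  · intro R' hR' hne
    obtain ⟨R, -, rfl⟩ := Finset.mem_image.1 hR'
    have h0 := Complex.ofReal_ne_zero.1 (right_ne_zero_of_mul hne)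
    refine prod_mono (clip_subset_two hz.1 ?_) (clip_subset_two hz.2 ?_)
    · by_contra h
      exact left_ne_zero_of_mul h0 (haar_of_notMem h)
    · by_contra h
      exact right_ne_zero_of_mul h0 (haar_of_notMem h)

/-- On the unit square a Haar sum agrees with its clipped version, whose rectangles lie in `[0,
2)²`. The John–Nirenberg inequality then gives a bound that does not depend on `T`. -/
theorem lintegral_haarSum_pow_four_le {c : DyadicRect → ℂ} {B : ℝ≥0∞}
    (hc : IsCarleson (fun R => ‖c R‖ₑ ^ 2) B) (h1 : ∀ J, Decays fun I => ‖c (I, J)‖ₑ)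
    (h2 : ∀ I, Decays fun J => ‖c (I, J)‖ₑ) (T : Finset DyadicRect) :
    ∫⁻ z in unitRect.toSet, ‖haarSum T c z‖ₑ ^ 4 ≤
      82944 * (16 * B) ^ 2 * volume (toSet (two, two)) := by
  classical
  set T' := (T.image clip₂).filter fun R => R.toSet ⊆ toSet (two, two)
  calc ∫⁻ z in unitRect.toSet, ‖haarSum T c z‖ₑ ^ 4
      = ∫⁻ z in unitRect.toSet, ‖haarSum T' (clipCoef T c) z‖ₑ ^ 4 :=
        setLIntegral_congr_fun unitRect.measurableSet_toSet fun z hz => by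
          simp only [haarSum_eq_clip T c hz, T']
    _ ≤ ∫⁻ z, ‖haarSum T' (clipCoef T c) z‖ₑ ^ 4 := setLIntegral_le_lintegral _ _
    _ ≤ 82944 * (16 * B) ^ 2 * volume (⋃ R ∈ T', R.toSet) := by
        refine lintegral_norm_haarSum_pow_four_le fun S _ => ?_
        calc ∑ R ∈ S, ‖clipCoef T c R‖ₑ ^ 2 ≤ ∑ R ∈ S, 16 * ‖c R‖ₑ ^ 2 := by
              refine Finset.sum_le_sum fun R _ => ?_
              refine (pow_le_pow_left' (enorm_clipCoef_le h1 h2 T R) 2).trans_eq ?_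
              rw [mul_pow]; norm_num
          _ = 16 * ∑ R ∈ S, ‖c R‖ₑ ^ 2 := by rw [Finset.mul_sum]
          _ ≤ 16 * (B * volume (⋃ R ∈ S, R.toSet)) := mul_le_mul_right (hc S) _
          _ = _ := by ring
    _ ≤ 82944 * (16 * B) ^ 2 * volume (toSet (two, two)) := by
        refine mul_le_mul_right (measure_mono ?_) _
        exact iUnion₂_subset fun R hR => (Finset.mem_filter.1 hR).2

end DyadicRect

/-- An `L²` function whose Haar coefficients satisfy a Carleson condition and decay at the large
scales is in `L⁴` of the unit square. -/
theorem lintegral_pow_four_lt_top {f : L2Plane} {B : ℝ≥0∞} (hB : B ≠ ⊤)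
    (hc : DyadicRect.IsCarleson (fun R => ‖haarCoeff f R‖ₑ ^ 2) B)
    (h1 : ∀ J, DyadicInterval.Decays fun I => ‖haarCoeff f (I, J)‖ₑ)
    (h2 : ∀ I, DyadicInterval.Decays fun J => ‖haarCoeff f (I, J)‖ₑ) :
    ∫⁻ z in unitRect.toSet, ‖f z‖ₑ ^ 4 < ⊤ := by
  set c := haarCoeff f
  set P := DyadicRect.toSet (DyadicInterval.two, DyadicInterval.two)
  have hs : Filter.Tendsto (fun T : Finset DyadicRect => ∑ R ∈ T, c R • haarL2 R) Filter.atTop (nhds f) :=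
    hasSum_haarL2 f
  -- Partial Haar sums converge in `L²`, hence almost everywhere along a subsequence, and Fatou's
  -- lemma transfers the uniform fourth moment bound to `f`.
  obtain ⟨u, hu⟩ := Filter.exists_seq_tendsto (Filter.atTop : Filter (Finset DyadicRect))
  have hm := tendstoInMeasure_of_tendsto_Lp (hs.comp hu)
  obtain ⟨ns, -, hns⟩ := hm.exists_seq_tendsto_ae
  have hae : ∀ T : Finset DyadicRect, (∑ R ∈ T, c R • haarL2 R : L2Plane) =ᵐ[volume]
      DyadicRect.haarSum T c := fun T => by
    have h0 : ∀ᵐ z, ∀ N, haarL2 N z = N.haar z := ae_all_iff.2 haarL2_ae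
    have h0' : ∀ᵐ z, ∀ N, (c N • haarL2 N : L2Plane) z = c N • haarL2 N z :=
      ae_all_iff.2 fun N => Lp.coeFn_smul _ _
    filter_upwards [Lp.coeFn_finsetSum T fun N => c N • haarL2 N, h0, h0'] with z h2 h3 h4
    rw [h2, DyadicRect.haarSum, Finset.sum_apply]
    refine Finset.sum_congr rfl fun N _ => ?_
    rw [h4, h3, smul_eq_mul]
  have hlim : ∀ᵐ z, Filter.Tendsto (fun n => DyadicRect.haarSum (u (ns n)) c z) Filter.atTop
      (nhds (f z)) := by
    filter_upwards [hns, ae_all_iff.2 fun n => hae (u (ns n))] with z h3 h4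
    exact h3.congr fun n => h4 n
  have hle : ∫⁻ z in unitRect.toSet, ‖f z‖ₑ ^ 4 ≤ 82944 * (16 * B) ^ 2 * volume P := by
    calc ∫⁻ z in unitRect.toSet, ‖f z‖ₑ ^ 4
        = ∫⁻ z in unitRect.toSet, Filter.liminf (fun n =>
            ‖DyadicRect.haarSum (u (ns n)) c z‖ₑ ^ 4) Filter.atTop := by
          refine lintegral_congr_ae (ae_restrict_of_ae ?_)
          filter_upwards [hlim] with z hz
          exact ((ENNReal.continuous_pow 4).continuousAt.tendsto.comp
            ((continuous_enorm.tendsto _).comp hz)).liminf_eq.symm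
      _ ≤ Filter.liminf (fun n => ∫⁻ z in unitRect.toSet,
            ‖DyadicRect.haarSum (u (ns n)) c z‖ₑ ^ 4) Filter.atTop :=
          lintegral_liminf_le fun n => (DyadicRect.measurable_haarSum _ _).enorm.pow_const 4
      _ ≤ _ := Filter.liminf_le_of_le (by isBoundedDefault) fun x hx => by
          obtain ⟨n, hn⟩ := hx.exists
          exact hn.trans (DyadicRect.lintegral_haarSum_pow_four_le hc h1 h2 _)
  refine hle.trans_lt (ENNReal.mul_lt_top (by finiteness) (DyadicRect.volume_ne_top _).lt_top)

theorem inMulDomain_of_lintegral {φ f : L2Plane} (hφ : ∀ᵐ z, z ∉ unitRect.toSet → φ z = 0)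
    (h1 : ∫⁻ z in unitRect.toSet, ‖φ z‖ₑ ^ 4 < ⊤) (h2 : ∫⁻ z in unitRect.toSet, ‖f z‖ₑ ^ 4 < ⊤) :
    InMulDomain φ f := by
  have hm1 := (Lp.memLp φ).1
  have hm2 := (Lp.memLp f).1
  refine ⟨hm1.mul hm2, ?_⟩
  rw [eLpNorm_lt_top_iff_lintegral_rpow_enorm_lt_top two_ne_zero ENNReal.ofNat_ne_top]
  have e : ∫⁻ z, ‖φ z * f z‖ₑ ^ (2 : ℝ≥0∞).toReal =
      ∫⁻ z in unitRect.toSet, ‖φ z‖ₑ ^ 2 * ‖f z‖ₑ ^ 2 := by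
    rw [← lintegral_indicator unitRect.measurableSet_toSet]
    refine lintegral_congr_ae ?_
    filter_upwards [hφ] with z hz
    by_cases h : z ∈ unitRect.toSet
    · rw [indicator_of_mem h, ← mul_pow, ← enorm_mul]
      simp
    · rw [indicator_of_notMem h, hz h]
      simp
  rw [e]
  have h := ENNReal.sq_lintegral_mul_le (μ := volume.restrict unitRect.toSet)
    (f := fun z => ‖φ z‖ₑ ^ 2) (g := fun z => ‖f z‖ₑ ^ 2) (hm1.enorm.pow_const 2).restrict
    (hm2.enorm.pow_const 2).restrict
  simp only [← pow_mul] at h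
  have h3 := h.trans_lt (ENNReal.mul_lt_top h1 h2)
  exact (ENNReal.pow_lt_top_iff.1 h3).resolve_right two_ne_zero

/-- Shifts of `b` need not be supported in the unit square, but `φ` is, so `L⁴` bounds there
suffice. They need only the Carleson condition and the decay, and both survive because a shift
changes the moduli of the coefficients only by passage to parents. -/
theorem inCommutatorDomain {φ b : L2Plane} (hφ : MemBMOdUnit φ) (hb : MemBMOdUnit b) :
    InCommutatorDomain φ b := by
  have hφ' := ae_mem_unitRect hφ.2
  have hb' := ae_mem_unitRect hb.2
  have hsgn : ∀ I : DyadicInterval, ‖(I.sgn : ℂ)‖ₑ = 1 := fun I => by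
    rw [← ofReal_norm, Complex.norm_real, Real.norm_eq_abs, DyadicInterval.abs_sgn, ENNReal.ofReal_one]
  have hφ4 := lintegral_pow_four_lt_top (ENNReal.pow_ne_top hφ.1.2.ne) (sum_enorm_haarCoeff_sq_le φ)
    (decays_haarCoeff₁ hφ') (decays_haarCoeff₂ hφ')
  have key : ∀ (f : L2Plane) (p q : Bool), (∀ R, ‖haarCoeff f R‖ₑ = ‖haarCoeff b (DyadicRect.par₂ p q R)‖ₑ) →
      InMulDomain φ f := fun f p q h => by
    refine inMulDomain_of_lintegral hφ' hφ4 (lintegral_pow_four_lt_top (B := 4096 * bmoNorm b ^ 2)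
      (ENNReal.mul_ne_top (by finiteness) (ENNReal.pow_ne_top hb.1.2.ne)) ?_ ?_ ?_)
    · simp only [h]
      exact (sum_enorm_haarCoeff_sq_le b).comp_par₂ p q
    · intro J
      simp only [h]
      exact (decays_haarCoeff₁ hb' (DyadicInterval.par q J)).par p
    · intro I
      simp only [h]
      exact (decays_haarCoeff₂ hb' (DyadicInterval.par p I)).par q
  refine ⟨key _ false false fun R => rfl, key _ true false fun R => ?_, key _ false true fun R => ?_,
    key _ true true fun R => ?_⟩
  · rw [haarCoeff_shift₁, enorm_mul, hsgn, one_mul]; rfl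
  · rw [haarCoeff_shift₂, enorm_mul, hsgn, one_mul]; rfl
  · rw [haarCoeff_shift₂, haarCoeff_shift₁, enorm_mul, enorm_mul, hsgn, hsgn, one_mul, one_mul]; rfl

theorem theorem5p5 :
    ∃ C : ℝ≥0∞, C < ∞ ∧
      ∀ φ : L2Plane, MemLMOdUnit φ → MarginalsVanish φ →
        ∀ b : L2Plane, MemBMOdUnit b →
          InCommutatorDomain φ b ∧
          MemBMOd (shiftCommutator φ b) ∧
          bmoNorm (shiftCommutator φ b) ≤ C * lmoNorm φ * bmoNorm b := by
  refine ⟨25 * 2 ^ 21, by finiteness, fun φ hφ hm b hb => ?_⟩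
  have h := inCommutatorDomain hφ.1 hb
  have h1 := bmoNorm_shiftCommutator_le hφ.1.2 hm hb.2 h
  refine ⟨h, ⟨fun K _ => (Lp.memLp _).restrict K, h1.trans_lt ?_⟩, h1⟩
  exact ENNReal.mul_lt_top (ENNReal.mul_lt_top (by finiteness) hφ.2) hb.1.2
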